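/- Let $X$ be an oriented smooth manifold with boundary of dimension $n\ge 1$, let $i\colon Y\hookrightarrow X$ be the inclusion of a union of connected components of $\partial X$, and let $\lambda\colon X\to\mathbb R_{\ge0}$ be a smooth function that vanishes on $Y$, with $d\lambda\neq0$ at every point of $Y$, and is positive on $X\smallsetminus Y$. Orient $Y$ so that an inward normal vector followed by a positive basis of $T_yY$ is a positive basis of $T_yX$. Forms are complex valued. For $U\subset X$ open, a form $\omega$ on $U\smallsetminus Y$ is called *logarithmic* on $U$ if $\lambda\,\omega$ and $d\lambda\wedge\omega$ extend to smooth forms on $U$. For a top-degree form $\omega$ on $X\smallsetminus Y$ with relatively compact support in $X$ such that $\lambda^M\omega$ extends smoothly to $X$ for some $M$, let $I_0(\omega)$ be the residue at $s=0$ of the meromorphic continuation of $s\mapsto\int_X\lambda^s\omega$, $\operatorname{Re}s\gg0$. **Theorem.** Logarithmic forms do not depend on the choice of $\lambda$ and form a complex of sheaves $\mathcal A^{\log}_{X,Y}$ with the de Rham differential. Every logarithmic form of positive degree can locally be written as $\omega=\frac{d\lambda}{\lambda}\wedge\sigma+\tau$ with $\sigma,\tau$ smooth, and $R(\omega)=\sigma|_Y$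 does not depend on the decomposition nor on $\lambda$; put $R=0$ in degree $0$. Moreover: (i) $R\colon\mathcal A^{\log}_{X,Y}\to i_*\mathcal A_Y[-1]$ is a morphism of complexes of sheaves: $R(\omega)$ is a smooth form of degree one less, $R$ is linear and compatible with restriction to open subsets, and $R(d\omega)=-d\,R(\omega)$. (ii) For every logarithmic $p$-form $\omega$ on $X$ and every compactly supported smooth $(n-p)$-form $\varphi$ on $X$, the continuation defining $I_0(\omega\wedge\varphi)$ exists and has at most a simple pole at $s=0$, its residue $I_0(\omega\wedge\varphi)$ does not depend on $\lambda$, and $$I_0(\omega\wedge\varphi)=\int_Y R(\omega)\wedge\varphi|_Y .$$ -/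

import Mathlib

open Set Filter Topology MeasureTheory
open scoped Manifold ContDiff

noncomputable section

/-! ### Exterior algebra of a real vector space, with complex coefficients -/

section Wedge

variable {V : Type*} [AddCommGroup V] [Module ℝ V] [TopologicalSpace V]

/-- The multilinear map `(v₁, …, v_{p+q}) ↦ α(v₁, …, v_p) β(v_{p+1}, …, v_{p+q})`. -/
def mulForms {p q : ℕ} (α : V [⋀^Fin p]→L[ℝ] ℂ) (β : V [⋀^Fin q]→L[ℝ] ℂ) :
    ContinuousMultilinearMap ℝ (fun _ : Fin (p + q) => V) ℂ where
  toFun v := α (fun j => v (Fin.castAdd q j)) * β (fun j => v (Fin.natAdd p j))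
  map_update_add' := by
    intro _ v k x y
    have e : ‹DecidableEq (Fin (p + q))› = instDecidableEqFin (p + q) := Subsingleton.elim _ _
    subst e
    refine Fin.addCases (fun j => ?_) (fun j => ?_) k
    · have h1 : ∀ z : V, (fun l => Function.update v (Fin.castAdd q j) z (Fin.castAdd q l))
          = Function.update (fun l => v (Fin.castAdd q l)) j z := by
        intro z; ext l; by_cases h : l = j
        · subst h; simp
        · simp [Function.update_of_ne h,
            Function.update_of_ne (fun h' => h (Fin.castAdd_injective p q h'))]
      have h2 : ∀ z : V, (fun l => Function.update v (Fin.castAdd q j) z (Fin.natAdd p l))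
          = (fun l => v (Fin.natAdd p l)) := by
        intro z; ext l
        rw [Function.update_of_ne]
        intro h; have := congrArg Fin.val h; simp at this; omega
      simp only [h1, h2, α.map_update_add, add_mul]
    · have h1 : ∀ z : V, (fun l => Function.update v (Fin.natAdd p j) z (Fin.natAdd p l))
          = Function.update (fun l => v (Fin.natAdd p l)) j z := by
        intro z; ext l; by_cases h : l = j
        · subst h; simp
        · simp [Function.update_of_ne h,
            Function.update_of_ne (fun h' => h (Fin.natAdd_injective q p h'))]
      have h2 : ∀ z : V, (fun l => Function.update v (Fin.natAdd p j) z (Fin.castAdd q l))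
          = (fun l => v (Fin.castAdd q l)) := by
        intro z; ext l
        rw [Function.update_of_ne]
        intro h; have := congrArg Fin.val h; simp at this; omega
      simp only [h1, h2, β.map_update_add, mul_add]
  map_update_smul' := by
    intro _ v k c x
    have e : ‹DecidableEq (Fin (p + q))› = instDecidableEqFin (p + q) := Subsingleton.elim _ _
    subst e
    refine Fin.addCases (fun j => ?_) (fun j => ?_) k
    · have h1 : ∀ z : V, (fun l => Function.update v (Fin.castAdd q j) z (Fin.castAdd q l))
          = Function.update (fun l => v (Fin.castAdd q l)) j z := by
        intro z; ext l; by_cases h : l = j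
        · subst h; simp
        · simp [Function.update_of_ne h,
            Function.update_of_ne (fun h' => h (Fin.castAdd_injective p q h'))]
      have h2 : ∀ z : V, (fun l => Function.update v (Fin.castAdd q j) z (Fin.natAdd p l))
          = (fun l => v (Fin.natAdd p l)) := by
        intro z; ext l
        rw [Function.update_of_ne]
        intro h; have := congrArg Fin.val h; simp at this; omega
      simp only [h1, h2, α.map_update_smul, smul_mul_assoc]
    · have h1 : ∀ z : V, (fun l => Function.update v (Fin.natAdd p j) z (Fin.natAdd p l))
          = Function.update (fun l => v (Fin.natAdd p l)) j z := by
        intro z; ext l; by_cases h : l = j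
        · subst h; simp
        · simp [Function.update_of_ne h,
            Function.update_of_ne (fun h' => h (Fin.natAdd_injective q p h'))]
      have h2 : ∀ z : V, (fun l => Function.update v (Fin.natAdd p j) z (Fin.castAdd q l))
          = (fun l => v (Fin.castAdd q l)) := by
        intro z; ext l
        rw [Function.update_of_ne]
        intro h; have := congrArg Fin.val h; simp at this; omega
      simp only [h1, h2, β.map_update_smul, mul_smul_comm]
  cont := (α.cont.comp (continuous_pi fun j => continuous_apply _)).mul
    (β.cont.comp (continuous_pi fun j => continuous_apply _))

/-- The wedge product of a `p`-form and a `q`-form, as an `r`-form with `r = p + q`: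
`(α ∧ β)(v₁, …, v_r) = (p! q!)⁻¹ ∑_π sgn(π) α(v_{π 1}, …, v_{π p}) β(v_{π (p+1)}, …, v_{π r})`. -/
def wedge {p q r : ℕ} (h : p + q = r) (α : V [⋀^Fin p]→L[ℝ] ℂ) (β : V [⋀^Fin q]→L[ℝ] ℂ) :
    V [⋀^Fin r]→L[ℝ] ℂ :=
  ((p.factorial * q.factorial : ℝ)⁻¹) •
    ContinuousMultilinearMap.alternatization ((mulForms α β).domDomCongr (finCongr h))

end Wedge

/-! ### Differential forms on manifolds with boundary -/

section Forms

variable {E : Type*} [NormedAddCommGroup E] [NormedSpace ℝ E]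
  {H : Type*} [TopologicalSpace H] (I : ModelWithCorners ℝ E H)
  (M : Type*) [TopologicalSpace M] [ChartedSpace H M]

/-- Complex-valued differential `p`-forms (no regularity imposed) on `M`. A form on a subset of
`M` is represented by any extension of it to `M`; all notions below ignore the extension. -/
abbrev DiffForm (p : ℕ) : Type _ := ∀ x : M, TangentSpace I x [⋀^Fin p]→L[ℝ] ℂ

variable {I M} {p q : ℕ}

/-- The wedge product of differential forms. -/
def DiffForm.wedge {r : ℕ} (h : p + q = r) (α : DiffForm I M p) (β : DiffForm I M q) :
    DiffForm I M r :=
  fun x => _root_.wedge h (α x) (β x)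

/-- The pull-back of a form by a map between manifolds. -/
def DiffForm.pullback {E' : Type*} [NormedAddCommGroup E'] [NormedSpace ℝ E']
    {H' : Type*} [TopologicalSpace H'] {I' : ModelWithCorners ℝ E' H'}
    {N : Type*} [TopologicalSpace N] [ChartedSpace H' N] (f : N → M) (w : DiffForm I M p) :
    DiffForm I' N p :=
  fun y => (w (f y)).compContinuousLinearMap (mfderiv I' I f y)

/-- The expression of `w` in the chart at `x₀`: the pull-back of `w` by the inverse chart, a form
on the image of the chart in the model vector space. -/
def DiffForm.inChart (w : DiffForm I M p) (x₀ : M) : E → E [⋀^Fin p]→L[ℝ] ℂ :=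
  fun u => (w ((extChartAt I x₀).symm u)).compContinuousLinearMap
    (mfderivWithin 𝓘(ℝ, E) I (extChartAt I x₀).symm (range I) u)

/-- `w` is smooth (up to the boundary) on the open set `U`. -/
def DiffForm.SmoothOn (w : DiffForm I M p) (U : Set M) : Prop :=
  ∀ x ∈ U, ContDiffWithinAt ℝ ∞ (w.inChart x) (range I) (extChartAt I x x)

/-- The exterior derivative, computed at each point in the chart at that point. -/
def DiffForm.d (w : DiffForm I M p) : DiffForm I M (p + 1) :=
  fun x => (extDerivWithin (w.inChart x) (range I) (extChartAt I x x)).compContinuousLinearMap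
    (mfderiv I 𝓘(ℝ, E) (extChartAt I x) x)

/-- The differential `df` of a real-valued function, as a `1`-form. -/
def dForm (f : M → ℝ) : DiffForm I M 1 :=
  fun x => ContinuousAlternatingMap.ofSubsingleton ℝ (TangentSpace I x) ℂ (0 : Fin 1)
    (Complex.ofRealCLM.comp (mfderiv I 𝓘(ℝ, ℝ) f x : TangentSpace I x →L[ℝ] ℝ))

end Forms

/-! ### Orientations and integration of top-degree forms -/

/-- The sign (`1`, `0` or `-1`) of an `n`-tuple of vectors with respect to an orientation: `1` for
a positively oriented basis, `-1` for a negatively oriented one, `0` if it is not a basis. -/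
def frameSign {V : Type*} [AddCommGroup V] [Module ℝ V] {n : ℕ} (o : Orientation ℝ V (Fin n))
    (v : Fin n → V) : ℝ :=
  ((SignType.sign (Module.Ray.someVector o v) : SignType) : ℝ)

section Integration

variable {n : ℕ} {H : Type*} [TopologicalSpace H]
  (I : ModelWithCorners ℝ (EuclideanSpace ℝ (Fin n)) H)
  (M : Type*) [TopologicalSpace M] [ChartedSpace H M]

variable {M} in
/-- The coordinate frame `∂/∂u₁, …, ∂/∂u_n` of the chart at `x₀`, at the point of coordinates `u`. -/
def coordFrame (x₀ : M) (u : EuclideanSpace ℝ (Fin n)) :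
    Fin n → TangentSpace I ((extChartAt I x₀).symm u) :=
  fun j => mfderivWithin 𝓘(ℝ, EuclideanSpace ℝ (Fin n)) I (extChartAt I x₀).symm (range I) u
    (EuclideanSpace.single j (1 : ℝ))

/-- An orientation of an `n`-manifold: an orientation of every tangent space such that the sign of
the coordinate frame of each chart is locally constant. For `n = 0` this is a choice of signs. -/
structure ManifoldOrientation where
  /-- the orientation of the tangent space at a point -/
  at' : ∀ x : M, Orientation ℝ (TangentSpace I x) (Fin n)
  locally_constant : ∀ x₀ : M, ∀ᶠ u in 𝓝[range I] (extChartAt I x₀ x₀),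
    frameSign (at' ((extChartAt I x₀).symm u)) (coordFrame I x₀ u) =
      frameSign (at' ((extChartAt I x₀).symm (extChartAt I x₀ x₀)))
        (coordFrame I x₀ (extChartAt I x₀ x₀))

variable [IsManifold I ∞ M] [T2Space M] [SigmaCompactSpace M]

/-- A smooth partition of unity on `M` subordinate to the chart domains. -/
def chartPartition : SmoothPartitionOfUnity M I M univ :=
  (SmoothPartitionOfUnity.exists_isSubordinate_chartAt_source I M).choose

variable {I M}

/-- The integrand, in the oriented coordinates of the chart at `x₀`, of the part of the top form
`w` cut out by the partition of unity. -/
def chartIntegrand (o : ManifoldOrientation I M) (w : DiffForm I M n) (x₀ : M)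
    (u : EuclideanSpace ℝ (Fin n)) : ℂ :=
  (chartPartition I M x₀ ((extChartAt I x₀).symm u) *
      frameSign (o.at' ((extChartAt I x₀).symm u)) (coordFrame I x₀ u)) •
    w ((extChartAt I x₀).symm u) (coordFrame I x₀ u)

/-- The integral over the oriented manifold `M` of a top-degree form vanishing off a compact set. -/
def formIntegral (o : ManifoldOrientation I M) (w : DiffForm I M n) : ℂ :=
  ∑ᶠ x₀ : M, ∫ u in (extChartAt I x₀).target, chartIntegrand o w x₀ u

/-- Absolute convergence of `formIntegral o w`. -/
def FormIntegrable (o : ManifoldOrientation I M) (w : DiffForm I M n) : Prop :=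
  {x₀ : M | ∃ x, chartPartition I M x₀ x ≠ 0 ∧ w x ≠ 0}.Finite ∧
    ∀ x₀ : M, IntegrableOn (chartIntegrand o w x₀) (extChartAt I x₀).target

/-- `Z` is the zeta function of the top form `w`: a meromorphic function on `ℂ` which is given by
the absolutely convergent integral `∫_M lam ^ s w` for all `s` of large real part. -/
def IsZeta (o : ManifoldOrientation I M) (lam : M → ℝ) (w : DiffForm I M n) (Z : ℂ → ℂ) : Prop :=
  Meromorphic Z ∧ ∃ C : ℝ, ∀ s : ℂ, C < s.re →
    FormIntegrable o (fun x => ((lam x : ℂ) ^ s) • w x) ∧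
      Z s = formIntegral o (fun x => ((lam x : ℂ) ^ s) • w x)

/-- `I₀(w) = c`: the zeta function of `w` exists, it has at most a simple pole at `0`, and its
residue there is `c`. -/
def HasI₀ (o : ManifoldOrientation I M) (lam : M → ℝ) (w : DiffForm I M n) (c : ℂ) : Prop :=
  ∃ Z : ℂ → ℂ, IsZeta o lam w Z ∧ Tendsto (fun s => s * Z s) (𝓝[≠] 0) (𝓝 c)

end Integration

/-! ### Logarithmic forms along a part of the boundary, and their residues -/

section Log

variable {d : ℕ} {X : Type*} [TopologicalSpace X] [ChartedSpace (EuclideanHalfSpace (d + 1)) X]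
  {Y : Type*} [TopologicalSpace Y] [ChartedSpace (EuclideanSpace ℝ (Fin d)) Y]

variable (d) in
/-- `i` is the inclusion of (the `d`-manifold) `Y` as a union of connected components of the
boundary of the `(d+1)`-manifold `X`. -/
structure IsBoundaryPart (i : Y → X) : Prop where
  isEmbedding : IsEmbedding i
  contMDiff : ContMDiff (𝓡 d) (𝓡∂ (d + 1)) ∞ i
  immersion : ∀ y, Function.Injective (mfderiv (𝓡 d) (𝓡∂ (d + 1)) i y)
  range_subset : range i ⊆ (𝓡∂ (d + 1)).boundary X
  component_subset : ∀ x ∈ range i,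
    connectedComponentIn ((𝓡∂ (d + 1)).boundary X) x ⊆ range i

/-- The orientation of `Y` is the one induced by that of `X`, with the convention "inward normal
first": if `ν` points inwards and `v` is a positive basis of `T_y Y` then `(ν, v)` is a positive
basis of `T_y X`. -/
def IsBoundaryOrientation (i : Y → X) (oX : ManifoldOrientation (𝓡∂ (d + 1)) X)
    (oY : ManifoldOrientation (𝓡 d) Y) : Prop :=
  ∀ (y : Y) (ν : TangentSpace (𝓡∂ (d + 1)) (i y)) (v : Fin d → TangentSpace (𝓡 d) y),
    0 < (EuclideanSpace.proj (0 : Fin (d + 1)) : EuclideanSpace ℝ (Fin (d + 1)) →L[ℝ] ℝ)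
        (mfderiv (𝓡∂ (d + 1)) 𝓘(ℝ, EuclideanSpace ℝ (Fin (d + 1)))
          (extChartAt (𝓡∂ (d + 1)) (i y)) (i y) ν) →
    frameSign (oY.at' y) v =
      frameSign (oX.at' (i y))
        (Fin.cons ν (fun j => mfderiv (𝓡 d) (𝓡∂ (d + 1)) i y (v j)) :
          Fin (d + 1) → TangentSpace (𝓡∂ (d + 1)) (i y))

variable (d) in
/-- `lam` is a smooth function on `X` vanishing to first order on `Y` and positive elsewhere. -/
structure IsBoundaryDefining (i : Y → X) (lam : X → ℝ) : Prop where
  contMDiff : ContMDiff (𝓡∂ (d + 1)) 𝓘(ℝ, ℝ) ∞ lam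
  eq_zero : ∀ x ∈ range i, lam x = 0
  mfderiv_ne_zero : ∀ x ∈ range i, mfderiv (𝓡∂ (d + 1)) 𝓘(ℝ, ℝ) lam x ≠ 0
  pos : ∀ x ∉ range i, 0 < lam x

/-- The form `η` on `U ∖ Y` extends to a smooth form on the open set `U`. -/
def ExtendsSmoothly (i : Y → X) (U : Set X) {p : ℕ} (η : DiffForm (𝓡∂ (d + 1)) X p) : Prop :=
  ∃ η' : DiffForm (𝓡∂ (d + 1)) X p, η'.SmoothOn U ∧ ∀ x ∈ U, x ∉ range i → η' x = η x

/-- `w` is a logarithmic form on the open set `U` (a section over `U` of the sheaf of logarithmic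
forms along `Y`): `lam w` and `d lam ∧ w` extend from `U ∖ Y` to smooth forms on `U`. -/
def IsLogOn (i : Y → X) (lam : X → ℝ) (U : Set X) {p : ℕ}
    (w : DiffForm (𝓡∂ (d + 1)) X p) : Prop :=
  ExtendsSmoothly i U (fun x => lam x • w x) ∧
    ExtendsSmoothly i U (DiffForm.wedge (Nat.add_comm 1 p) (dForm lam) w)

/-- `w = (d lam / lam) ∧ σ + τ` on `U ∖ Y`, with `σ` and `τ` smooth on `U`. -/
def IsLogDecomposition (i : Y → X) (lam : X → ℝ) (U : Set X) {q : ℕ}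
    (w : DiffForm (𝓡∂ (d + 1)) X (q + 1)) (σ : DiffForm (𝓡∂ (d + 1)) X q)
    (τ : DiffForm (𝓡∂ (d + 1)) X (q + 1)) : Prop :=
  σ.SmoothOn U ∧ τ.SmoothOn U ∧ ∀ x ∈ U, x ∉ range i →
    w x = (lam x)⁻¹ • DiffForm.wedge (Nat.add_comm 1 q) (dForm lam) σ x + τ x

open Classical in
/-- The residue `R(w) = σ|_Y` of a form of positive degree: at `y`, take any decomposition
`w = (d lam / lam) ∧ σ + τ` in a neighbourhood of `y` and restrict `σ` to `Y`. (The value is `0`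
if there is no decomposition. The residue of a `0`-form lives in degree `-1`, so it is zero.) -/
def residue (i : Y → X) {q : ℕ} (w : DiffForm (𝓡∂ (d + 1)) X (q + 1)) : DiffForm (𝓡 d) Y q :=
  fun y =>
    if h : ∃ (σ : DiffForm (𝓡∂ (d + 1)) X q) (lam : X → ℝ) (U : Set X)
        (τ : DiffForm (𝓡∂ (d + 1)) X (q + 1)),
        IsBoundaryDefining d i lam ∧ IsOpen U ∧ i y ∈ U ∧ IsLogDecomposition i lam U w σ τ
    then DiffForm.pullback (I := 𝓡∂ (d + 1)) (I' := 𝓡 d) i h.choose y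
    else 0

end Log

end

/-!
The proof rests on two local facts about a boundary defining function `lam`. First, in a chart of
`X` around a point of `Y`, the boundary hyperplane consists of points of `Y` (by the inverse
function theorem, `IsBoundaryDefining.eventually_mem_range`), and `lam` is the first coordinate
times a smooth positive function by Hadamard's lemma; hence any two boundary defining functions
differ locally by a smooth positive factor (`IsBoundaryDefining.exists_eq_mul`), which gives the
independence of `lam` of the notion of logarithmic form (`IsBoundaryDefining.isLogOn_of_isLogOn`).
Second, there is near every point of `Y` a vector field `v` with `dlam v = 1`. Since contraction
with `v` is an antiderivation, `w = dlam ∧ ι_v w + ι_v (dlam ∧ w)`, and for a logarithmic form `w`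
this is a decomposition `w = (dlam / lam) ∧ σ + τ` with `σ = ι_v (lam w)` and `τ = ι_v (dlam ∧ w)`
smooth (`IsBoundaryDefining.exists_isLogDecomposition`).

As the complement of `Y` is dense, smooth extensions are unique. So they glue, and the extension of
`lam w` along `Y`, which is `dlam ∧ σ`, is determined by `w`; it determines the restriction of `σ`
to `Y` (`IsBoundaryDefining.pullback_eq_of_isLogDecomposition`). The properties of the residue
follow by computing with decompositions; for `R(dw) = -d R(w)`, one uses that
`dlam / lam = d (log lam)` is closed.

For the residue formula, a partition of unity reduces the zeta function of `w ∧ φ` to integrals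
`∫ Λ^(s-1) h` over the half-space, where `Λ` is the function `lam` in a chart and `h` is the
coordinate expression of a form that extends `lam (w ∧ φ)`. With a cut-off function one finds
smooth functions `β` and `γ` such that `(β ∂₀ + γ) Λ = 1` and such that `Λ β` vanishes on the
boundary (`exists_isFlatData`). Integration by parts along `β ∂₀` then expresses the integral at
`s` by integrals of the same kind at `s + 1`, with the factor `s⁻¹` (`IsFlatData.flatZeta_eq`).
This gives the meromorphic continuation, a pole at `0` that is at most simple, and the value of the
residue: the integral of `β h` over the boundary hyperplane, where `β` is `1 / ∂₀Λ` on `Y` and `0`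
at the other boundary points (`exists_continuation_flatZeta`). Along `Y` one has
`lam (w ∧ φ) = dlam ∧ (σ ∧ φ)`, and `dlam` cancels `1 / ∂₀Λ` on a coordinate frame whose first
vector points inwards. So the residue is the integral of `σ ∧ φ` over the boundary hyperplane
(`IsBoundaryDefining.boundaryDensity_eq`), and a change of variables to the charts of `Y`
identifies the sum over the charts of `X` with the integral over `Y`
(`IsBoundaryDefining.sum_integral_boundaryDensity`).
-/

noncomputable section

set_option linter.unusedSectionVars false

/-! ### Exterior algebra -/

section ExteriorAlgebra

/-- The signed sum of a function of `n` vectors over all permutations of its arguments. -/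
def altSum {V : Type*} {n : ℕ} (f : (Fin n → V) → ℂ) (v : Fin n → V) : ℂ :=
  ∑ π : Equiv.Perm (Fin n), ((Equiv.Perm.sign π : ℤ) : ℂ) * f (fun j => v (π j))

theorem altSum_comp_perm {V : Type*} {n : ℕ} (f : (Fin n → V) → ℂ) (τ : Equiv.Perm (Fin n))
    (v : Fin n → V) :
    altSum (fun u => f (fun j => u (τ j))) v = ((Equiv.Perm.sign τ : ℤ) : ℂ) * altSum f v := by
  unfold altSum
  rw [Finset.mul_sum]
  refine Fintype.sum_equiv (Equiv.mulRight τ) _ _ fun π => ?_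
  have h1 : ((Equiv.Perm.sign τ : ℤ) : ℂ) * ((Equiv.Perm.sign τ : ℤ) : ℂ) = 1 := by
    rw [← Int.cast_mul, ← Units.val_mul, Int.units_mul_self]; simp
  simp only [Equiv.coe_mulRight, Equiv.Perm.sign_mul, Units.val_mul, Int.cast_mul,
    Equiv.Perm.coe_mul, Function.comp_apply]
  linear_combination (-((Equiv.Perm.sign π : ℤ) : ℂ) * f (fun j => v (π (τ j)))) * h1

/-- Antisymmetrizing the first `p` arguments beforehand multiplies the signed sum over all
permutations by `p!`: the sum absorbs permutations of the first block. -/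
theorem altSum_mul_altSum_left {V : Type*} {p q : ℕ} (f : (Fin p → V) → ℂ) (g : (Fin q → V) → ℂ)
    (v : Fin (p + q) → V) :
    altSum (fun u => altSum f (fun j => u (Fin.castAdd q j)) * g (fun j => u (Fin.natAdd p j))) v
      = p.factorial *
        altSum (fun u => f (fun j => u (Fin.castAdd q j)) * g (fun j => u (Fin.natAdd p j))) v := by
  have key : ∀ τ : Equiv.Perm (Fin p), altSum (fun u => ((Equiv.Perm.sign τ : ℤ) : ℂ) *
      (f (fun j => u (Fin.castAdd q (τ j))) * g (fun j => u (Fin.natAdd p j)))) v =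
      altSum (fun u => f (fun j => u (Fin.castAdd q j)) * g (fun j => u (Fin.natAdd p j))) v := by
    intro τ
    set τ' : Equiv.Perm (Fin (p + q)) := finSumFinEquiv.permCongr (Equiv.Perm.sumCongr τ 1)
    have h1 : ∀ j, τ' (Fin.castAdd q j) = Fin.castAdd q (τ j) := fun j => by
      simp [τ', Equiv.permCongr_apply]
    have h2 : ∀ j, τ' (Fin.natAdd p j) = Fin.natAdd p j := fun j => by
      simp [τ', Equiv.permCongr_apply]
    have h3 : Equiv.Perm.sign τ' = Equiv.Perm.sign τ := by
      simp [τ', Equiv.Perm.sign_permCongr, Equiv.Perm.sign_sumCongr]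
    have h4 := altSum_comp_perm (fun u : Fin (p + q) → V =>
      f (fun j => u (Fin.castAdd q j)) * g (fun j => u (Fin.natAdd p j))) τ' v
    simp only [h1, h2, h3] at h4
    have h5 : ((Equiv.Perm.sign τ : ℤ) : ℂ) * ((Equiv.Perm.sign τ : ℤ) : ℂ) = 1 := by
      rw [← Int.cast_mul, ← Units.val_mul, Int.units_mul_self]; simp
    have h6 : ∀ F : (Fin (p + q) → V) → ℂ, altSum (fun u => ((Equiv.Perm.sign τ : ℤ) : ℂ) * F u) v
        = ((Equiv.Perm.sign τ : ℤ) : ℂ) * altSum F v := by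
      intro F; simp only [altSum, Finset.mul_sum]; exact Finset.sum_congr rfl fun _ _ => by ring
    rw [h6, h4, ← mul_assoc, h5, one_mul]
  calc _ = ∑ τ : Equiv.Perm (Fin p), altSum (fun u => ((Equiv.Perm.sign τ : ℤ) : ℂ) *
      (f (fun j => u (Fin.castAdd q (τ j))) * g (fun j => u (Fin.natAdd p j)))) v := by
        simp only [altSum, Finset.sum_mul, Finset.mul_sum]
        rw [Finset.sum_comm]
        exact Finset.sum_congr rfl fun _ _ => Finset.sum_congr rfl fun _ _ => by ring
    _ = _ := by simp [key, Fintype.card_perm]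

/-- The analogue of `altSum_mul_altSum_left` for the last `q` arguments. -/
theorem altSum_mul_altSum_right {V : Type*} {p q : ℕ} (f : (Fin p → V) → ℂ) (g : (Fin q → V) → ℂ)
    (v : Fin (p + q) → V) :
    altSum (fun u => f (fun j => u (Fin.castAdd q j)) * altSum g (fun j => u (Fin.natAdd p j))) v
      = q.factorial *
        altSum (fun u => f (fun j => u (Fin.castAdd q j)) * g (fun j => u (Fin.natAdd p j))) v := by
  have key : ∀ τ : Equiv.Perm (Fin q), altSum (fun u => ((Equiv.Perm.sign τ : ℤ) : ℂ) *
      (f (fun j => u (Fin.castAdd q j)) * g (fun j => u (Fin.natAdd p (τ j))))) v =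
      altSum (fun u => f (fun j => u (Fin.castAdd q j)) * g (fun j => u (Fin.natAdd p j))) v := by
    intro τ
    set τ' : Equiv.Perm (Fin (p + q)) := finSumFinEquiv.permCongr (Equiv.Perm.sumCongr 1 τ)
    have h1 : ∀ j, τ' (Fin.castAdd q j) = Fin.castAdd q j := fun j => by
      simp [τ', Equiv.permCongr_apply]
    have h2 : ∀ j, τ' (Fin.natAdd p j) = Fin.natAdd p (τ j) := fun j => by
      simp [τ', Equiv.permCongr_apply]
    have h3 : Equiv.Perm.sign τ' = Equiv.Perm.sign τ := by
      simp [τ', Equiv.Perm.sign_permCongr, Equiv.Perm.sign_sumCongr]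
    have h4 := altSum_comp_perm (fun u : Fin (p + q) → V =>
      f (fun j => u (Fin.castAdd q j)) * g (fun j => u (Fin.natAdd p j))) τ' v
    simp only [h1, h2, h3] at h4
    have h5 : ((Equiv.Perm.sign τ : ℤ) : ℂ) * ((Equiv.Perm.sign τ : ℤ) : ℂ) = 1 := by
      rw [← Int.cast_mul, ← Units.val_mul, Int.units_mul_self]; simp
    have h6 : ∀ F : (Fin (p + q) → V) → ℂ, altSum (fun u => ((Equiv.Perm.sign τ : ℤ) : ℂ) * F u) v
        = ((Equiv.Perm.sign τ : ℤ) : ℂ) * altSum F v := by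
      intro F; simp only [altSum, Finset.mul_sum]; exact Finset.sum_congr rfl fun _ _ => by ring
    rw [h6, h4, ← mul_assoc, h5, one_mul]
  calc _ = ∑ τ : Equiv.Perm (Fin q), altSum (fun u => ((Equiv.Perm.sign τ : ℤ) : ℂ) *
      (f (fun j => u (Fin.castAdd q j)) * g (fun j => u (Fin.natAdd p (τ j))))) v := by
        simp only [altSum, Finset.mul_sum]
        rw [Finset.sum_comm]
        exact Finset.sum_congr rfl fun _ _ => Finset.sum_congr rfl fun _ _ => by ring
    _ = _ := by simp [key, Fintype.card_perm]

variable {V : Type*} [AddCommGroup V] [Module ℝ V] [TopologicalSpace V]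
variable {W : Type*} [AddCommGroup W] [Module ℝ W] [TopologicalSpace W]

theorem wedge_apply {p q r : ℕ} (h : p + q = r) (α : V [⋀^Fin p]→L[ℝ] ℂ) (β : V [⋀^Fin q]→L[ℝ] ℂ)
    (v : Fin r → V) :
    wedge h α β v = ((p.factorial * q.factorial : ℂ))⁻¹ *
      altSum (fun u => α (fun j => u (Fin.cast h (Fin.castAdd q j))) *
        β (fun j => u (Fin.cast h (Fin.natAdd p j)))) v := by
  subst h
  simp only [wedge, ContinuousAlternatingMap.smul_apply,
    ContinuousMultilinearMap.alternatization_apply_apply, altSum]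
  rw [Complex.real_smul]
  congr 1
  · push_cast; rfl
  · refine Finset.sum_congr rfl fun π _ => ?_
    rw [Units.smul_def, zsmul_eq_mul]
    rfl

theorem wedge_add_left {p q r : ℕ} (h : p + q = r) (α α' : V [⋀^Fin p]→L[ℝ] ℂ)
    (β : V [⋀^Fin q]→L[ℝ] ℂ) : wedge h (α + α') β = wedge h α β + wedge h α' β := by
  ext v
  simp only [wedge_apply, altSum, ContinuousAlternatingMap.add_apply, add_mul, mul_add,
    Finset.sum_add_distrib]

theorem wedge_add_right {p q r : ℕ} (h : p + q = r) (α : V [⋀^Fin p]→L[ℝ] ℂ)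
    (β β' : V [⋀^Fin q]→L[ℝ] ℂ) : wedge h α (β + β') = wedge h α β + wedge h α β' := by
  ext v
  simp only [wedge_apply, altSum, ContinuousAlternatingMap.add_apply, mul_add,
    Finset.sum_add_distrib]

theorem wedge_smul_left {p q r : ℕ} (h : p + q = r) (c : ℂ) (α : V [⋀^Fin p]→L[ℝ] ℂ)
    (β : V [⋀^Fin q]→L[ℝ] ℂ) : wedge h (c • α) β = c • wedge h α β := by
  ext v
  simp only [wedge_apply, altSum, ContinuousAlternatingMap.smul_apply, smul_eq_mul, Finset.mul_sum]
  exact Finset.sum_congr rfl fun _ _ => by ring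

theorem wedge_smul_right {p q r : ℕ} (h : p + q = r) (c : ℂ) (α : V [⋀^Fin p]→L[ℝ] ℂ)
    (β : V [⋀^Fin q]→L[ℝ] ℂ) : wedge h α (c • β) = c • wedge h α β := by
  ext v
  simp only [wedge_apply, altSum, ContinuousAlternatingMap.smul_apply, smul_eq_mul, Finset.mul_sum]
  exact Finset.sum_congr rfl fun _ _ => by ring

theorem ofReal_smul_form {p : ℕ} (c : ℝ) (α : V [⋀^Fin p]→L[ℝ] ℂ) : (c : ℂ) • α = c • α := by
  ext v; simp

theorem neg_one_smul_form {p : ℕ} (α : V [⋀^Fin p]→L[ℝ] ℂ) : (-1 : ℂ) • α = -α := by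
  ext v; simp

theorem neg_one_real_smul_form {p : ℕ} (α : V [⋀^Fin p]→L[ℝ] ℂ) : (-1 : ℝ) • α = -α := by
  ext v; simp

theorem smul_zero_form {p : ℕ} (c : ℝ) : c • (0 : V [⋀^Fin p]→L[ℝ] ℂ) = 0 := by
  ext v; simp

theorem wedge_real_smul_left {p q r : ℕ} (h : p + q = r) (c : ℝ) (α : V [⋀^Fin p]→L[ℝ] ℂ)
    (β : V [⋀^Fin q]→L[ℝ] ℂ) : wedge h (c • α) β = c • wedge h α β := by
  rw [← ofReal_smul_form, wedge_smul_left, ofReal_smul_form]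

theorem wedge_real_smul_right {p q r : ℕ} (h : p + q = r) (c : ℝ) (α : V [⋀^Fin p]→L[ℝ] ℂ)
    (β : V [⋀^Fin q]→L[ℝ] ℂ) : wedge h α (c • β) = c • wedge h α β := by
  rw [← ofReal_smul_form, wedge_smul_right, ofReal_smul_form]

theorem wedge_zero_left {p q r : ℕ} (h : p + q = r) (β : V [⋀^Fin q]→L[ℝ] ℂ) :
    wedge h (0 : V [⋀^Fin p]→L[ℝ] ℂ) β = 0 := by
  ext v
  simp [wedge_apply, altSum]

theorem wedge_zero_right {p q r : ℕ} (h : p + q = r) (α : V [⋀^Fin p]→L[ℝ] ℂ) :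
    wedge h α (0 : V [⋀^Fin q]→L[ℝ] ℂ) = 0 := by
  ext v
  simp [wedge_apply, altSum]

theorem wedge_compContinuousLinearMap {p q r : ℕ} (h : p + q = r) (α : V [⋀^Fin p]→L[ℝ] ℂ)
    (β : V [⋀^Fin q]→L[ℝ] ℂ) (f : W →L[ℝ] V) :
    (wedge h α β).compContinuousLinearMap f =
      wedge h (α.compContinuousLinearMap f) (β.compContinuousLinearMap f) := by
  ext v
  simp only [ContinuousAlternatingMap.compContinuousLinearMap_apply, wedge_apply, altSum]
  rfl

/-- Expansion of `ℓ ∧ β` along the first factor, for a `1`-form `ℓ`. -/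
theorem wedge_one_apply {p : ℕ} (ℓ : V [⋀^Fin 1]→L[ℝ] ℂ) (β : V [⋀^Fin p]→L[ℝ] ℂ)
    (v : Fin (p + 1) → V) :
    wedge (Nat.add_comm 1 p) ℓ β v =
      ∑ i : Fin (p + 1), (-1) ^ (i : ℕ) * (ℓ (fun _ => v i) * β (fun j => v (i.succAbove j))) := by
  have hβ : ∀ (e : Equiv.Perm (Fin p)) (u : Fin p → V),
      β (fun j => u (e j)) = ((Equiv.Perm.sign e : ℤ) : ℂ) * β u := by
    intro e u
    have := β.toAlternatingMap.map_perm u e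
    rw [Units.smul_def, zsmul_eq_mul] at this
    exact this
  -- A permutation is determined by the image `i` of `0` and a permutation of the other arguments;
  -- by antisymmetry of `β`, the latter only contributes a factor `p!`.
  rw [wedge_apply, altSum, ← Equiv.Perm.decomposeFin.symm.sum_comp, Fintype.sum_prod_type,
    Finset.mul_sum]
  refine Finset.sum_congr rfl fun i _ => ?_
  have h0 : ∀ j : Fin 1, Fin.cast (Nat.add_comm 1 p) (Fin.castAdd p j) = 0 := fun j => by
    ext; simp
  have h1 : ∀ j : Fin p, Fin.cast (Nat.add_comm 1 p) (Fin.natAdd 1 j) = j.succ := fun j => by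
    ext; simp
  simp only [h0, h1, Equiv.Perm.decomposeFin_symm_apply_zero,
    Equiv.Perm.decomposeFin_symm_apply_succ, Equiv.Perm.decomposeFin.symm_sign]
  have h2 : ∀ e : Equiv.Perm (Fin p), β (fun j => v (Equiv.swap 0 i (e j).succ)) =
      ((Equiv.Perm.sign e : ℤ) : ℂ) * β (fun j => v (Equiv.swap 0 i j.succ)) := fun e =>
    hβ e (fun j => v (Equiv.swap 0 i j.succ))
  have h3 : (((if i = 0 then 1 else -1 : ℤˣ) : ℤ) : ℂ) * β (fun j => v (Equiv.swap 0 i j.succ)) =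
      (-1) ^ (i : ℕ) * β (fun j => v (i.succAbove j)) := by
    refine Fin.cases ?_ (fun k => ?_) i
    · simp
    · have h4 := hβ (Fin.cycleRange k) (fun j => v (k.succ.succAbove j))
      simp only [Fin.succAbove_cycleRange, Fin.sign_cycleRange] at h4
      rw [h4]
      simp [pow_succ, Fin.succ_ne_zero]
  have h5 : ∀ e : Equiv.Perm (Fin p),
      ((Equiv.Perm.sign e : ℤ) : ℂ) * ((Equiv.Perm.sign e : ℤ) : ℂ) = 1 := fun e => by
    rw [← Int.cast_mul, ← Units.val_mul, Int.units_mul_self]; simp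
  have h6 : ∀ e : Equiv.Perm (Fin p),
      (((((if i = 0 then 1 else -1 : ℤˣ) * Equiv.Perm.sign e : ℤˣ)) : ℤ) : ℂ) *
        (ℓ (fun _ => v i) * β (fun j => v (Equiv.swap 0 i (e j).succ))) =
      (-1) ^ (i : ℕ) * (ℓ (fun _ => v i) * β (fun j => v (i.succAbove j))) := by
    intro e
    rw [h2, Units.val_mul, Int.cast_mul]
    linear_combination (ℓ fun _ => v i) * h3 + (((if i = 0 then 1 else -1 : ℤˣ) : ℤ) : ℂ) *
      (ℓ fun _ => v i) * β (fun j => v (Equiv.swap 0 i j.succ)) * h5 e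
  rw [Finset.sum_congr rfl fun e _ => h6 e]
  have h7 : (p.factorial : ℂ) ≠ 0 := by exact_mod_cast p.factorial_ne_zero
  simp [Fintype.card_perm, h7]

/-- Contraction of the wedge product of a `1`-form with a form. -/
theorem wedge_one_cons {p : ℕ} (ℓ : V [⋀^Fin 1]→L[ℝ] ℂ) (β : V [⋀^Fin (p + 1)]→L[ℝ] ℂ)
    (x : V) (v : Fin (p + 1) → V) :
    wedge (Nat.add_comm 1 (p + 1)) ℓ β (Fin.cons x v) = ℓ (fun _ => x) * β v -
      ∑ i : Fin (p + 1), (-1) ^ (i : ℕ) *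
        (ℓ (fun _ => v i) * β (Fin.cons x (fun j => v (i.succAbove j)))) := by
  rw [wedge_one_apply, Fin.sum_univ_succ]
  simp only [Fin.val_zero, pow_zero, one_mul, Fin.cons_zero, Fin.succAbove_zero, Fin.cons_succ,
    Fin.val_succ, sub_eq_add_neg, ← Finset.sum_neg_distrib]
  congr 1
  refine Finset.sum_congr rfl fun i _ => ?_
  have : (fun j => (Fin.cons x v : Fin (p + 2) → V) (i.succ.succAbove j)) =
      (Fin.cons x (fun j => v (i.succAbove j)) : Fin (p + 1) → V) := by
    funext j
    refine Fin.cases ?_ (fun k => ?_) j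
    · simp
    · simp [Fin.succ_succAbove_succ]
  rw [this, pow_succ]; ring

/-- If the `1`-form `ℓ` kills all the vectors but the first, only one term of `ℓ ∧ β` survives. -/
theorem wedge_one_cons_of_forall_eq_zero {p : ℕ} (ℓ : V [⋀^Fin 1]→L[ℝ] ℂ)
    (β : V [⋀^Fin p]→L[ℝ] ℂ) (x : V) (v : Fin p → V) (h : ∀ j, ℓ (fun _ => v j) = 0) :
    wedge (Nat.add_comm 1 p) ℓ β (Fin.cons x v) = ℓ (fun _ => x) * β v := by
  rw [wedge_one_apply, Fin.sum_univ_succ]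
  simp [h]

/-- Associativity of the wedge product, with a first factor of degree `1`. -/
theorem wedge_assoc_one {q r d : ℕ} (h : q + 1 + r = d + 1) (h' : q + r = d)
    (ℓ : V [⋀^Fin 1]→L[ℝ] ℂ) (σ : V [⋀^Fin q]→L[ℝ] ℂ) (φ : V [⋀^Fin r]→L[ℝ] ℂ) :
    wedge h (wedge (Nat.add_comm 1 q) ℓ σ) φ = wedge (Nat.add_comm 1 d) ℓ (wedge h' σ φ) := by
  have general : ∀ (a b c ab bc abc : ℕ) (h1 : a + b = ab) (h2 : ab + c = abc) (h3 : b + c = bc)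
      (h4 : a + bc = abc) (α : V [⋀^Fin a]→L[ℝ] ℂ) (β : V [⋀^Fin b]→L[ℝ] ℂ)
      (γ : V [⋀^Fin c]→L[ℝ] ℂ), wedge h2 (wedge h1 α β) γ = wedge h4 α (wedge h3 β γ) := by
    intro a b c ab bc abc h1 h2 h3 h4 α β γ
    subst h1 h2 h3
    ext v
    -- Both sides equal `(a! b! c!)⁻¹` times the signed sum of `α β γ` over all permutations.
    have e1 : wedge rfl (wedge rfl α β) γ v = ((a.factorial * b.factorial * c.factorial : ℂ))⁻¹ *
        altSum (fun u => α (fun j => u (Fin.castAdd c (Fin.castAdd b j))) *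
          β (fun j => u (Fin.castAdd c (Fin.natAdd a j))) * γ (fun j => u (Fin.natAdd (a + b) j)))
          v := by
      rw [wedge_apply]
      simp only [wedge_apply, Fin.cast_refl, id_eq]
      have := altSum_mul_altSum_left (p := a + b) (q := c)
        (fun u : Fin (a + b) → V => ((a.factorial * b.factorial : ℂ))⁻¹ *
          (α (fun j => u (Fin.castAdd b j)) * β (fun j => u (Fin.natAdd a j)))) (fun u => γ u) v
      have e : ∀ (k : ℂ) {n : ℕ} (F : (Fin n → V) → ℂ) (v : Fin n → V),
          altSum (fun u => k * F u) v = k * altSum F v := by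
        intro k n F v; simp only [altSum, Finset.mul_sum]
        exact Finset.sum_congr rfl fun _ _ => by ring
      simp only [e, mul_assoc] at this ⊢
      rw [this]
      have h7 : ((a + b).factorial : ℂ) ≠ 0 := by exact_mod_cast (a + b).factorial_ne_zero
      field_simp
    have e2 : wedge h4 α (wedge rfl β γ) v = ((a.factorial * b.factorial * c.factorial : ℂ))⁻¹ *
        altSum (fun u => α (fun j => u (Fin.castAdd c (Fin.castAdd b j))) *
          β (fun j => u (Fin.castAdd c (Fin.natAdd a j))) * γ (fun j => u (Fin.natAdd (a + b) j)))
          v := by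
      rw [wedge_apply]
      simp only [wedge_apply, Fin.cast_refl, id_eq]
      have := altSum_mul_altSum_right (p := a) (q := b + c) (fun u => α u)
        (fun u : Fin (b + c) → V => ((b.factorial * c.factorial : ℂ))⁻¹ *
          (β (fun j => u (Fin.castAdd c j)) * γ (fun j => u (Fin.natAdd b j))))
          (fun j => v (Fin.cast h4 j))
      have e : ∀ (k : ℂ) {n : ℕ} (F : (Fin n → V) → ℂ) (v : Fin n → V),
          altSum (fun u => k * F u) v = k * altSum F v := by
        intro k n F v; simp only [altSum, Finset.mul_sum]
        exact Finset.sum_congr rfl fun _ _ => by ring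
      have e' : ∀ (n m : ℕ) (hnm : n = m) (F : (Fin n → V) → ℂ) (v : Fin m → V),
          altSum (fun u => F (fun j => u (Fin.cast hnm j))) v =
            altSum F (fun j => v (Fin.cast hnm j)) := by
        intro n m hnm F v; subst hnm; rfl
      have e'' := e' _ _ h4 (fun u => α (fun j => u (Fin.castAdd (b + c) j)) *
        ((b.factorial * c.factorial : ℂ)⁻¹ * altSum (fun u => β (fun j => u (Fin.castAdd c j)) *
          γ (fun j => u (Fin.natAdd b j))) (fun j => u (Fin.natAdd a j)))) v
      rw [e'']
      simp only [e] at this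
      rw [this, ← e' _ _ h4]
      have h7 : ((b + c).factorial : ℂ) ≠ 0 := by exact_mod_cast (b + c).factorial_ne_zero
      have e3 : ∀ u : Fin (a + b + c) → V,
          α (fun j => u (Fin.cast h4 (Fin.castAdd (b + c) j))) *
            ((b.factorial * c.factorial : ℂ)⁻¹ *
              (β (fun j => u (Fin.cast h4 (Fin.natAdd a (Fin.castAdd c j)))) *
              γ (fun j => u (Fin.cast h4 (Fin.natAdd a (Fin.natAdd b j)))))) =
          (b.factorial * c.factorial : ℂ)⁻¹ *
          (α (fun j => u (Fin.castAdd c (Fin.castAdd b j))) *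
          β (fun j => u (Fin.castAdd c (Fin.natAdd a j))) *
            γ (fun j => u (Fin.natAdd (a + b) j))) := by
        intro u
        have i1 : ∀ j, Fin.cast h4 (Fin.castAdd (b + c) j) = Fin.castAdd c (Fin.castAdd b j) :=
          fun j => by ext; simp
        have i2 : ∀ j, Fin.cast h4 (Fin.natAdd a (Fin.castAdd c j)) =
            Fin.castAdd c (Fin.natAdd a j) := fun j => by ext; simp
        have i3 : ∀ j, Fin.cast h4 (Fin.natAdd a (Fin.natAdd b j)) =
            Fin.natAdd (a + b) j := fun j => by ext; simp [Nat.add_assoc]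
        simp only [i1, i2, i3]; ring
      simp only [e3, e]
      field_simp
    rw [e1, e2]
  exact general _ _ _ _ _ _ _ _ _ _ _ _ _

end ExteriorAlgebra

/-! ### Smooth families of alternating forms -/

section Smoothness

variable {E : Type*} [NormedAddCommGroup E] [NormedSpace ℝ E]
variable {V : Type*} [NormedAddCommGroup V] [NormedSpace ℝ V]

theorem ContDiffWithinAt.form_apply {p : ℕ} {n : WithTop ℕ∞} {f : E → V [⋀^Fin p]→L[ℝ] ℂ}
    {s : Set E} {x : E} (h : ContDiffWithinAt ℝ n f s x) (v : Fin p → V) :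
    ContDiffWithinAt ℝ n (fun y => f y v) s x :=
  (ContinuousAlternatingMap.apply ℝ V ℂ v).contDiff.contDiffAt.comp_contDiffWithinAt x h

variable [FiniteDimensional ℝ V]

/-- A form-valued map is smooth as soon as its values on all tuples of vectors are: on a
finite-dimensional space, a form is a linear function of its values on tuples of basis vectors. -/
theorem contDiffWithinAt_form_of_apply {p : ℕ} {n : WithTop ℕ∞} {f : E → V [⋀^Fin p]→L[ℝ] ℂ}
    {s : Set E} {x : E} (h : ∀ v : Fin p → V, ContDiffWithinAt ℝ n (fun y => f y v) s x) :
    ContDiffWithinAt ℝ n f s x := by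
  classical
  let b := Module.finBasis ℝ V
  -- Evaluation on tuples of basis vectors is an injective linear map to a space of functions, so
  -- it has a linear left inverse.
  let ev : (V [⋀^Fin p]→L[ℝ] ℂ) →ₗ[ℝ] ((Fin p → Fin (Module.finrank ℝ V)) → ℂ) :=
    { toFun := fun α k => α (fun j => b (k j))
      map_add' := fun _ _ => rfl
      map_smul' := fun _ _ => rfl }
  have hev : Function.Injective ev := by
    intro α β hαβ
    have : α.toAlternatingMap = β.toAlternatingMap := by
      refine Module.Basis.ext_alternating b fun k _ => ?_
      exact congrFun hαβ k
    exact ContinuousAlternatingMap.toAlternatingMap_injective this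
  have : FiniteDimensional ℝ (V [⋀^Fin p]→L[ℝ] ℂ) := FiniteDimensional.of_injective ev hev
  obtain ⟨g, hg⟩ := ev.exists_leftInverse_of_injective (LinearMap.ker_eq_bot.2 hev)
  have h1 : f = fun y => (LinearMap.toContinuousLinearMap g) (fun k => f y (fun j => b (k j))) := by
    funext y
    exact (LinearMap.congr_fun hg (f y)).symm
  rw [h1]
  refine (ContinuousLinearMap.contDiff _).contDiffAt.comp_contDiffWithinAt x ?_
  exact contDiffWithinAt_pi.2 fun k => h _

theorem ContDiffWithinAt.wedge {p q r : ℕ} (hr : p + q = r) {n : WithTop ℕ∞}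
    {f : E → V [⋀^Fin p]→L[ℝ] ℂ} {g : E → V [⋀^Fin q]→L[ℝ] ℂ}
    {s : Set E} {x : E} (hf : ContDiffWithinAt ℝ n f s x) (hg : ContDiffWithinAt ℝ n g s x) :
    ContDiffWithinAt ℝ n (fun y => _root_.wedge hr (f y) (g y)) s x := by
  refine contDiffWithinAt_form_of_apply fun v => ?_
  simp only [wedge_apply, altSum]
  refine contDiffWithinAt_const.mul (ContDiffWithinAt.sum fun π _ => ?_)
  exact contDiffWithinAt_const.mul ((hf.form_apply _).mul (hg.form_apply _))

theorem ContDiffWithinAt.form_compContinuousLinearMap {F : Type*} [NormedAddCommGroup F]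
    [NormedSpace ℝ F] [FiniteDimensional ℝ F] {p : ℕ} {n : WithTop ℕ∞}
    {f : E → V [⋀^Fin p]→L[ℝ] ℂ} {g : E → F →L[ℝ] V}
    {s : Set E} {x : E} (hf : ContDiffWithinAt ℝ n f s x) (hg : ContDiffWithinAt ℝ n g s x) :
    ContDiffWithinAt ℝ n (fun y => (f y).compContinuousLinearMap (g y)) s x := by
  refine contDiffWithinAt_form_of_apply fun v => ?_
  have h1 : ContDiffWithinAt ℝ n (fun y =>
      (ContinuousMultilinearMap.compContinuousLinearMapContinuousMultilinear ℝ
        (fun _ : Fin p => F) (fun _ => V) ℂ) (fun _ => g y)) s x :=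
    (ContinuousMultilinearMap.contDiff _).contDiffAt.comp_contDiffWithinAt x
      (contDiffWithinAt_pi.2 fun _ => hg)
  have h2 : ContDiffWithinAt ℝ n (fun y => (f y).toContinuousMultilinearMap) s x :=
    (ContinuousAlternatingMap.toContinuousMultilinearMapLI (𝕜 := ℝ) (E := V) (F := ℂ)
      (ι := Fin p)).contDiff.contDiffAt.comp_contDiffWithinAt x hf
  exact (ContinuousMultilinearMap.apply ℝ (fun _ : Fin p => F) ℂ
    v).contDiff.contDiffAt.comp_contDiffWithinAt x (h1.clm_apply h2)

end Smoothness

/-! ### Smooth differential forms on manifolds -/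

section FormsOnManifolds

variable {E : Type*} [NormedAddCommGroup E] [NormedSpace ℝ E] [FiniteDimensional ℝ E]
  {H : Type*} [TopologicalSpace H] {I : ModelWithCorners ℝ E H}
  {M : Type*} [TopologicalSpace M] [ChartedSpace H M] [IsManifold I ∞ M]
  {E' : Type*} [NormedAddCommGroup E'] [NormedSpace ℝ E'] [FiniteDimensional ℝ E']
  {H' : Type*} [TopologicalSpace H'] {I' : ModelWithCorners ℝ E' H'}
  {N : Type*} [TopologicalSpace N] [ChartedSpace H' N] [IsManifold I' ∞ N]
  {p q r : ℕ}

theorem two_le_infty : minSmoothness ℝ 2 ≤ (∞ : WithTop ℕ∞) := by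
  rw [minSmoothness_of_isRCLikeNormedField]
  exact WithTop.coe_le_coe.2 (le_top : (2 : ℕ∞) ≤ ⊤)

namespace DiffForm

/-- Smoothness of a form at a point, in the chart at that point. -/
def SmoothAt (w : DiffForm I M p) (x : M) : Prop :=
  ContDiffWithinAt ℝ ∞ (w.inChart x) (range I) (extChartAt I x x)

/-- Forms are evaluated on vectors of the model space, with which every tangent space is identified;
this allows to replace the base point by an equal one. -/
theorem congr_point (w : DiffForm I M p) {x x' : M} (h : x = x') (v : Fin p → E) :
    (w x : (Fin p → E) → ℂ) v = (w x' : (Fin p → E) → ℂ) v := by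
  subst h; rfl

theorem isManifold_one : IsManifold I 1 M := IsManifold.of_le (n := ∞) (by simp)

/-- A form is recovered from its expression in a chart. -/
theorem eq_inChart (w : DiffForm I M p) {x₀ x : M} (hx : x ∈ (extChartAt I x₀).source) :
    w x = (w.inChart x₀ (extChartAt I x₀ x)).compContinuousLinearMap
      (mfderiv I 𝓘(ℝ, E) (extChartAt I x₀) x) := by
  have : IsManifold I 1 M := isManifold_one
  ext v
  have h1 := mfderivWithin_extChartAt_symm_comp_mfderiv_extChartAt' (I := I) hx
  have h2 : ∀ a : E, (mfderivWithin 𝓘(ℝ, E) I (extChartAt I x₀).symm (range I)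
      (extChartAt I x₀ x) : E →L[ℝ] E)
        ((mfderiv I 𝓘(ℝ, E) (extChartAt I x₀) x : E →L[ℝ] E) a) = a :=
    fun a => congrArg (fun L : E →L[ℝ] E => L a) h1
  have h3 := congr_point w ((extChartAt I x₀).left_inv hx).symm v
  refine h3.trans ?_
  exact (congrArg (w ((extChartAt I x₀).symm (extChartAt I x₀ x)) : (Fin p → E) → ℂ)
    (funext fun j => h2 (v j))).symm

/-- The pull-back of a form by a map out of a vector space, computed in a chart. -/
theorem comp_mfderivWithin (w : DiffForm I M p) {x₀ : M} {g : E' → M} {s : Set E'} {u : E'}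
    (hs : UniqueDiffWithinAt ℝ s u) (hg : MDifferentiableWithinAt 𝓘(ℝ, E') I g s u)
    (hu : g u ∈ (extChartAt I x₀).source) :
    ((w (g u)).compContinuousLinearMap (mfderivWithin 𝓘(ℝ, E') I g s u) : E' [⋀^Fin p]→L[ℝ] ℂ) =
      (w.inChart x₀ (extChartAt I x₀ (g u))).compContinuousLinearMap
        (fderivWithin ℝ (extChartAt I x₀ ∘ g) s u) := by
  have : IsManifold I 1 M := isManifold_one
  have h1 : fderivWithin ℝ (extChartAt I x₀ ∘ g) s u =
      ((mfderiv I 𝓘(ℝ, E) (extChartAt I x₀) (g u)).comp (mfderivWithin 𝓘(ℝ, E') I g s u) :) := by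
    rw [← mfderivWithin_eq_fderivWithin]
    exact mfderiv_comp_mfderivWithin u (mdifferentiableAt_extChartAt (by simpa using hu)) hg
      (uniqueMDiffWithinAt_iff_uniqueDiffWithinAt.2 hs)
  rw [h1, eq_inChart w hu]
  rfl

theorem uniqueDiffWithinAt_of_mem_target {x₀ : M} {u : E} (hu : u ∈ (extChartAt I x₀).target) :
    UniqueDiffWithinAt ℝ (range I) u :=
  I.uniqueDiffOn u (extChartAt_target_subset_range x₀ hu)

theorem extChartAt_mem_range (x₀ x : M) : extChartAt I x₀ x ∈ range I := by
  simp

/-- The transformation rule for the expressions of a form in two charts. -/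
theorem inChart_coordChange (w : DiffForm I M p) {x₀ x₁ : M} {u : E}
    (hu : u ∈ (extChartAt I x₁).target)
    (hu' : (extChartAt I x₁).symm u ∈ (extChartAt I x₀).source) :
    w.inChart x₁ u =
      (w.inChart x₀ ((extChartAt I x₀ ∘ (extChartAt I x₁).symm) u)).compContinuousLinearMap
      (fderivWithin ℝ (extChartAt I x₀ ∘ (extChartAt I x₁).symm) (range I) u) := by
  have : IsManifold I 1 M := isManifold_one
  exact comp_mfderivWithin w (uniqueDiffWithinAt_of_mem_target hu)
    (mdifferentiableWithinAt_extChartAt_symm hu) hu'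

theorem contDiffWithinAt_coordChange {x₀ x₁ x : M} (h₀ : x ∈ (extChartAt I x₀).source)
    (h₁ : x ∈ (extChartAt I x₁).source) :
    ContDiffWithinAt ℝ ∞ (extChartAt I x₀ ∘ (extChartAt I x₁).symm) (range I)
      (extChartAt I x₁ x) := by
  apply contDiffWithinAt_ext_coord_change
  rw [PartialEquiv.trans_source]
  refine ⟨(extChartAt I x₁).map_source h₁, ?_⟩
  simpa only [mem_preimage, PartialEquiv.symm_symm, (extChartAt I x₁).left_inv h₁] using h₀

/-- A property that holds near `x` holds, in a chart, near the coordinates of `x`. -/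
theorem eventually_mem_target {x₀ x : M} (h₀ : x ∈ (extChartAt I x₀).source) {s : Set M}
    (hs : s ∈ 𝓝 x) :
    ∀ᶠ u in 𝓝[range I] (extChartAt I x₀ x), u ∈ (extChartAt I x₀).target ∧
      (extChartAt I x₀).symm u ∈ s := by
  refine Filter.Eventually.and (extChartAt_target_mem_nhdsWithin' h₀) ?_
  have := (continuousAt_extChartAt_symm' h₀).tendsto
  rw [(extChartAt I x₀).left_inv h₀] at this
  exact (this.mono_left nhdsWithin_le_nhds).eventually hs

theorem inChart_eventuallyEq_coordChange (w : DiffForm I M p) {x₀ x₁ x : M}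
    (h₀ : x ∈ (extChartAt I x₀).source) (h₁ : x ∈ (extChartAt I x₁).source) :
    w.inChart x₁ =ᶠ[𝓝[range I] (extChartAt I x₁ x)] fun u =>
      (w.inChart x₀ ((extChartAt I x₀ ∘ (extChartAt I x₁).symm) u)).compContinuousLinearMap
      (fderivWithin ℝ (extChartAt I x₀ ∘ (extChartAt I x₁).symm) (range I) u) := by
  filter_upwards [eventually_mem_target h₁ (extChartAt_source_mem_nhds' h₀)] with u hu
  exact inChart_coordChange w hu.1 hu.2

/-- Smoothness of a form in a chart does not depend on the chart. -/
theorem contDiffWithinAt_inChart_of (w : DiffForm I M p) {x₀ x₁ x : M}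
    (h₀ : x ∈ (extChartAt I x₀).source) (h₁ : x ∈ (extChartAt I x₁).source)
    (h : ContDiffWithinAt ℝ ∞ (w.inChart x₀) (range I) (extChartAt I x₀ x)) :
    ContDiffWithinAt ℝ ∞ (w.inChart x₁) (range I) (extChartAt I x₁ x) := by
  have hτ := contDiffWithinAt_coordChange h₀ h₁
  have hmem := extChartAt_mem_range (I := I) x₁ x
  have e : (extChartAt I x₀ ∘ (extChartAt I x₁).symm) (extChartAt I x₁ x) = extChartAt I x₀ x := by
    rw [Function.comp_apply, (extChartAt I x₁).left_inv h₁]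
  refine ContDiffWithinAt.congr_of_eventuallyEq ?_ (inChart_eventuallyEq_coordChange w h₀ h₁)
    ((inChart_eventuallyEq_coordChange w h₀ h₁).self_of_nhdsWithin hmem)
  refine ContDiffWithinAt.form_compContinuousLinearMap ?_ ?_
  · refine ContDiffWithinAt.comp (g := w.inChart x₀) (t := range I) _ ?_ hτ
      fun u _ => extChartAt_mem_range _ _
    rw [e]; exact h
  · exact hτ.fderivWithin_right I.uniqueDiffOn (by simp) hmem

theorem SmoothAt.contDiffWithinAt {w : DiffForm I M p} {x : M} (h : w.SmoothAt x) {x₀ : M}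
    (h₀ : x ∈ (extChartAt I x₀).source) :
    ContDiffWithinAt ℝ ∞ (w.inChart x₀) (range I) (extChartAt I x₀ x) :=
  contDiffWithinAt_inChart_of w (mem_extChartAt_source x) h₀ h

theorem smoothAt_of_contDiffWithinAt {w : DiffForm I M p} {x x₀ : M}
    (h₀ : x ∈ (extChartAt I x₀).source)
    (h : ContDiffWithinAt ℝ ∞ (w.inChart x₀) (range I) (extChartAt I x₀ x)) : w.SmoothAt x :=
  contDiffWithinAt_inChart_of w h₀ (mem_extChartAt_source x) h

theorem inChart_eventuallyEq {w w' : DiffForm I M p} {x₀ x : M}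
    (h₀ : x ∈ (extChartAt I x₀).source) (h : ∀ᶠ z in 𝓝 x, w z = w' z) :
    w.inChart x₀ =ᶠ[𝓝[range I] (extChartAt I x₀ x)] w'.inChart x₀ := by
  filter_upwards [eventually_mem_target h₀ h] with u hu
  have := hu.2
  simp only [inChart]
  rw [this]

theorem SmoothAt.congr {w w' : DiffForm I M p} {x : M} (hw : w.SmoothAt x)
    (h : ∀ᶠ z in 𝓝 x, w' z = w z) : w'.SmoothAt x := by
  have := inChart_eventuallyEq (mem_extChartAt_source (I := I) x) h
  exact ContDiffWithinAt.congr_of_eventuallyEq hw this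
    (this.self_of_nhdsWithin (extChartAt_mem_range _ _))

theorem SmoothAt.add {w w' : DiffForm I M p} {x : M} (hw : w.SmoothAt x) (hw' : w'.SmoothAt x) :
    SmoothAt (fun z => w z + w' z) x :=
  ContDiffWithinAt.add hw hw'

theorem contDiffWithinAt_comp_symm {F : Type*} [NormedAddCommGroup F] [NormedSpace ℝ F]
    {f : M → F} {x x₀ : M} (h₀ : x ∈ (extChartAt I x₀).source)
    (hf : ContMDiffAt I 𝓘(ℝ, F) ∞ f x) :
    ContDiffWithinAt ℝ ∞ (f ∘ (extChartAt I x₀).symm) (range I) (extChartAt I x₀ x) := by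
  have := (contMDiffAt_iff_of_mem_source (x := x₀) (y := f x) (x' := x)
    (by simpa using h₀) (mem_chart_source _ _)).1 hf
  simpa [Function.comp_def] using! this.2

theorem SmoothAt.smul {f : M → ℝ} {w : DiffForm I M p} {x : M}
    (hf : ContMDiffAt I 𝓘(ℝ, ℝ) ∞ f x) (hw : w.SmoothAt x) : SmoothAt (fun z => f z • w z) x :=
  ContDiffWithinAt.smul (contDiffWithinAt_comp_symm (mem_extChartAt_source x) hf) hw

theorem SmoothAt.const_smul {w : DiffForm I M p} {x : M} (c : ℂ) (hw : w.SmoothAt x) :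
    SmoothAt (fun z => c • w z) x :=
  ContDiffWithinAt.const_smul c hw

theorem smoothAt_zero {x : M} : SmoothAt (fun _ => 0 : DiffForm I M p) x :=
  contDiffWithinAt_const (c := (0 : E [⋀^Fin p]→L[ℝ] ℂ))

theorem inChart_wedge (h : p + q = r) (α : DiffForm I M p) (β : DiffForm I M q) (x₀ : M) (u : E) :
    (wedge h α β).inChart x₀ u = _root_.wedge h (α.inChart x₀ u) (β.inChart x₀ u) :=
  wedge_compContinuousLinearMap h _ _ _

theorem SmoothAt.wedge (h : p + q = r) {α : DiffForm I M p} {β : DiffForm I M q} {x : M}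
    (hα : α.SmoothAt x) (hβ : β.SmoothAt x) : (DiffForm.wedge h α β).SmoothAt x := by
  have : (DiffForm.wedge h α β).inChart x = fun u =>
      _root_.wedge h (α.inChart x u) (β.inChart x u) := funext fun u => inChart_wedge h α β x u
  rw [SmoothAt, this]
  exact ContDiffWithinAt.wedge h hα hβ

theorem inChart_dForm {f : M → ℝ} {x₀ : M} {u : E} (hu : u ∈ (extChartAt I x₀).target)
    (hf : MDifferentiableAt I 𝓘(ℝ, ℝ) f ((extChartAt I x₀).symm u)) :
    (dForm f : DiffForm I M 1).inChart x₀ u =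
      ContinuousAlternatingMap.ofSubsingleton ℝ E ℂ (0 : Fin 1)
        (Complex.ofRealCLM.comp (fderivWithin ℝ (f ∘ (extChartAt I x₀).symm) (range I) u)) := by
  have : IsManifold I 1 M := isManifold_one
  have h1 : fderivWithin ℝ (f ∘ (extChartAt I x₀).symm) (range I) u =
      ((mfderiv I 𝓘(ℝ, ℝ) f ((extChartAt I x₀).symm u)).comp
        (mfderivWithin 𝓘(ℝ, E) I (extChartAt I x₀).symm (range I) u) :) := by
    rw [← mfderivWithin_eq_fderivWithin]
    exact mfderiv_comp_mfderivWithin u hf (mdifferentiableWithinAt_extChartAt_symm hu)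
      (uniqueMDiffWithinAt_iff_uniqueDiffWithinAt.2 (uniqueDiffWithinAt_of_mem_target hu))
  rw [h1]
  ext v
  rfl

theorem smoothAt_dForm {f : M → ℝ} {x : M} (hf : ContMDiffAt I 𝓘(ℝ, ℝ) ∞ f x) :
    (dForm f : DiffForm I M 1).SmoothAt x := by
  have hx := mem_extChartAt_source (I := I) x
  have h1 : ∀ᶠ z in 𝓝 x, MDifferentiableAt I 𝓘(ℝ, ℝ) f z := by
    have : ∀ᶠ z in 𝓝 x, ContMDiffAt I 𝓘(ℝ, ℝ) 1 f z :=
      (contMDiffAt_iff_contMDiffAt_nhds (by simp)).1 (hf.of_le (by simp))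
    exact this.mono fun z hz => hz.mdifferentiableAt one_ne_zero
  have h2 : (dForm f : DiffForm I M 1).inChart x =ᶠ[𝓝[range I] (extChartAt I x x)] fun u =>
      ContinuousAlternatingMap.ofSubsingleton ℝ E ℂ (0 : Fin 1)
        (Complex.ofRealCLM.comp (fderivWithin ℝ (f ∘ (extChartAt I x).symm) (range I) u)) := by
    filter_upwards [eventually_mem_target hx h1] with u hu
    exact inChart_dForm hu.1 hu.2
  refine ContDiffWithinAt.congr_of_eventuallyEq ?_ h2
    (h2.self_of_nhdsWithin (extChartAt_mem_range _ _))
  have h3 : ContDiffWithinAt ℝ ∞ (fderivWithin ℝ (f ∘ (extChartAt I x).symm) (range I))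
      (range I) (extChartAt I x x) :=
    (contDiffWithinAt_comp_symm hx hf).fderivWithin_right I.uniqueDiffOn (by simp)
      (extChartAt_mem_range _ _)
  refine contDiffWithinAt_form_of_apply fun v => ?_
  exact Complex.ofRealCLM.contDiff.contDiffAt.comp_contDiffWithinAt _
    (h3.clm_apply contDiffWithinAt_const)

/-! ### The exterior derivative -/

theorem mem_closure_interior_range {x₀ x : M} :
    extChartAt I x₀ x ∈ closure (interior (range I)) :=
  I.range_subset_closure_interior (extChartAt_mem_range _ _)

/-- The exterior derivative can be computed in any chart. -/
theorem inChart_d {w : DiffForm I M p} {x₀ x : M} (h₀ : x ∈ (extChartAt I x₀).source)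
    (hw : w.SmoothAt x) :
    w.d.inChart x₀ (extChartAt I x₀ x) =
      extDerivWithin (w.inChart x₀) (range I) (extChartAt I x₀ x) := by
  have : IsManifold I 1 M := isManifold_one
  have hx := mem_extChartAt_source (I := I) x
  have hl := (extChartAt I x₀).left_inv h₀
  have hu := (extChartAt I x₀).map_source h₀
  have hmem := extChartAt_mem_range (I := I) x₀ x
  have hτ := contDiffWithinAt_coordChange (I := I) hx h₀
  have e : (extChartAt I x ∘ (extChartAt I x₀).symm) (extChartAt I x₀ x) = extChartAt I x x := by
    rw [Function.comp_apply, hl]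
  have h1 := inChart_eventuallyEq_coordChange w hx h₀
  rw [h1.extDerivWithin_eq_of_mem hmem]
  have h2 := extDerivWithin_pullback (t := range I) (r := ∞)
    (show DifferentiableWithinAt ℝ (w.inChart x) (range I)
      ((extChartAt I x ∘ (extChartAt I x₀).symm) (extChartAt I x₀ x)) by
        rw [e]; exact ContDiffWithinAt.differentiableWithinAt hw (by simp)) hτ
    two_le_infty I.uniqueDiffOn
    mem_closure_interior_range hmem (fun u _ => extChartAt_mem_range _ _)
  rw [h2]
  have h3 : fderivWithin ℝ (extChartAt I x ∘ (extChartAt I x₀).symm) (range I) (extChartAt I x₀ x) =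
      ((mfderiv I 𝓘(ℝ, E) (extChartAt I x) ((extChartAt I x₀).symm (extChartAt I x₀ x))).comp
        (mfderivWithin 𝓘(ℝ, E) I (extChartAt I x₀).symm (range I) (extChartAt I x₀ x)) :) := by
    rw [← mfderivWithin_eq_fderivWithin]
    refine mfderiv_comp_mfderivWithin _ (mdifferentiableAt_extChartAt ?_)
      (mdifferentiableWithinAt_extChartAt_symm hu)
      (uniqueMDiffWithinAt_iff_uniqueDiffWithinAt.2 (uniqueDiffWithinAt_of_mem_target hu))
    rw [hl]; simp
  rw [h3, e]
  ext v
  have h4 : ∀ x' : M, x' = x → ∀ L : E →L[ℝ] E,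
      (w.d x' : (Fin (p + 1) → E) → ℂ) (fun j => L (v j)) =
      extDerivWithin (w.inChart x) (range I) (extChartAt I x x) (fun j =>
        (mfderiv I 𝓘(ℝ, E) (extChartAt I x) x' : E →L[ℝ] E) (L (v j))) := by
    intro x' hx' L; subst hx'; rfl
  exact h4 _ hl _

/-- The exterior derivative is local. -/
theorem d_congr {w w' : DiffForm I M p} {x : M} (h : ∀ᶠ z in 𝓝 x, w z = w' z) :
    w.d x = w'.d x := by
  have h1 := inChart_eventuallyEq (mem_extChartAt_source (I := I) x) h
  simp only [DiffForm.d]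
  rw [h1.extDerivWithin_eq_of_mem (extChartAt_mem_range _ _)]

theorem smoothAt_d {w : DiffForm I M p} {x : M} (hw : ∀ᶠ z in 𝓝 x, w.SmoothAt z) :
    w.d.SmoothAt x := by
  have hx := mem_extChartAt_source (I := I) x
  have h2 : w.d.inChart x =ᶠ[𝓝[range I] (extChartAt I x x)]
      extDerivWithin (w.inChart x) (range I) := by
    filter_upwards [eventually_mem_target hx
      (Filter.inter_mem hw (extChartAt_source_mem_nhds (I := I) x))]
      with u hu
    have := inChart_d hu.2.2 hu.2.1
    rwa [(extChartAt I x).right_inv hu.1] at this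
  refine ContDiffWithinAt.congr_of_eventuallyEq ?_ h2
    (h2.self_of_nhdsWithin (extChartAt_mem_range _ _))
  have h3 : ContDiffWithinAt ℝ ∞ (fderivWithin ℝ (w.inChart x) (range I))
      (range I) (extChartAt I x x) :=
    (hw.self_of_nhds : w.SmoothAt x).fderivWithin_right I.uniqueDiffOn (by simp)
      (extChartAt_mem_range _ _)
  exact (ContinuousAlternatingMap.alternatizeUncurryFinCLM ℝ E
    ℂ).contDiff.contDiffAt.comp_contDiffWithinAt _ h3

theorem d_d {w : DiffForm I M p} {x : M} (hw : ∀ᶠ z in 𝓝 x, w.SmoothAt z) :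
    w.d.d x = 0 := by
  have hx := mem_extChartAt_source (I := I) x
  have h2 : w.d.inChart x =ᶠ[𝓝[range I] (extChartAt I x x)]
      extDerivWithin (w.inChart x) (range I) := by
    filter_upwards [eventually_mem_target hx
      (Filter.inter_mem hw (extChartAt_source_mem_nhds (I := I) x))]
      with u hu
    have := inChart_d hu.2.2 hu.2.1
    rwa [(extChartAt I x).right_inv hu.1] at this
  simp only [DiffForm.d]
  rw [h2.extDerivWithin_eq_of_mem (extChartAt_mem_range _ _),
    extDerivWithin_extDerivWithin_apply (r := ∞) hw.self_of_nhds two_le_infty I.uniqueDiffOn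
      mem_closure_interior_range (extChartAt_mem_range _ _)]
  rfl

theorem d_add {w w' : DiffForm I M p} {x : M} (hw : w.SmoothAt x) (hw' : w'.SmoothAt x) :
    DiffForm.d (fun z => w z + w' z) x = w.d x + w'.d x := by
  have h1 : DiffForm.inChart (fun z => w z + w' z) x = w.inChart x + w'.inChart x := rfl
  simp only [DiffForm.d]
  rw [h1, extDerivWithin_add (I.uniqueDiffOn _ (extChartAt_mem_range _ _))
    (ContDiffWithinAt.differentiableWithinAt hw (by simp))
    (ContDiffWithinAt.differentiableWithinAt hw' (by simp))]
  rfl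

/-- The Leibniz rule for the product of a form on a vector space with a function. -/
theorem _root_.extDerivWithin_smul_fun {f : E → ℝ} {η : E → E [⋀^Fin p]→L[ℝ] ℂ} {s : Set E} {u : E}
    (hs : UniqueDiffWithinAt ℝ s u) (hf : DifferentiableWithinAt ℝ f s u)
    (hη : DifferentiableWithinAt ℝ η s u) :
    extDerivWithin (fun z => f z • η z) s u =
      _root_.wedge (Nat.add_comm 1 p) (ContinuousAlternatingMap.ofSubsingleton ℝ E ℂ (0 : Fin 1)
        (Complex.ofRealCLM.comp (fderivWithin ℝ f s u))) (η u) + f u • extDerivWithin η s u := by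
  rw [extDerivWithin, fderivWithin_fun_smul hs hf hη,
    ContinuousAlternatingMap.alternatizeUncurryFin_add,
    ContinuousAlternatingMap.alternatizeUncurryFin_smul, add_comm (f u • _)]
  congr 1
  ext v
  rw [wedge_one_apply, ContinuousAlternatingMap.alternatizeUncurryFin_apply]
  refine Finset.sum_congr rfl fun i _ => ?_
  simp only [ContinuousLinearMap.smulRight_apply, ContinuousAlternatingMap.smul_apply,
    zsmul_eq_mul, Complex.real_smul]
  push_cast
  rfl

/-- The Leibniz rule for the product of a form with a function. -/
theorem d_smul {f : M → ℝ} {w : DiffForm I M p} {x : M} (hf : ContMDiffAt I 𝓘(ℝ, ℝ) ∞ f x)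
    (hw : w.SmoothAt x) :
    DiffForm.d (fun z => f z • w z) x =
      DiffForm.wedge (Nat.add_comm 1 p) (dForm f) w x + f x • w.d x := by
  have : IsManifold I 1 M := isManifold_one
  have hx := mem_extChartAt_source (I := I) x
  have hl := (extChartAt I x).left_inv hx
  have h1 : DiffForm.inChart (fun z => f z • w z) x =
      fun u => (f ∘ (extChartAt I x).symm) u • w.inChart x u := rfl
  have hd : MDifferentiableAt I 𝓘(ℝ, ℝ) f ((extChartAt I x).symm (extChartAt I x x)) := by
    rw [hl]; exact hf.mdifferentiableAt (by simp)
  have h2 := extDerivWithin_smul_fun (I.uniqueDiffOn _ (extChartAt_mem_range x x))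
    ((contDiffWithinAt_comp_symm hx hf).differentiableWithinAt (by simp))
    (ContDiffWithinAt.differentiableWithinAt hw (by simp))
  rw [← inChart_dForm ((extChartAt I x).map_source hx) hd, ← inChart_wedge] at h2
  have h3 := eq_inChart (DiffForm.wedge (Nat.add_comm 1 p) (dForm f) w) hx
  rw [h3]
  simp only [DiffForm.d]
  rw [h1, h2, Function.comp_apply, hl]
  rfl

/-- `d (df ∧ w) = -df ∧ dw`. -/
theorem d_wedge_dForm {f : M → ℝ} {w : DiffForm I M p} {x : M}
    (hf : ContMDiffAt I 𝓘(ℝ, ℝ) ∞ f x) (hf' : ∀ᶠ z in 𝓝 x, ContMDiffAt I 𝓘(ℝ, ℝ) ∞ f z)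
    (hw : ∀ᶠ z in 𝓝 x, w.SmoothAt z) :
    (DiffForm.wedge (Nat.add_comm 1 p) (dForm f) w).d x =
      -DiffForm.wedge (Nat.add_comm 1 (p + 1)) (dForm f) w.d x := by
  have hdw : ∀ᶠ z in 𝓝 x, w.d.SmoothAt z := by
    filter_upwards [hw.eventually_nhds] with z hz using smoothAt_d hz
  have hfw : ∀ᶠ z in 𝓝 x, DiffForm.SmoothAt (fun z => f z • w z) z := by
    filter_upwards [hw, hf'] with z hz hz' using hz.smul hz'
  -- By the Leibniz rule `df ∧ w = d (f w) - f dw`, and `d ∘ d = 0`.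
  have h1 : ∀ᶠ z in 𝓝 x, DiffForm.wedge (Nat.add_comm 1 p) (dForm f) w z =
      DiffForm.d (fun z => f z • w z) z + (-1 : ℂ) • (f z • w.d z) := by
    filter_upwards [hw, hf'] with z hz hz'
    rw [d_smul hz' hz, neg_one_smul_form]; abel
  have hneg : ∀ᶠ z in 𝓝 x, DiffForm.SmoothAt (fun z => f z • w.d z) z := by
    filter_upwards [hdw, hf'] with z hz hz' using hz.smul hz'
  have h2 : ∀ {k : ℕ} {η : DiffForm I M k}, η.SmoothAt x →
      DiffForm.d (fun z => (-1 : ℂ) • η z) x = (-1 : ℂ) • η.d x := by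
    intro k η hη
    have e : (fun z => (-1 : ℂ) • η z) = fun z => (-1 : ℝ) • η z := by
      funext z; rw [neg_one_smul_form, neg_one_real_smul_form]
    have := d_smul (f := fun _ : M => (-1 : ℝ)) contMDiffAt_const hη
    rw [e, this]
    have h0 : DiffForm.wedge (Nat.add_comm 1 k) (dForm fun _ : M => (-1 : ℝ)) η x = 0 := by
      have : (dForm (fun _ : M => (-1 : ℝ)) : DiffForm I M 1) x = 0 := by
        simp only [dForm, mfderiv_const]; ext v; exact Complex.ofReal_zero
      rw [DiffForm.wedge, this, wedge_zero_left]
    rw [h0, zero_add, neg_one_smul_form, neg_one_real_smul_form]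
  rw [d_congr h1, d_add (smoothAt_d hfw) (hneg.self_of_nhds.const_smul _), d_d hfw, zero_add,
    h2 hneg.self_of_nhds, d_smul hf hdw.self_of_nhds, d_d hw, smul_zero_form, add_zero,
    neg_one_smul_form]

/-! ### Pull-back of forms -/

/-- In charts, the pull-back of a form is the pull-back by the map written in charts. -/
theorem inChart_pullback_eventuallyEq {f : N → M} {w : DiffForm I M p} {y : N} {y₀ : N} {x₀ : M}
    (hf : ∀ᶠ z in 𝓝 y, MDifferentiableAt I' I f z) (hfc : ContinuousAt f y)
    (hy : y ∈ (extChartAt I' y₀).source) (hx : f y ∈ (extChartAt I x₀).source) :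
    (pullback f w : DiffForm I' N p).inChart y₀ =ᶠ[𝓝[range I'] (extChartAt I' y₀ y)] fun u =>
      (w.inChart x₀ ((extChartAt I x₀ ∘ f ∘ (extChartAt I' y₀).symm) u)).compContinuousLinearMap
        (fderivWithin ℝ (extChartAt I x₀ ∘ f ∘ (extChartAt I' y₀).symm) (range I') u) := by
  have : IsManifold I' 1 N := isManifold_one
  filter_upwards [eventually_mem_target hy (Filter.inter_mem hf (hfc.preimage_mem_nhds
    (extChartAt_source_mem_nhds' hx)))] with u hu
  have hud := uniqueDiffWithinAt_of_mem_target hu.1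
  have hs := mdifferentiableWithinAt_extChartAt_symm hu.1
  have h1 := comp_mfderivWithin w (g := f ∘ (extChartAt I' y₀).symm) (x₀ := x₀) hud
    (MDifferentiableAt.comp_mdifferentiableWithinAt u hu.2.1 hs) hu.2.2
  refine Eq.trans ?_ h1
  have h2 : mfderivWithin 𝓘(ℝ, E') I (f ∘ (extChartAt I' y₀).symm) (range I') u =
    ((mfderiv I' I f ((extChartAt I' y₀).symm u)).comp
      (mfderivWithin 𝓘(ℝ, E') I' (extChartAt I' y₀).symm (range I') u) :) :=
    mfderiv_comp_mfderivWithin u hu.2.1 hs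
      (uniqueMDiffWithinAt_iff_uniqueDiffWithinAt.2 hud)
  rw [h2]
  rfl

theorem contDiffWithinAt_writtenInCharts {f : N → M} {y y₀ : N} {x₀ : M}
    (hf : ContMDiffAt I' I ∞ f y)
    (hy : y ∈ (extChartAt I' y₀).source) (hx : f y ∈ (extChartAt I x₀).source) :
    ContDiffWithinAt ℝ ∞ (extChartAt I x₀ ∘ f ∘ (extChartAt I' y₀).symm) (range I')
      (extChartAt I' y₀ y) :=
  ((contMDiffAt_iff_of_mem_source (x := y₀) (y := x₀) (by simpa using hy) (by simpa using hx)).1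
    hf).2

theorem SmoothAt.pullback {f : N → M} {w : DiffForm I M p} {y : N} (hf : ContMDiff I' I ∞ f)
    (hw : w.SmoothAt (f y)) : (DiffForm.pullback f w : DiffForm I' N p).SmoothAt y := by
  have hy := mem_extChartAt_source (I := I') y
  have hx := mem_extChartAt_source (I := I) (f y)
  have h1 := inChart_pullback_eventuallyEq (w := w)
    (Eventually.of_forall fun z => (hf z).mdifferentiableAt (by simp))
    hf.continuous.continuousAt hy hx
  have hψ := contDiffWithinAt_writtenInCharts (hf y) hy hx
  have hmem := extChartAt_mem_range (I := I') y y
  refine ContDiffWithinAt.congr_of_eventuallyEq ?_ h1 (h1.self_of_nhdsWithin hmem)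
  refine ContDiffWithinAt.form_compContinuousLinearMap ?_ ?_
  · refine ContDiffWithinAt.comp (g := w.inChart (f y)) (t := range I) _ ?_ hψ
      fun u _ => extChartAt_mem_range _ _
    have e : (extChartAt I (f y) ∘ f ∘ (extChartAt I' y).symm) (extChartAt I' y y) =
      extChartAt I (f y) (f y) := by simp
    rw [e]; exact hw
  · exact hψ.fderivWithin_right I'.uniqueDiffOn (by simp) hmem

/-- The exterior derivative commutes with pull-backs. -/
theorem d_pullback {f : N → M} {w : DiffForm I M p} {y : N} (hf : ContMDiff I' I ∞ f)
    (hw : w.SmoothAt (f y)) :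
    (DiffForm.pullback f w : DiffForm I' N p).d y = DiffForm.pullback f w.d y := by
  have : IsManifold I' 1 N := isManifold_one
  have : IsManifold I 1 M := isManifold_one
  have hy := mem_extChartAt_source (I := I') y
  have hx := mem_extChartAt_source (I := I) (f y)
  have h1 := inChart_pullback_eventuallyEq (w := w)
    (Eventually.of_forall fun z => (hf z).mdifferentiableAt (by simp))
    hf.continuous.continuousAt hy hx
  have hψ := contDiffWithinAt_writtenInCharts (hf y) hy hx
  have hmem := extChartAt_mem_range (I := I') y y
  have e : (extChartAt I (f y) ∘ f ∘ (extChartAt I' y).symm) (extChartAt I' y y) =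
      extChartAt I (f y) (f y) := by simp
  have h2 := extDerivWithin_pullback (t := range I) (r := ∞)
    (show DifferentiableWithinAt ℝ (w.inChart (f y)) (range I)
      ((extChartAt I (f y) ∘ f ∘ (extChartAt I' y).symm) (extChartAt I' y y)) by
        rw [e]; exact ContDiffWithinAt.differentiableWithinAt hw (by simp)) hψ
    two_le_infty I'.uniqueDiffOn mem_closure_interior_range hmem
    (fun u _ => extChartAt_mem_range _ _)
  rw [← h1.extDerivWithin_eq_of_mem hmem, e] at h2
  ext v
  refine (congrArg (fun a : E' [⋀^Fin (p + 1)]→L[ℝ] ℂ => a fun j =>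
    (mfderiv I' 𝓘(ℝ, E') (extChartAt I' y) y : E' →L[ℝ] E') (v j)) h2).trans ?_
  have h3 : ((fderivWithin ℝ (extChartAt I (f y) ∘ f ∘ (extChartAt I' y).symm) (range I')
      (extChartAt I' y y)).comp (mfderiv I' 𝓘(ℝ, E') (extChartAt I' y) y : E' →L[ℝ] E') :
        E' →L[ℝ] E)
      = (mfderiv I 𝓘(ℝ, E) (extChartAt I (f y)) (f y) : E →L[ℝ] E).comp
        (mfderiv I' I f y : E' →L[ℝ] E) := by
    have hfd := (hf y).mdifferentiableAt (by simp)
    have e1 : (mfderiv I' 𝓘(ℝ, E') (extChartAt I' y) y : E' →L[ℝ] E') =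
      ContinuousLinearMap.id ℝ E' := mfderiv_extChartAt_self
    have e2 : (mfderiv I 𝓘(ℝ, E) (extChartAt I (f y)) (f y) : E →L[ℝ] E) =
      ContinuousLinearMap.id ℝ E := mfderiv_extChartAt_self
    rw [e1, e2, ContinuousLinearMap.comp_id]
    have e3 : (mfderiv I' I f y : E' →L[ℝ] E) = _ := hfd.mfderiv
    rw [e3]
    rfl
  exact congrArg (fun L : E' →L[ℝ] E => extDerivWithin (w.inChart (f y)) (range I)
    (extChartAt I (f y) (f y)) (fun j => L (v j))) h3

end DiffForm

end FormsOnManifolds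

/-! ### Smoothness of parametric integrals -/

section ParametricIntegral

variable {E : Type} [NormedAddCommGroup E] [NormedSpace ℝ E]

theorem intervalIntegrable_slice {G : Type*} [NormedAddCommGroup G] {K : Set E} {F : ℝ × E → G}
    (hF : ContinuousOn F (Icc 0 1 ×ˢ K)) {u : E} (hu : u ∈ K) :
    IntervalIntegrable (fun t => F (t, u)) volume 0 1 := by
  apply ContinuousOn.intervalIntegrable
  rw [uIcc_of_le zero_le_one]
  exact hF.comp (by fun_prop) fun t ht => ⟨ht, hu⟩

/-- Continuity in the parameter, uniformly over the compact interval of integration. -/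
theorem eventually_dist_slice_lt {G : Type*} [NormedAddCommGroup G] {K : Set E} {F : ℝ × E → G}
    (hF : ContinuousOn F (Icc 0 1 ×ˢ K)) {u : E} (hu : u ∈ K) {ε : ℝ} (hε : 0 < ε) :
    ∀ᶠ z in 𝓝[K] u, ∀ t ∈ Icc (0 : ℝ) 1, ‖F (t, z) - F (t, u)‖ < ε := by
  obtain ⟨v, hv, h⟩ := (isCompact_Icc (a := (0 : ℝ)) (b := 1)).mem_uniformity_of_prod
    (f := fun (z : E) (t : ℝ) => F (t, z)) (s := K) (q := u)
    (hF.comp (f := Prod.swap) continuous_swap.continuousOn fun x hx => ⟨hx.2, hx.1⟩)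
    hu (Metric.dist_mem_uniformity hε)
  filter_upwards [hv] with z hz t ht
  have := h z hz t ht
  rwa [mem_ofPred_eq, dist_eq_norm] at this

theorem continuousOn_integral_slice {G : Type*} [NormedAddCommGroup G] [NormedSpace ℝ G] {K : Set E}
    {F : ℝ × E → G} (hF : ContinuousOn F (Icc 0 1 ×ˢ K)) :
    ContinuousOn (fun u => ∫ t in (0 : ℝ)..1, F (t, u)) K := by
  intro u hu
  rw [ContinuousWithinAt, Metric.tendsto_nhds]
  intro ε hε
  filter_upwards [eventually_dist_slice_lt hF hu (half_pos hε), self_mem_nhdsWithin] with z hz hzK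
  rw [dist_eq_norm, ← intervalIntegral.integral_sub (intervalIntegrable_slice hF hzK)
    (intervalIntegrable_slice hF hu)]
  have := intervalIntegral.norm_integral_le_of_norm_le_const (a := (0 : ℝ)) (b := 1) (C := ε / 2)
    (f := fun t => F (t, z) - F (t, u)) fun t ht => by
      rw [uIoc_of_le zero_le_one] at ht
      exact (hz t ⟨ht.1.le, ht.2⟩).le
  rw [sub_zero, abs_one, mul_one] at this
  linarith

/-- Differentiation under the integral sign within a convex set. -/
theorem hasFDerivWithinAt_integral_slice {G : Type*} [NormedAddCommGroup G] [NormedSpace ℝ G]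
    [CompleteSpace G]
    {K : Set E} (hK : Convex ℝ K) {F : ℝ × E → G} {F' : ℝ × E → E →L[ℝ] G}
    (hF : ContinuousOn F (Icc 0 1 ×ˢ K)) (hF' : ContinuousOn F' (Icc 0 1 ×ˢ K))
    (h : ∀ t ∈ Icc (0 : ℝ) 1, ∀ u ∈ K, HasFDerivWithinAt (fun u => F (t, u)) (F' (t, u)) K u)
    {u : E} (hu : u ∈ K) :
    HasFDerivWithinAt (fun u => ∫ t in (0 : ℝ)..1, F (t, u))
      (∫ t in (0 : ℝ)..1, F' (t, u)) K u := by
  rw [hasFDerivWithinAt_iff_isLittleO, Asymptotics.isLittleO_iff]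
  intro ε hε
  have hev := eventually_dist_slice_lt hF' hu hε
  obtain ⟨δ, hδ, hball⟩ := Metric.mem_nhdsWithin_iff.1 hev
  filter_upwards [inter_mem_nhdsWithin K (Metric.ball_mem_nhds u hδ)] with z hz
  have hint := intervalIntegrable_slice hF' hu
  have e1 : (∫ t in (0 : ℝ)..1, F' (t, u)) (z - u) = ∫ t in (0 : ℝ)..1, F' (t, u) (z - u) :=
    (ContinuousLinearMap.intervalIntegral_apply hint _)
  have hint2 : IntervalIntegrable (fun t => F' (t, u) (z - u)) volume 0 1 :=
    ⟨hint.1.apply_continuousLinearMap _, hint.2.apply_continuousLinearMap _⟩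
  rw [e1, ← intervalIntegral.integral_sub (intervalIntegrable_slice hF hz.1)
    (intervalIntegrable_slice hF hu), ← intervalIntegral.integral_sub
    ((intervalIntegrable_slice hF hz.1).sub (intervalIntegrable_slice hF hu)) hint2]
  have := intervalIntegral.norm_integral_le_of_norm_le_const (a := (0 : ℝ)) (b := 1)
    (C := ε * ‖z - u‖) (f := fun t => F (t, z) - F (t, u) - F' (t, u) (z - u)) fun t ht => by
      rw [uIoc_of_le zero_le_one] at ht
      have ht' : t ∈ Icc (0 : ℝ) 1 := ⟨ht.1.le, ht.2⟩
      refine (hK.inter (convex_ball u δ)).norm_image_sub_le_of_norm_hasFDerivWithin_le'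
        (f := fun z => F (t, z)) (f' := fun z => F' (t, z))
        (fun x hx => (h t ht' x hx.1).mono inter_subset_left) (fun x hx => ?_)
        ⟨hu, Metric.mem_ball_self hδ⟩ hz
      exact (hball ⟨hx.2, hx.1⟩ t ht').le
  rw [sub_zero, abs_one, mul_one] at this
  exact this

/-- Parametric integrals of `C^n` functions on a convex set are `C^n`, up to the boundary of the
set. -/
theorem contDiffOn_integral_slice {K : Set E} (hK : Convex ℝ K) (hK' : UniqueDiffOn ℝ K) (n : ℕ) :
    ∀ {G : Type} [NormedAddCommGroup G] [NormedSpace ℝ G] [CompleteSpace G] {F : ℝ × E → G},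
    ContDiffOn ℝ n F (Icc 0 1 ×ˢ K) → ContDiffOn ℝ n (fun u => ∫ t in (0 : ℝ)..1, F (t, u)) K := by
  -- The target varies in the induction, the derivative being valued in `E →L[ℝ] G`.
  induction n with
  | zero =>
    intro G _ _ _ F hF
    rw [CharP.cast_eq_zero, contDiffOn_zero] at hF ⊢
    exact continuousOn_integral_slice hF
  | succ n ih =>
    intro G _ _ _ F hF
    have hU : UniqueDiffOn ℝ (Icc (0 : ℝ) 1 ×ˢ K) := (uniqueDiffOn_Icc zero_lt_one).prod hK'
    rw [Nat.cast_succ] at hF ⊢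
    have hF1 : ContDiffOn ℝ n (fun x => (fderivWithin ℝ F (Icc 0 1 ×ˢ K) x).comp
        (ContinuousLinearMap.inr ℝ ℝ E)) (Icc 0 1 ×ˢ K) :=
      (hF.fderivWithin hU le_rfl).clm_comp contDiffOn_const
    rw [contDiffOn_succ_iff_hasFDerivWithinAt_of_uniqueDiffOn hK']
    refine ⟨by simp, _, ih hF1, fun u hu => ?_⟩
    refine hasFDerivWithinAt_integral_slice hK hF.continuousOn hF1.continuousOn
      (fun t ht u hu => ?_) hu
    have h1 := (hF.differentiableOn (by simp) (t, u) ⟨ht, hu⟩).hasFDerivWithinAt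
    exact h1.comp u ((hasFDerivAt_prodMk_right t u).hasFDerivWithinAt) fun z hz => ⟨ht, hz⟩

end ParametricIntegral

/-! ### Hadamard's lemma on the half-space -/

section Hadamard

variable {d : ℕ}

/-- The first coordinate vector of `ℝ^(d+1)`, the inward normal of the half-space. -/
def e₀ (d : ℕ) : EuclideanSpace ℝ (Fin (d + 1)) := EuclideanSpace.single 0 1

theorem e₀_zero : e₀ d 0 = 1 := by simp [e₀]

theorem e₀_of_ne {j : Fin (d + 1)} (hj : j ≠ 0) : e₀ d j = 0 := by simp [e₀, hj]

theorem mem_halfSpace {u : EuclideanSpace ℝ (Fin (d + 1))} :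
    u ∈ range (𝓡∂ (d + 1)) ↔ 0 ≤ u 0 := by
  rw [range_modelWithCornersEuclideanHalfSpace]; rfl

theorem convex_halfSpace : Convex ℝ (range (𝓡∂ (d + 1))) := by
  intro x hx y hy a b ha hb _
  rw [mem_halfSpace] at *
  simp only [PiLp.add_apply, PiLp.smul_apply, smul_eq_mul]
  positivity

/-- The contraction `u ↦ (t u₀, u₁, …, u_d)` of the half-space onto its boundary. -/
def squeeze (x : ℝ × EuclideanSpace ℝ (Fin (d + 1))) : EuclideanSpace ℝ (Fin (d + 1)) :=
  x.2 + ((x.1 - 1) * x.2 0) • e₀ d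

theorem squeeze_apply_zero (t : ℝ) (u : EuclideanSpace ℝ (Fin (d + 1))) :
    squeeze (t, u) 0 = t * u 0 := by
  simp [squeeze, e₀_zero]; ring

theorem squeeze_of_ne (t : ℝ) (u : EuclideanSpace ℝ (Fin (d + 1))) {j : Fin (d + 1)} (hj : j ≠ 0) :
    squeeze (t, u) j = u j := by
  simp [squeeze, e₀_of_ne hj]

theorem squeeze_one (u : EuclideanSpace ℝ (Fin (d + 1))) : squeeze (1, u) = u := by
  simp [squeeze]

theorem contDiff_coord (j : Fin (d + 1)) {n : WithTop ℕ∞} :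
    ContDiff ℝ n (fun u : EuclideanSpace ℝ (Fin (d + 1)) => u j) :=
  (EuclideanSpace.proj j : EuclideanSpace ℝ (Fin (d + 1)) →L[ℝ] ℝ).contDiff

theorem contDiff_squeeze {n : WithTop ℕ∞} : ContDiff ℝ n (squeeze (d := d)) := by
  unfold squeeze
  exact contDiff_snd.add (((contDiff_fst.sub contDiff_const).mul
    ((contDiff_coord 0).comp contDiff_snd)).smul contDiff_const)

theorem dist_squeeze_le {t : ℝ} (ht : t ∈ Icc (0 : ℝ) 1) (u u₁ : EuclideanSpace ℝ (Fin (d + 1)))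
    (h : u₁ 0 = 0) : dist (squeeze (t, u)) u₁ ≤ dist u u₁ := by
  rw [EuclideanSpace.dist_eq, EuclideanSpace.dist_eq]
  refine Real.sqrt_le_sqrt (Finset.sum_le_sum fun j _ => ?_)
  rcases eq_or_ne j 0 with rfl | hj
  · rw [squeeze_apply_zero, h, dist_zero_right, dist_zero_right, norm_mul, Real.norm_of_nonneg ht.1]
    have : t * ‖u 0‖ ≤ 1 * ‖u 0‖ := mul_le_mul_of_nonneg_right ht.2 (norm_nonneg _)
    exact pow_le_pow_left₀ (mul_nonneg ht.1 (norm_nonneg _)) (by simpa using this) 2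
  · rw [squeeze_of_ne t u hj]

/-- Hadamard's lemma on the half-space: a smooth function that vanishes on the boundary near a
boundary point is divisible by the first coordinate, since
`f u = ∫₀¹ d/dt f (t u₀, u₁, …, u_d) dt`. -/
theorem exists_eq_coord_zero_mul {f : EuclideanSpace ℝ (Fin (d + 1)) → ℝ}
    {u₁ : EuclideanSpace ℝ (Fin (d + 1))} (h₁ : u₁ 0 = 0)
    (hf : ∀ᶠ u in 𝓝[range (𝓡∂ (d + 1))] u₁, ContDiffWithinAt ℝ ∞ f (range (𝓡∂ (d + 1))) u)
    (hf0 : ∀ᶠ u in 𝓝[range (𝓡∂ (d + 1))] u₁, u 0 = 0 → f u = 0) :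
    ∃ g : EuclideanSpace ℝ (Fin (d + 1)) → ℝ,
      (∀ᶠ u in 𝓝[range (𝓡∂ (d + 1))] u₁, ContDiffWithinAt ℝ ∞ g (range (𝓡∂ (d + 1))) u) ∧
      (∀ᶠ u in 𝓝[range (𝓡∂ (d + 1))] u₁, f u = u 0 * g u) ∧
      g u₁ = fderivWithin ℝ f (range (𝓡∂ (d + 1))) u₁ (e₀ d) := by
  set HS := range (𝓡∂ (d + 1)) with hHS
  obtain ⟨r, hr, hball⟩ := Metric.mem_nhdsWithin_iff.1 (hf.and hf0)
  set B := Metric.ball u₁ r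
  set K := HS ∩ B with hKdef
  have hB : ∀ u ∈ K, B ∈ 𝓝 u := fun u hu => Metric.isOpen_ball.mem_nhds hu.2
  have hKc : Convex ℝ K := convex_halfSpace.inter (convex_ball _ _)
  have hKu : UniqueDiffOn ℝ K := (𝓡∂ (d + 1)).uniqueDiffOn.inter Metric.isOpen_ball
  have hfK : ContDiffOn ℝ ∞ f K := fun u hu => (hball ⟨hu.2, hu.1⟩).1.mono inter_subset_left
  have hmaps : ∀ t ∈ Icc (0 : ℝ) 1, ∀ u ∈ K, squeeze (t, u) ∈ K := by
    intro t ht u hu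
    refine ⟨?_, (dist_squeeze_le ht u u₁ h₁).trans_lt hu.2⟩
    rw [hHS, mem_halfSpace, squeeze_apply_zero]
    exact mul_nonneg ht.1 (mem_halfSpace.1 hu.1)
  have hu₁ : u₁ ∈ K := ⟨mem_halfSpace.2 h₁.ge, Metric.mem_ball_self hr⟩
  set F : ℝ × EuclideanSpace ℝ (Fin (d + 1)) → ℝ :=
    fun x => fderivWithin ℝ f K (squeeze x) (e₀ d) with hFdef
  have hFs : ContDiffOn ℝ ∞ F (Icc 0 1 ×ˢ K) := by
    have h1 : ContDiffOn ℝ ∞ (fderivWithin ℝ f K) K := hfK.fderivWithin hKu (by simp)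
    exact (h1.comp contDiff_squeeze.contDiffOn fun x hx => hmaps x.1 hx.1 x.2 hx.2).clm_apply
      contDiffOn_const
  refine ⟨fun u => ∫ t in (0 : ℝ)..1, F (t, u), ?_, ?_, ?_⟩
  · have h2 : ContDiffOn ℝ ∞ (fun u => ∫ t in (0 : ℝ)..1, F (t, u)) K :=
      contDiffOn_infty.2 fun n => contDiffOn_integral_slice hKc hKu n
        (hFs.of_le (by exact_mod_cast le_top))
    filter_upwards [inter_mem_nhdsWithin HS (Metric.ball_mem_nhds u₁ hr)] with u hu
    exact (contDiffWithinAt_inter (hB u hu)).1 (h2 u hu)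
  · filter_upwards [inter_mem_nhdsWithin HS (Metric.ball_mem_nhds u₁ hr)] with u hu
    have hsq : ∀ t : ℝ, HasDerivAt (fun t => squeeze (t, u)) (u 0 • e₀ d) t := by
      intro t
      have h3 : HasDerivAt (fun t : ℝ => (t - 1) * u 0) (1 * u 0) t :=
        ((hasDerivAt_id t).sub_const 1).mul_const (u 0)
      rw [one_mul] at h3
      exact (h3.smul_const (e₀ d)).const_add u
    have hder : ∀ t ∈ Icc (0 : ℝ) 1,
        HasDerivWithinAt (fun t => f (squeeze (t, u))) (u 0 * F (t, u)) (Icc 0 1) t := by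
      intro t ht
      have h4 := (hfK.differentiableOn (by simp) _ (hmaps t ht u hu)).hasFDerivWithinAt
      have h5 := h4.comp_hasDerivWithinAt t ((hsq t).hasDerivWithinAt (s := Icc 0 1))
        fun z hz => hmaps z hz u hu
      have h6 : fderivWithin ℝ f K (squeeze (t, u)) (u 0 • e₀ d) = u 0 * F (t, u) := by
        rw [map_smul, smul_eq_mul]
      rw [h6] at h5
      exact h5
    have hint := intervalIntegral.integral_eq_sub_of_hasDerivAt_of_le zero_le_one
      (fun t ht => (hder t ht).continuousWithinAt)
      (fun t ht => (hder t (Ioo_subset_Icc_self ht)).hasDerivAt (Icc_mem_nhds ht.1 ht.2))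
      ((intervalIntegrable_slice hFs.continuousOn hu).const_mul (u 0))
    have h0 : f (squeeze (0, u)) = 0 := by
      have := hmaps 0 (by simp) u hu
      exact (hball ⟨this.2, this.1⟩).2 (by rw [squeeze_apply_zero, zero_mul])
    rw [squeeze_one, h0, sub_zero] at hint
    rw [← hint, intervalIntegral.integral_const_mul]
  · have h7 : ∀ t : ℝ, F (t, u₁) = fderivWithin ℝ f HS u₁ (e₀ d) := by
      intro t
      have : squeeze (t, u₁) = u₁ := by simp [squeeze, h₁]
      rw [hFdef]
      simp only [this]
      rw [hKdef, fderivWithin_inter (Metric.ball_mem_nhds u₁ hr)]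
    simp [h7]

end Hadamard

/-! ### Boundary defining functions in charts -/

section BoundaryGeometry

theorem contMDiffAt_comp_extChartAt {E : Type*} [NormedAddCommGroup E] [NormedSpace ℝ E]
    [FiniteDimensional ℝ E]
    {H : Type*} [TopologicalSpace H] {I : ModelWithCorners ℝ E H}
    {M : Type*} [TopologicalSpace M] [ChartedSpace H M] [IsManifold I ∞ M] {f : E → ℝ} {x₀ x : M}
    (h₀ : x ∈ (extChartAt I x₀).source)
    (hf : ContDiffWithinAt ℝ ∞ f (range I) (extChartAt I x₀ x)) :
    ContMDiffAt I 𝓘(ℝ, ℝ) ∞ (f ∘ extChartAt I x₀) x := by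
  have hc : ContMDiffAt I 𝓘(ℝ, E) ∞ (extChartAt I x₀) x :=
    contMDiffAt_extChartAt' (by simpa using h₀)
  rw [← contMDiffWithinAt_univ] at hc ⊢
  exact hf.contMDiffWithinAt.comp x hc fun z _ => DiffForm.extChartAt_mem_range x₀ z

variable {d : ℕ} {X : Type*} [TopologicalSpace X] [ChartedSpace (EuclideanHalfSpace (d + 1)) X]
  [IsManifold (𝓡∂ (d + 1)) ∞ X]
  {Y : Type*} [TopologicalSpace Y] [ChartedSpace (EuclideanSpace ℝ (Fin d)) Y]
  [IsManifold (𝓡 d) ∞ Y]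
  {i : Y → X} {lam lam' : X → ℝ}

namespace IsBoundaryDefining

theorem eq_zero_iff (h : IsBoundaryDefining d i lam) {x : X} : lam x = 0 ↔ x ∈ range i :=
  ⟨fun h0 => by_contra fun hx => (h.pos x hx).ne' h0, h.eq_zero x⟩

theorem nonneg (h : IsBoundaryDefining d i lam) (x : X) : 0 ≤ lam x := by
  by_cases hx : x ∈ range i
  · exact (h.eq_zero x hx).ge
  · exact (h.pos x hx).le

theorem isClosed_range (h : IsBoundaryDefining d i lam) : IsClosed (range i) := by
  have : range i = lam ⁻¹' {0} := by ext x; exact h.eq_zero_iff.symm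
  rw [this]
  exact isClosed_singleton.preimage h.contMDiff.continuous

variable {x₀ x : X}

theorem contDiffWithinAt (h : IsBoundaryDefining d i lam)
    (hx : x ∈ (extChartAt (𝓡∂ (d + 1)) x₀).source) :
    ContDiffWithinAt ℝ ∞ (lam ∘ (extChartAt (𝓡∂ (d + 1)) x₀).symm) (range (𝓡∂ (d + 1)))
      (extChartAt (𝓡∂ (d + 1)) x₀ x) :=
  DiffForm.contDiffWithinAt_comp_symm hx (h.contMDiff x)

/-- The derivative of a function, computed in a chart. -/
theorem _root_.mfderiv_eq_fderivWithin_comp {f : X → ℝ}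
    (hf : MDifferentiableAt (𝓡∂ (d + 1)) 𝓘(ℝ, ℝ) f x)
    (hx : x ∈ (extChartAt (𝓡∂ (d + 1)) x₀).source) (v : EuclideanSpace ℝ (Fin (d + 1))) :
    (mfderiv (𝓡∂ (d + 1)) 𝓘(ℝ, ℝ) f x : EuclideanSpace ℝ (Fin (d + 1)) →L[ℝ] ℝ) v =
      fderivWithin ℝ (f ∘ (extChartAt (𝓡∂ (d + 1)) x₀).symm) (range (𝓡∂ (d + 1)))
        (extChartAt (𝓡∂ (d + 1)) x₀ x)
        ((mfderiv (𝓡∂ (d + 1)) 𝓘(ℝ, EuclideanSpace ℝ (Fin (d + 1)))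
          (extChartAt (𝓡∂ (d + 1)) x₀) x :
            EuclideanSpace ℝ (Fin (d + 1)) →L[ℝ] EuclideanSpace ℝ (Fin (d + 1))) v) := by
  have h1 := DiffForm.eq_inChart (dForm f : DiffForm (𝓡∂ (d + 1)) X 1) hx
  have hl := (extChartAt (𝓡∂ (d + 1)) x₀).left_inv hx
  rw [DiffForm.inChart_dForm ((extChartAt (𝓡∂ (d + 1)) x₀).map_source hx) (by rwa [hl])] at h1
  have h2 := congrArg (fun a : EuclideanSpace ℝ (Fin (d + 1)) [⋀^Fin 1]→L[ℝ] ℂ => a fun _ => v) h1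
  exact Complex.ofReal_injective h2

theorem fderivWithin_ne_zero (h : IsBoundaryDefining d i lam)
    (hx : x ∈ (extChartAt (𝓡∂ (d + 1)) x₀).source) (hxi : x ∈ range i) :
    fderivWithin ℝ (lam ∘ (extChartAt (𝓡∂ (d + 1)) x₀).symm) (range (𝓡∂ (d + 1)))
      (extChartAt (𝓡∂ (d + 1)) x₀ x) ≠ 0 := by
  intro h0
  refine h.mfderiv_ne_zero x hxi ?_
  ext v
  have := mfderiv_eq_fderivWithin_comp ((h.contMDiff x).mdifferentiableAt (by simp)) hx v
  rw [h0] at this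
  exact this

/-- In every chart, the points of `Y` lie on the boundary of the half-space: a boundary defining
function has a minimum there, but its differential does not vanish. -/
theorem coord_zero_eq_zero (h : IsBoundaryDefining d i lam)
    (hx : x ∈ (extChartAt (𝓡∂ (d + 1)) x₀).source) (hxi : x ∈ range i) :
    extChartAt (𝓡∂ (d + 1)) x₀ x 0 = 0 := by
  by_contra hne
  have hl := (extChartAt (𝓡∂ (d + 1)) x₀).left_inv hx
  have hpos : 0 < extChartAt (𝓡∂ (d + 1)) x₀ x 0 :=
    lt_of_le_of_ne (mem_halfSpace.1 (DiffForm.extChartAt_mem_range x₀ x)) (Ne.symm hne)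
  have hnhds : range (𝓡∂ (d + 1)) ∈ 𝓝 (extChartAt (𝓡∂ (d + 1)) x₀ x) := by
    rw [← mem_interior_iff_mem_nhds, interior_range_modelWithCornersEuclideanHalfSpace]
    exact hpos
  refine h.fderivWithin_ne_zero hx hxi ?_
  rw [fderivWithin_of_mem_nhds hnhds]
  refine IsLocalMin.fderiv_eq_zero (Eventually.of_forall fun u => ?_)
  rw [Function.comp_apply, hl, h.eq_zero x hxi]
  exact h.nonneg _

/-- Deletion of the first coordinate. -/
def _root_.tailL (d : ℕ) : EuclideanSpace ℝ (Fin (d + 1)) →L[ℝ] EuclideanSpace ℝ (Fin d) :=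
  LinearMap.toContinuousLinearMap
    { toFun := fun u => WithLp.toLp 2 fun j => u j.succ
      map_add' := fun _ _ => rfl
      map_smul' := fun _ _ => rfl }

theorem _root_.tailL_apply (u : EuclideanSpace ℝ (Fin (d + 1))) (j : Fin d) :
    tailL d u j = u j.succ := rfl

theorem _root_.eq_of_tailL_eq {u v : EuclideanSpace ℝ (Fin (d + 1))} (h0 : u 0 = v 0)
    (h : tailL d u = tailL d v) : u = v := by
  ext j
  refine Fin.cases h0 (fun k => ?_) j
  rw [← tailL_apply, ← tailL_apply, h]

/-- The inclusion of `Y` read in charts, as a map to the model space of `X`. -/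
def _root_.inclInCharts (i : Y → X) (y₀ : Y) (x₀ : X) (v : EuclideanSpace ℝ (Fin d)) :
    EuclideanSpace ℝ (Fin (d + 1)) :=
  extChartAt (𝓡∂ (d + 1)) x₀ (i ((extChartAt (𝓡 d) y₀).symm v))

variable {y₀ y : Y}

theorem _root_.IsBoundaryPart.contDiffAt_inclInCharts (hi : IsBoundaryPart d i)
    (hy : y ∈ (extChartAt (𝓡 d) y₀).source) (hx : i y ∈ (extChartAt (𝓡∂ (d + 1)) x₀).source) :
    ContDiffAt ℝ ∞ (inclInCharts i y₀ x₀) (extChartAt (𝓡 d) y₀ y) := by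
  have := DiffForm.contDiffWithinAt_writtenInCharts (hi.contMDiff y) hy hx
  rw [ModelWithCorners.range_eq_univ, contDiffWithinAt_univ] at this
  exact this

theorem _root_.IsBoundaryPart.fderiv_inclInCharts (hi : IsBoundaryPart d i)
    (hy : y ∈ (extChartAt (𝓡 d) y₀).source) (hx : i y ∈ (extChartAt (𝓡∂ (d + 1)) x₀).source)
    (v : EuclideanSpace ℝ (Fin d)) :
    fderiv ℝ (inclInCharts i y₀ x₀) (extChartAt (𝓡 d) y₀ y) v =
      (mfderiv (𝓡∂ (d + 1)) 𝓘(ℝ, EuclideanSpace ℝ (Fin (d + 1)))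
        (extChartAt (𝓡∂ (d + 1)) x₀) (i y) :
        EuclideanSpace ℝ (Fin (d + 1)) →L[ℝ] EuclideanSpace ℝ (Fin (d + 1)))
        ((mfderiv (𝓡 d) (𝓡∂ (d + 1)) i y :
            EuclideanSpace ℝ (Fin d) →L[ℝ] EuclideanSpace ℝ (Fin (d + 1)))
          ((mfderivWithin 𝓘(ℝ, EuclideanSpace ℝ (Fin d)) (𝓡 d) (extChartAt (𝓡 d) y₀).symm
            (range (𝓡 d)) (extChartAt (𝓡 d) y₀ y) :
              EuclideanSpace ℝ (Fin d) →L[ℝ] EuclideanSpace ℝ (Fin d)) v)) := by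
  have : IsManifold (𝓡∂ (d + 1)) 1 X := DiffForm.isManifold_one
  have : IsManifold (𝓡 d) 1 Y := DiffForm.isManifold_one
  have hl := (extChartAt (𝓡 d) y₀).left_inv hy
  have hs := mdifferentiableWithinAt_extChartAt_symm ((extChartAt (𝓡 d) y₀).map_source hy)
  have hu := (uniqueMDiffWithinAt_iff_uniqueDiffWithinAt.2
    (DiffForm.uniqueDiffWithinAt_of_mem_target ((extChartAt (𝓡 d) y₀).map_source hy)))
  have h1 := mfderiv_comp_mfderivWithin (I := 𝓘(ℝ, EuclideanSpace ℝ (Fin d)))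
    (I' := 𝓡 d) (I'' := 𝓡∂ (d + 1)) (g := i) (extChartAt (𝓡 d) y₀ y)
    (((hi.contMDiff _).mdifferentiableAt (by simp))) hs hu
  have hm2 : MDifferentiableWithinAt 𝓘(ℝ, EuclideanSpace ℝ (Fin d)) (𝓡∂ (d + 1))
      (i ∘ (extChartAt (𝓡 d) y₀).symm) (range (𝓡 d)) (extChartAt (𝓡 d) y₀ y) :=
    MDifferentiableAt.comp_mdifferentiableWithinAt _
      ((hi.contMDiff _).mdifferentiableAt (by simp)) hs
  have h2 := mfderiv_comp_mfderivWithin (I := 𝓘(ℝ, EuclideanSpace ℝ (Fin d)))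
    (I' := 𝓡∂ (d + 1)) (I'' := 𝓘(ℝ, EuclideanSpace ℝ (Fin (d + 1))))
    (g := extChartAt (𝓡∂ (d + 1)) x₀)
    (f := i ∘ (extChartAt (𝓡 d) y₀).symm) (extChartAt (𝓡 d) y₀ y)
    (mdifferentiableAt_extChartAt (by rw [Function.comp_apply, hl]; simpa using hx)) hm2 hu
  have h3 : fderiv ℝ (inclInCharts i y₀ x₀) (extChartAt (𝓡 d) y₀ y) =
      mfderivWithin 𝓘(ℝ, EuclideanSpace ℝ (Fin d)) 𝓘(ℝ, EuclideanSpace ℝ (Fin (d + 1)))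
        (extChartAt (𝓡∂ (d + 1)) x₀ ∘ i ∘ (extChartAt (𝓡 d) y₀).symm) (range (𝓡 d))
        (extChartAt (𝓡 d) y₀ y) := by
    rw [ModelWithCorners.range_eq_univ, mfderivWithin_univ, mfderiv_eq_fderiv]
    rfl
  rw [h3, h2, h1]
  have h4 : ∀ y' : Y, y' = y → ∀ w : EuclideanSpace ℝ (Fin d),
      (mfderiv (𝓡∂ (d + 1)) 𝓘(ℝ, EuclideanSpace ℝ (Fin (d + 1)))
        (extChartAt (𝓡∂ (d + 1)) x₀) (i y') :
        EuclideanSpace ℝ (Fin (d + 1)) →L[ℝ] EuclideanSpace ℝ (Fin (d + 1)))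
        ((mfderiv (𝓡 d) (𝓡∂ (d + 1)) i y' :
            EuclideanSpace ℝ (Fin d) →L[ℝ] EuclideanSpace ℝ (Fin (d + 1))) w) =
      (mfderiv (𝓡∂ (d + 1)) 𝓘(ℝ, EuclideanSpace ℝ (Fin (d + 1)))
        (extChartAt (𝓡∂ (d + 1)) x₀) (i y) :
        EuclideanSpace ℝ (Fin (d + 1)) →L[ℝ] EuclideanSpace ℝ (Fin (d + 1)))
        ((mfderiv (𝓡 d) (𝓡∂ (d + 1)) i y :
            EuclideanSpace ℝ (Fin d) →L[ℝ] EuclideanSpace ℝ (Fin (d + 1))) w) := by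
    rintro y' rfl w; rfl
  exact h4 _ hl _

/-- The inclusion of `Y`, read in charts, is an immersion. -/
theorem _root_.IsBoundaryPart.fderiv_inclInCharts_injective (hi : IsBoundaryPart d i)
    (hy : y ∈ (extChartAt (𝓡 d) y₀).source) (hx : i y ∈ (extChartAt (𝓡∂ (d + 1)) x₀).source) :
    Function.Injective (fderiv ℝ (inclInCharts i y₀ x₀) (extChartAt (𝓡 d) y₀ y)) := by
  have : IsManifold (𝓡∂ (d + 1)) 1 X := DiffForm.isManifold_one
  have : IsManifold (𝓡 d) 1 Y := DiffForm.isManifold_one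
  intro v v' hv
  rw [hi.fderiv_inclInCharts hy hx, hi.fderiv_inclInCharts hy hx] at hv
  have h1 : Function.Injective (mfderiv (𝓡∂ (d + 1)) 𝓘(ℝ, EuclideanSpace ℝ (Fin (d + 1)))
        (extChartAt (𝓡∂ (d + 1)) x₀) (i y)) := (isInvertible_mfderiv_extChartAt hx).injective
  have h2 : Function.Injective (mfderivWithin 𝓘(ℝ, EuclideanSpace ℝ (Fin d)) (𝓡 d)
      (extChartAt (𝓡 d) y₀).symm (range (𝓡 d)) (extChartAt (𝓡 d) y₀ y)) :=
    (isInvertible_mfderivWithin_extChartAt_symm ((extChartAt (𝓡 d) y₀).map_source hy)).injective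
  exact h2 (hi.immersion y (h1 hv))

theorem eventually_inclInCharts (hi : IsBoundaryPart d i)
    (hy : y ∈ (extChartAt (𝓡 d) y₀).source) (hx : i y ∈ (extChartAt (𝓡∂ (d + 1)) x₀).source) :
    ∀ᶠ v in 𝓝 (extChartAt (𝓡 d) y₀ y), v ∈ (extChartAt (𝓡 d) y₀).target ∧
      i ((extChartAt (𝓡 d) y₀).symm v) ∈ (extChartAt (𝓡∂ (d + 1)) x₀).source := by
  have := DiffForm.eventually_mem_target hy
    (hi.contMDiff.continuous.continuousAt.preimage_mem_nhds (extChartAt_source_mem_nhds' hx))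
  rwa [ModelWithCorners.range_eq_univ, nhdsWithin_univ] at this

/-- The image of the derivative of the inclusion is tangent to the boundary of the half-space. -/
theorem fderiv_inclInCharts_zero (h : IsBoundaryDefining d i lam) (hi : IsBoundaryPart d i)
    (hy : y ∈ (extChartAt (𝓡 d) y₀).source) (hx : i y ∈ (extChartAt (𝓡∂ (d + 1)) x₀).source)
    (v : EuclideanSpace ℝ (Fin d)) :
    fderiv ℝ (inclInCharts i y₀ x₀) (extChartAt (𝓡 d) y₀ y) v 0 = 0 := by
  let P : EuclideanSpace ℝ (Fin (d + 1)) →L[ℝ] ℝ := EuclideanSpace.proj (0 : Fin (d + 1))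
  have h1 : P ∘ inclInCharts i y₀ x₀ =ᶠ[𝓝 (extChartAt (𝓡 d) y₀ y)] fun _ => (0 : ℝ) := by
    filter_upwards [eventually_inclInCharts hi hy hx] with v hv
    exact h.coord_zero_eq_zero hv.2 (mem_range_self _)
  have h2 := (hi.contDiffAt_inclInCharts hy hx).differentiableAt (by simp)
  have h3 := (HasFDerivAt.comp (g := P) (g' := P) _ P.hasFDerivAt h2.hasFDerivAt).fderiv
  rw [h1.fderiv_eq, fderiv_const_apply] at h3
  exact (congrArg (fun L : EuclideanSpace ℝ (Fin d) →L[ℝ] ℝ => L v) h3).symm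

theorem tail_fderiv_injective (h : IsBoundaryDefining d i lam) (hi : IsBoundaryPart d i)
    (hy : y ∈ (extChartAt (𝓡 d) y₀).source) (hx : i y ∈ (extChartAt (𝓡∂ (d + 1)) x₀).source) :
    Function.Injective ((tailL d).comp
      (fderiv ℝ (inclInCharts i y₀ x₀) (extChartAt (𝓡 d) y₀ y))) := by
  intro v v' hv
  refine hi.fderiv_inclInCharts_injective hy hx (eq_of_tailL_eq ?_ hv)
  rw [h.fderiv_inclInCharts_zero hi hy hx, h.fderiv_inclInCharts_zero hi hy hx]

/-- Near a point of `Y`, the boundary of the half-space consists of points of `Y`: by the inverse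
function theorem, the image of an immersion of a `d`-manifold into it is open. -/
theorem eventually_mem_range (h : IsBoundaryDefining d i lam) (hi : IsBoundaryPart d i)
    (hx : x ∈ (extChartAt (𝓡∂ (d + 1)) x₀).source) (hxi : x ∈ range i) :
    ∀ᶠ u in 𝓝 (extChartAt (𝓡∂ (d + 1)) x₀ x), u 0 = 0 →
      (extChartAt (𝓡∂ (d + 1)) x₀).symm u ∈ range i := by
  obtain ⟨y, rfl⟩ := hxi
  have hy := mem_extChartAt_source (I := 𝓡 d) y
  have hinj := h.tail_fderiv_injective hi hy hx
  have hsurj : Function.Surjective ((tailL d).comp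
      (fderiv ℝ (inclInCharts i y x₀) (extChartAt (𝓡 d) y y))) :=
    LinearMap.surjective_of_injective (f := (((tailL d).comp
      (fderiv ℝ (inclInCharts i y x₀) (extChartAt (𝓡 d) y y))) :
        EuclideanSpace ℝ (Fin d) →ₗ[ℝ] EuclideanSpace ℝ (Fin d))) hinj
  have hstrict : HasStrictFDerivAt (tailL d ∘ inclInCharts i y x₀) ((tailL d).comp
      (fderiv ℝ (inclInCharts i y x₀) (extChartAt (𝓡 d) y y))) (extChartAt (𝓡 d) y y) :=
    (tailL d).hasStrictFDerivAt.comp _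
      ((hi.contDiffAt_inclInCharts hy hx).hasStrictFDerivAt (by simp))
  have hmap := hstrict.map_nhds_eq_of_surj (LinearMap.range_eq_top.2 hsurj)
  have hev := eventually_inclInCharts hi hy hx
  have h1 : (tailL d ∘ inclInCharts i y x₀) '' {v | v ∈ (extChartAt (𝓡 d) y).target ∧
      i ((extChartAt (𝓡 d) y).symm v) ∈ (extChartAt (𝓡∂ (d + 1)) x₀).source} ∈
      𝓝 (tailL d (extChartAt (𝓡∂ (d + 1)) x₀ (i y))) := by
    have : (tailL d ∘ inclInCharts i y x₀) (extChartAt (𝓡 d) y y) =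
        tailL d (extChartAt (𝓡∂ (d + 1)) x₀ (i y)) := by
      simp only [Function.comp_apply, inclInCharts, (extChartAt (𝓡 d) y).left_inv hy]
    rw [← this, ← hmap]
    exact image_mem_map hev
  filter_upwards [(tailL d).continuous.continuousAt.preimage_mem_nhds h1] with u hu hu0
  obtain ⟨v, hv, hvu⟩ := hu
  have : inclInCharts i y x₀ v = u :=
    eq_of_tailL_eq ((h.coord_zero_eq_zero hv.2 (mem_range_self _)).trans hu0.symm) hvu
  rw [← this, inclInCharts, (extChartAt (𝓡∂ (d + 1)) x₀).left_inv hv.2]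
  exact mem_range_self _

/-- Along `Y`, the differential of a boundary defining function kills the vectors tangent to the
boundary. -/
theorem fderivWithin_eq_zero (h : IsBoundaryDefining d i lam) (hi : IsBoundaryPart d i)
    (hx : x ∈ (extChartAt (𝓡∂ (d + 1)) x₀).source) (hxi : x ∈ range i)
    {a : EuclideanSpace ℝ (Fin (d + 1))} (ha : a 0 = 0) :
    fderivWithin ℝ (lam ∘ (extChartAt (𝓡∂ (d + 1)) x₀).symm) (range (𝓡∂ (d + 1)))
      (extChartAt (𝓡∂ (d + 1)) x₀ x) a = 0 := by
  have h0 := h.coord_zero_eq_zero hx hxi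
  set u := extChartAt (𝓡∂ (d + 1)) x₀ x with hu
  have hd := ((h.contDiffWithinAt hx).differentiableWithinAt (by simp)).hasFDerivWithinAt
  rw [← hu] at hd
  have hc : HasDerivAt (fun t : ℝ => u + t • a) a 0 := by
    simpa using ((hasDerivAt_id (0 : ℝ)).smul_const a).const_add u
  have e0 : u + (0 : ℝ) • a = u := by simp
  rw [← e0] at hd
  have h1 := hd.comp_hasDerivAt (0 : ℝ) hc (Eventually.of_forall fun t => by
    rw [mem_halfSpace]; simp [h0, ha])
  rw [e0] at h1
  have h2 : ((lam ∘ (extChartAt (𝓡∂ (d + 1)) x₀).symm) ∘ fun t : ℝ => u + t • a) =ᶠ[𝓝 0]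
      fun _ => 0 := by
    have hcc : ContinuousAt (fun t : ℝ => u + t • a) 0 := hc.continuousAt
    have hev := h.eventually_mem_range hi hx hxi
    rw [← hu] at hev
    rw [ContinuousAt, e0] at hcc
    filter_upwards [hcc.eventually hev] with t ht
    exact h.eq_zero _ (ht (by simp [h0, ha]))
  exact h1.unique ((hasDerivAt_const (0 : ℝ) (0 : ℝ)).congr_of_eventuallyEq h2)

theorem eq_smul_e₀_add (a : EuclideanSpace ℝ (Fin (d + 1))) :
    ∃ b : EuclideanSpace ℝ (Fin (d + 1)), b 0 = 0 ∧ a = a 0 • e₀ d + b :=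
  ⟨a - a 0 • e₀ d, by simp [e₀_zero], by abel⟩

/-- In a chart, the differential of a boundary defining function along `Y` is a multiple of the
first coordinate. -/
theorem fderivWithin_apply (h : IsBoundaryDefining d i lam) (hi : IsBoundaryPart d i)
    (hx : x ∈ (extChartAt (𝓡∂ (d + 1)) x₀).source) (hxi : x ∈ range i)
    (a : EuclideanSpace ℝ (Fin (d + 1))) :
    fderivWithin ℝ (lam ∘ (extChartAt (𝓡∂ (d + 1)) x₀).symm) (range (𝓡∂ (d + 1)))
      (extChartAt (𝓡∂ (d + 1)) x₀ x) a = a 0 *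
    fderivWithin ℝ (lam ∘ (extChartAt (𝓡∂ (d + 1)) x₀).symm) (range (𝓡∂ (d + 1)))
      (extChartAt (𝓡∂ (d + 1)) x₀ x) (e₀ d) := by
  obtain ⟨b, hb, hab⟩ := eq_smul_e₀_add a
  conv_lhs => rw [hab]
  rw [map_add, map_smul, h.fderivWithin_eq_zero hi hx hxi hb, add_zero, smul_eq_mul]

/-- The inward derivative of a boundary defining function along `Y` is positive: it is nonnegative
since the function is minimal there, and nonzero since the differential kills tangent vectors. -/
theorem fderivWithin_e₀_pos (h : IsBoundaryDefining d i lam) (hi : IsBoundaryPart d i)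
    (hx : x ∈ (extChartAt (𝓡∂ (d + 1)) x₀).source) (hxi : x ∈ range i) :
    0 < fderivWithin ℝ (lam ∘ (extChartAt (𝓡∂ (d + 1)) x₀).symm) (range (𝓡∂ (d + 1)))
      (extChartAt (𝓡∂ (d + 1)) x₀ x) (e₀ d) := by
  have hl := (extChartAt (𝓡∂ (d + 1)) x₀).left_inv hx
  refine lt_of_le_of_ne ?_ fun h0 => ?_
  · have hd := ((h.contDiffWithinAt hx).differentiableWithinAt (by simp)).hasFDerivWithinAt
    have hmin : IsLocalMinOn (lam ∘ (extChartAt (𝓡∂ (d + 1)) x₀).symm) (range (𝓡∂ (d + 1)))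
        (extChartAt (𝓡∂ (d + 1)) x₀ x) := Eventually.of_forall fun u => by
      rw [Function.comp_apply, hl, h.eq_zero x hxi]
      exact h.nonneg _
    refine hmin.hasFDerivWithinAt_nonneg hd (mem_posTangentConeAt_of_segment_subset ?_)
    refine convex_halfSpace.segment_subset (DiffForm.extChartAt_mem_range x₀ x) ?_
    rw [mem_halfSpace, PiLp.add_apply, e₀_zero]
    have := mem_halfSpace.1 (DiffForm.extChartAt_mem_range (I := 𝓡∂ (d + 1)) x₀ x)
    linarith
  · refine h.fderivWithin_ne_zero hx hxi ?_
    ext a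
    rw [h.fderivWithin_apply hi hx hxi, ← h0, mul_zero]; rfl

/-- Two boundary defining functions differ, locally, by a smooth positive factor: by Hadamard's
lemma, each of them is the first coordinate of a chart times a smooth positive function. -/
theorem exists_eq_mul (h : IsBoundaryDefining d i lam) (hi : IsBoundaryPart d i)
    (h' : IsBoundaryDefining d i lam') (x : X) :
    ∃ f : X → ℝ, ∀ᶠ z in 𝓝 x, ContMDiffAt (𝓡∂ (d + 1)) 𝓘(ℝ, ℝ) ∞ f z ∧ 0 < f z ∧
      lam' z = f z * lam z := by
  by_cases hxi : x ∈ range i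
  swap
  · refine ⟨fun z => lam' z / lam z, ?_⟩
    filter_upwards [h.isClosed_range.isOpen_compl.mem_nhds hxi] with z hz
    have hz' := h.pos z hz
    exact ⟨(h'.contMDiff z).div₀ (h.contMDiff z) hz'.ne', div_pos (h'.pos z hz) hz', by field_simp⟩
  have hx := mem_extChartAt_source (I := 𝓡∂ (d + 1)) x
  have had : ∀ {μ : X → ℝ}, IsBoundaryDefining d i μ →
      ∃ g : EuclideanSpace ℝ (Fin (d + 1)) → ℝ,
      (∀ᶠ z in 𝓝 x, ContMDiffAt (𝓡∂ (d + 1)) 𝓘(ℝ, ℝ) ∞ (g ∘ extChartAt (𝓡∂ (d + 1)) x) z) ∧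
      (∀ᶠ z in 𝓝 x, μ z = extChartAt (𝓡∂ (d + 1)) x z 0 * g (extChartAt (𝓡∂ (d + 1)) x z)) ∧
      (∀ᶠ z in 𝓝 x, 0 < g (extChartAt (𝓡∂ (d + 1)) x z)) := by
    intro μ hμ
    have hsrc : ∀ᶠ u in 𝓝[range (𝓡∂ (d + 1))] (extChartAt (𝓡∂ (d + 1)) x x),
        u ∈ (extChartAt (𝓡∂ (d + 1)) x).target := extChartAt_target_mem_nhdsWithin x
    obtain ⟨g, hg1, hg2, hg3⟩ := exists_eq_coord_zero_mul
      (f := μ ∘ (extChartAt (𝓡∂ (d + 1)) x).symm)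
      (hμ.coord_zero_eq_zero hx hxi)
      (by
        filter_upwards [hsrc] with u hu
        have := hμ.contDiffWithinAt ((extChartAt (𝓡∂ (d + 1)) x).map_target hu)
        rwa [(extChartAt (𝓡∂ (d + 1)) x).right_inv hu] at this)
      (by
        filter_upwards [nhdsWithin_le_nhds (hμ.eventually_mem_range hi hx hxi)] with u hu hu0
        exact hμ.eq_zero _ (hu hu0))
    have htend : Tendsto (extChartAt (𝓡∂ (d + 1)) x) (𝓝 x)
        (𝓝[range (𝓡∂ (d + 1))] (extChartAt (𝓡∂ (d + 1)) x x)) :=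
      tendsto_nhdsWithin_iff.2 ⟨continuousAt_extChartAt x,
        Eventually.of_forall fun z => DiffForm.extChartAt_mem_range x z⟩
    have hsrc' := extChartAt_source_mem_nhds (I := 𝓡∂ (d + 1)) x
    have hgpos : 0 < g (extChartAt (𝓡∂ (d + 1)) x x) := by
      rw [hg3]; exact hμ.fderivWithin_e₀_pos hi hx hxi
    have hgsm : ∀ᶠ z in 𝓝 x,
        ContMDiffAt (𝓡∂ (d + 1)) 𝓘(ℝ, ℝ) ∞ (g ∘ extChartAt (𝓡∂ (d + 1)) x) z := by
      filter_upwards [htend.eventually hg1, hsrc'] with z hz hzs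
      exact contMDiffAt_comp_extChartAt hzs hz
    refine ⟨g, hgsm, ?_, ?_⟩
    · filter_upwards [htend.eventually hg2, hsrc'] with z hz hzs
      rwa [Function.comp_apply, (extChartAt (𝓡∂ (d + 1)) x).left_inv hzs] at hz
    · exact hgsm.self_of_nhds.continuousAt.eventually (lt_mem_nhds hgpos)
  obtain ⟨g, hg1, hg2, hg3⟩ := had h
  obtain ⟨g', hg1', hg2', hg3'⟩ := had h'
  refine ⟨fun z => g' (extChartAt (𝓡∂ (d + 1)) x z) / g (extChartAt (𝓡∂ (d + 1)) x z), ?_⟩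
  filter_upwards [hg1, hg2, hg3, hg1', hg2', hg3'] with z a1 a2 a3 b1 b2 b3
  refine ⟨b1.div₀ a1 a3.ne', div_pos b3 a3, ?_⟩
  rw [a2, b2]; field_simp

/-- Two smooth forms that agree off `Y` agree on `Y`, because the complement of `Y` is dense. -/
theorem eq_of_eventually_eq (h : IsBoundaryDefining d i lam) {p : ℕ}
    {α β : DiffForm (𝓡∂ (d + 1)) X p} (hα : α.SmoothAt x) (hβ : β.SmoothAt x)
    (hαβ : ∀ᶠ z in 𝓝 x, z ∉ range i → α z = β z) : α x = β x := by
  have hx := mem_extChartAt_source (I := 𝓡∂ (d + 1)) x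
  rw [DiffForm.eq_inChart α hx, DiffForm.eq_inChart β hx]
  congr 1
  set u₁ := extChartAt (𝓡∂ (d + 1)) x x
  have hsub : {u : EuclideanSpace ℝ (Fin (d + 1)) | 0 < u 0} ⊆ range (𝓡∂ (d + 1)) :=
    fun u hu => mem_halfSpace.2 (le_of_lt hu)
  have hne : (𝓝[{u : EuclideanSpace ℝ (Fin (d + 1)) | 0 < u 0}] u₁).NeBot := by
    rw [← mem_closure_iff_nhdsWithin_neBot, ← interior_range_modelWithCornersEuclideanHalfSpace]
    exact DiffForm.mem_closure_interior_range
  have hev : α.inChart x =ᶠ[𝓝[{u | 0 < u 0}] u₁] β.inChart x := by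
    filter_upwards [nhdsWithin_mono _ hsub (DiffForm.eventually_mem_target hx hαβ),
      self_mem_nhdsWithin] with u hu hu0
    have hui : (extChartAt (𝓡∂ (d + 1)) x).symm u ∉ range i := fun hui => by
      have := h.coord_zero_eq_zero ((extChartAt (𝓡∂ (d + 1)) x).map_target hu.1) hui
      rw [(extChartAt (𝓡∂ (d + 1)) x).right_inv hu.1] at this
      exact (show 0 < u 0 from hu0).ne' this
    have := hu.2 hui
    simp only [DiffForm.inChart]
    rw [this]
  have h1 := (ContDiffWithinAt.continuousWithinAt hα).mono hsub
  have h2 := (ContDiffWithinAt.continuousWithinAt hβ).mono hsub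
  exact tendsto_nhds_unique_of_eventuallyEq h1 h2 hev

end IsBoundaryDefining

end BoundaryGeometry

/-! ### Contraction with a vector -/

section Contraction

variable {V : Type*} [NormedAddCommGroup V] [NormedSpace ℝ V]

/-- The contraction of a form with a vector is an antiderivation (case of `ℓ ∧ W`, `ℓ` of
degree `1`). -/
theorem contraction_wedge_one {p : ℕ} (ℓ : V [⋀^Fin 1]→L[ℝ] ℂ) (W : V [⋀^Fin (p + 1)]→L[ℝ] ℂ)
    (v : V) :
    ℓ (fun _ => v) • W = wedge (Nat.add_comm 1 p) ℓ (W.curryLeft v) +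
      (wedge (Nat.add_comm 1 (p + 1)) ℓ W).curryLeft v := by
  ext u
  have h1 : (wedge (Nat.add_comm 1 (p + 1)) ℓ W).curryLeft v u =
      wedge (Nat.add_comm 1 (p + 1)) ℓ W (Fin.cons v u) := rfl
  have h2 : ∀ u, W.curryLeft v u = W (Fin.cons v u) := fun _ => rfl
  rw [ContinuousAlternatingMap.add_apply, ContinuousAlternatingMap.smul_apply, h1,
    wedge_one_cons, wedge_one_apply, smul_eq_mul]
  simp only [h2]
  ring

theorem contraction_wedge_one_zero (ℓ : V [⋀^Fin 1]→L[ℝ] ℂ) (W : V [⋀^Fin 0]→L[ℝ] ℂ) (v : V) :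
    ℓ (fun _ => v) • W = (wedge (Nat.add_comm 1 0) ℓ W).curryLeft v := by
  ext u
  have h1 : (wedge (Nat.add_comm 1 0) ℓ W).curryLeft v u =
      wedge (Nat.add_comm 1 0) ℓ W (Fin.cons v u) := rfl
  rw [h1, wedge_one_cons_of_forall_eq_zero ℓ W v u fun j => j.elim0]
  rfl

end Contraction

/-! ### Forms prescribed in a chart -/

section OfChart

variable {E : Type*} [NormedAddCommGroup E] [NormedSpace ℝ E] [FiniteDimensional ℝ E]
  {H : Type*} [TopologicalSpace H] {I : ModelWithCorners ℝ E H}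
  {M : Type*} [TopologicalSpace M] [ChartedSpace H M] [IsManifold I ∞ M] {p : ℕ}

/-- The form on a chart domain whose expression in the chart is `η`. -/
def DiffForm.ofChart (x₀ : M) (η : E → E [⋀^Fin p]→L[ℝ] ℂ) : DiffForm I M p :=
  fun z => (η (extChartAt I x₀ z)).compContinuousLinearMap (mfderiv I 𝓘(ℝ, E) (extChartAt I x₀) z)

theorem DiffForm.inChart_ofChart (x₀ : M) (η : E → E [⋀^Fin p]→L[ℝ] ℂ) {u : E}
    (hu : u ∈ (extChartAt I x₀).target) :
    (DiffForm.ofChart x₀ η : DiffForm I M p).inChart x₀ u = η u := by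
  have : IsManifold I 1 M := isManifold_one
  have h1 := mfderiv_extChartAt_comp_mfderivWithin_extChartAt_symm (I := I) hu
  ext v
  have h2 : ∀ a : E, (mfderiv I 𝓘(ℝ, E) (extChartAt I x₀) ((extChartAt I x₀).symm u) : E →L[ℝ] E)
      ((mfderivWithin 𝓘(ℝ, E) I (extChartAt I x₀).symm (range I) u : E →L[ℝ] E) a) = a :=
    fun a => congrArg (fun L : E →L[ℝ] E => L a) h1
  have h3 : (DiffForm.ofChart x₀ η : DiffForm I M p).inChart x₀ u v =
      η (extChartAt I x₀ ((extChartAt I x₀).symm u)) fun j =>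
        (mfderiv I 𝓘(ℝ, E) (extChartAt I x₀) ((extChartAt I x₀).symm u) : E →L[ℝ] E)
      ((mfderivWithin 𝓘(ℝ, E) I (extChartAt I x₀).symm (range I) u : E →L[ℝ] E) (v j)) := rfl
  rw [h3]
  refine (congrArg (η _) (funext fun j => h2 (v j))).trans ?_
  rw [(extChartAt I x₀).right_inv hu]

theorem DiffForm.smoothAt_ofChart {x₀ x : M} {η : E → E [⋀^Fin p]→L[ℝ] ℂ}
    (hx : x ∈ (extChartAt I x₀).source)
    (h : ContDiffWithinAt ℝ ∞ η (range I) (extChartAt I x₀ x)) :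
    (DiffForm.ofChart x₀ η : DiffForm I M p).SmoothAt x := by
  refine DiffForm.smoothAt_of_contDiffWithinAt hx ?_
  have h1 : (DiffForm.ofChart x₀ η : DiffForm I M p).inChart x₀
      =ᶠ[𝓝[range I] (extChartAt I x₀ x)] η := by
    filter_upwards [DiffForm.eventually_mem_target hx univ_mem] with u hu
    exact DiffForm.inChart_ofChart x₀ η hu.1
  exact h.congr_of_eventuallyEq h1 (h1.self_of_nhdsWithin (DiffForm.extChartAt_mem_range _ _))

theorem DiffForm.inChart_congr {w w' : DiffForm I M p} {x₀ x : M}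
    (hx : x ∈ (extChartAt I x₀).source) (h : w x = w' x) :
    w.inChart x₀ (extChartAt I x₀ x) = w'.inChart x₀ (extChartAt I x₀ x) := by
  have hl : w ((extChartAt I x₀).symm (extChartAt I x₀ x)) =
      w' ((extChartAt I x₀).symm (extChartAt I x₀ x)) := by
    rw [(extChartAt I x₀).left_inv hx, h]
  simp only [DiffForm.inChart]
  rw [hl]

end OfChart

/-! ### Differentials of functions -/

section DForm

variable {E : Type*} [NormedAddCommGroup E] [NormedSpace ℝ E]
  {H : Type*} [TopologicalSpace H] {I : ModelWithCorners ℝ E H}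
  {M : Type*} [TopologicalSpace M] [ChartedSpace H M]

theorem dForm_congr {f g : M → ℝ} {x : M} (h : f =ᶠ[𝓝 x] g) :
    (dForm f : DiffForm I M 1) x = dForm g x := by
  simp only [dForm, h.mfderiv_eq]

/-- The Leibniz rule for functions. -/
theorem dForm_mul {f g : M → ℝ} {x : M} (hf : MDifferentiableAt I 𝓘(ℝ, ℝ) f x)
    (hg : MDifferentiableAt I 𝓘(ℝ, ℝ) g x) :
    (dForm (fun z => f z * g z) : DiffForm I M 1) x = f x • dForm g x + g x • dForm f x := by
  have h := (hf.hasMFDerivAt.mul hg.hasMFDerivAt).mfderiv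
  ext v
  have h2 := congrArg (fun L : E →L[ℝ] ℝ => L (v 0)) h
  have h3 : (dForm (fun z => f z * g z) : DiffForm I M 1) x v =
    Complex.ofReal ((mfderiv I 𝓘(ℝ, ℝ) (f * g) x : E →L[ℝ] ℝ) (v 0)) := rfl
  rw [h3]
  refine (congrArg Complex.ofReal h2).trans ?_
  have h4 : (f x • dForm g x + g x • dForm f x : TangentSpace I x [⋀^Fin 1]→L[ℝ] ℂ) v =
    f x • Complex.ofReal ((mfderiv I 𝓘(ℝ, ℝ) g x : E →L[ℝ] ℝ) (v 0)) +
    g x • Complex.ofReal ((mfderiv I 𝓘(ℝ, ℝ) f x : E →L[ℝ] ℝ) (v 0)) := rfl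
  rw [h4]
  have h5 : ∀ a b : ℝ, Complex.ofReal (f x * a + g x * b) = f x • (a : ℂ) + g x • (b : ℂ) := by
    intro a b
    simp
  exact h5 _ _

theorem dForm_log {f : M → ℝ} {x : M} (hf : MDifferentiableAt I 𝓘(ℝ, ℝ) f x) (h0 : f x ≠ 0) :
    (dForm (fun z => Real.log (f z)) : DiffForm I M 1) x = (f x)⁻¹ • dForm f x := by
  have hl : HasMFDerivAt 𝓘(ℝ, ℝ) 𝓘(ℝ, ℝ) Real.log (f x)
      (ContinuousLinearMap.toSpanSingleton ℝ ((f x)⁻¹ : ℝ) : ℝ →L[ℝ] ℝ) :=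
    (Real.hasDerivAt_log h0).hasFDerivAt.hasMFDerivAt
  have h := (hl.comp x hf.hasMFDerivAt).mfderiv
  ext v
  have h2 := congrArg (fun L : E →L[ℝ] ℝ => L (v 0)) h
  have h3 : (dForm (fun z => Real.log (f z)) : DiffForm I M 1) x v =
    Complex.ofReal ((mfderiv I 𝓘(ℝ, ℝ) (Real.log ∘ f) x : E →L[ℝ] ℝ) (v 0)) := rfl
  rw [h3]
  refine (congrArg Complex.ofReal h2).trans ?_
  have h4 : ((f x)⁻¹ • dForm f x : TangentSpace I x [⋀^Fin 1]→L[ℝ] ℂ) v =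
    (f x)⁻¹ • Complex.ofReal ((mfderiv I 𝓘(ℝ, ℝ) f x : E →L[ℝ] ℝ) (v 0)) := rfl
  rw [h4]
  have h5 : ∀ a : ℝ, Complex.ofReal ((ContinuousLinearMap.toSpanSingleton ℝ ((f x)⁻¹ : ℝ) :
      ℝ →L[ℝ] ℝ) a) = (f x)⁻¹ • (a : ℂ) := by
    intro a
    simp [mul_comm]
  exact h5 _

end DForm

/-! ### Logarithmic forms and their local decompositions -/

section LogForms

variable {d : ℕ} {X : Type*} [TopologicalSpace X] [ChartedSpace (EuclideanHalfSpace (d + 1)) X]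
  [IsManifold (𝓡∂ (d + 1)) ∞ X]
  {Y : Type*} [TopologicalSpace Y] [ChartedSpace (EuclideanSpace ℝ (Fin d)) Y]
  [IsManifold (𝓡 d) ∞ Y]
  {i : Y → X} {lam lam' : X → ℝ} {p q : ℕ} {U V : Set X}

/-- The smooth extensions of a form across `Y` glue, because they are unique. -/
theorem IsBoundaryDefining.extendsSmoothly_of_local (h : IsBoundaryDefining d i lam)
    {η : DiffForm (𝓡∂ (d + 1)) X p}
    (hloc : ∀ x ∈ U, ∃ V, IsOpen V ∧ x ∈ V ∧ ExtendsSmoothly i V η) (hU : IsOpen U) :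
    ExtendsSmoothly i U η := by
  classical
  choose! V hV hxV ext hext heq using hloc
  refine ⟨fun z => ext z z, fun x hx => ?_, fun x hx hxi => heq x hx x (hxV x hx) hxi⟩
  refine DiffForm.SmoothAt.congr (hext x hx x (hxV x hx)) ?_
  filter_upwards [(hV x hx).mem_nhds (hxV x hx), hU.mem_nhds hx] with z hz hzU
  refine h.eq_of_eventually_eq (hext z hzU z (hxV z hzU)) (hext x hx z hz) ?_
  filter_upwards [(hV z hzU).mem_nhds (hxV z hzU), (hV x hx).mem_nhds hz] with t ht ht' hti
  rw [heq z hzU t ht hti, heq x hx t ht' hti]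

namespace IsBoundaryDefining

theorem isLogOn_of_local (h : IsBoundaryDefining d i lam) {w : DiffForm (𝓡∂ (d + 1)) X p}
    (hloc : ∀ x ∈ U, ∃ V, IsOpen V ∧ x ∈ V ∧ IsLogOn i lam V w) (hU : IsOpen U) :
    IsLogOn i lam U w := by
  constructor
  · refine h.extendsSmoothly_of_local (fun x hx => ?_) hU
    obtain ⟨V, hV, hxV, hw⟩ := hloc x hx
    exact ⟨V, hV, hxV, hw.1⟩
  · refine h.extendsSmoothly_of_local (fun x hx => ?_) hU
    obtain ⟨V, hV, hxV, hw⟩ := hloc x hx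
    exact ⟨V, hV, hxV, hw.2⟩

theorem isLogOn_add_smul {w w' : DiffForm (𝓡∂ (d + 1)) X p} (a b : ℂ)
    (hw : IsLogOn i lam U w) (hw' : IsLogOn i lam U w') :
    IsLogOn i lam U (fun x => a • w x + b • w' x) := by
  obtain ⟨⟨α, hα, hα'⟩, β, hβ, hβ'⟩ := hw
  obtain ⟨⟨α₁, hα₁, hα₁'⟩, β₁, hβ₁, hβ₁'⟩ := hw'
  refine ⟨⟨fun z => a • α z + b • α₁ z, fun x hx => ?_, fun x hx hxi => ?_⟩,
    ⟨fun z => a • β z + b • β₁ z, fun x hx => ?_, fun x hx hxi => ?_⟩⟩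
  · exact ((show α.SmoothAt x from hα x hx).const_smul a).add
      ((show α₁.SmoothAt x from hα₁ x hx).const_smul b)
  · simp only [hα' x hx hxi, hα₁' x hx hxi]
    ext v
    simp only [ContinuousAlternatingMap.add_apply, ContinuousAlternatingMap.smul_apply,
      Complex.real_smul, smul_eq_mul]
    ring
  · exact ((show β.SmoothAt x from hβ x hx).const_smul a).add
      ((show β₁.SmoothAt x from hβ₁ x hx).const_smul b)
  · simp only [hβ' x hx hxi, hβ₁' x hx hxi]
    simp only [DiffForm.wedge, wedge_add_right, wedge_smul_right]

/-- Off `Y`, logarithmic forms are smooth. -/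
theorem smoothAt_of_isLogOn (h : IsBoundaryDefining d i lam) (hU : IsOpen U)
    {w : DiffForm (𝓡∂ (d + 1)) X p} (hw : IsLogOn i lam U w) {x : X} (hx : x ∈ U)
    (hxi : x ∉ range i) : w.SmoothAt x := by
  obtain ⟨⟨α, hα, hα'⟩, -⟩ := hw
  have h1 : DiffForm.SmoothAt (fun z => (lam z)⁻¹ • α z) x := by
    refine DiffForm.SmoothAt.smul ?_ (hα x hx)
    exact (h.contMDiff x).inv₀ (h.pos x hxi).ne'
  refine h1.congr ?_
  filter_upwards [hU.mem_nhds hx, h.isClosed_range.isOpen_compl.mem_nhds hxi] with z hz hzi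
  rw [hα' z hz hzi]
  ext v
  have := (h.pos z hzi).ne'
  simp [this]

/-- Near a point of `Y`, a vector field `v` with `dlam v = 1`, given by `v = c e₀` in a chart. The
first clause says that the contraction with `v` takes smooth forms to smooth forms. -/
theorem exists_transverse (h : IsBoundaryDefining d i lam) (hi : IsBoundaryPart d i)
    (hU : IsOpen U) {x : X} (hx : x ∈ U) (hxi : x ∈ range i) :
    ∃ V ⊆ U ∩ (extChartAt (𝓡∂ (d + 1)) x).source, IsOpen V ∧ x ∈ V ∧
      ∃ c : EuclideanSpace ℝ (Fin (d + 1)) → ℝ,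
      (∀ z ∈ V, ∀ {k : ℕ} {η : EuclideanSpace ℝ (Fin (d + 1)) →
          EuclideanSpace ℝ (Fin (d + 1)) [⋀^Fin (k + 1)]→L[ℝ] ℂ},
        ContDiffWithinAt ℝ ∞ η (range (𝓡∂ (d + 1))) (extChartAt (𝓡∂ (d + 1)) x z) →
        ContDiffWithinAt ℝ ∞ (fun u => c u • (η u).curryLeft (e₀ d)) (range (𝓡∂ (d + 1)))
          (extChartAt (𝓡∂ (d + 1)) x z)) ∧
      (∀ z ∈ V, c (extChartAt (𝓡∂ (d + 1)) x z) ≠ 0) ∧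
      ∀ z ∈ V, (dForm lam : DiffForm (𝓡∂ (d + 1)) X 1).inChart x (extChartAt (𝓡∂ (d + 1)) x z)
        (fun _ => e₀ d) = ((c (extChartAt (𝓡∂ (d + 1)) x z))⁻¹ : ℝ) := by
  have hxs := mem_extChartAt_source (I := 𝓡∂ (d + 1)) x
  -- The function `c` is the inverse of the first partial derivative `b` of `lam`.
  set b : EuclideanSpace ℝ (Fin (d + 1)) → ℝ := fun u =>
    fderivWithin ℝ (lam ∘ (extChartAt (𝓡∂ (d + 1)) x).symm) (range (𝓡∂ (d + 1))) u (e₀ d) with hb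
  have hbs : ∀ z ∈ (extChartAt (𝓡∂ (d + 1)) x).source,
      ContDiffWithinAt ℝ ∞ b (range (𝓡∂ (d + 1))) (extChartAt (𝓡∂ (d + 1)) x z) := fun z hz =>
    ((h.contDiffWithinAt hz).fderivWithin_right (𝓡∂ (d + 1)).uniqueDiffOn (by simp)
      (DiffForm.extChartAt_mem_range _ _)).clm_apply contDiffWithinAt_const
  have hpos : 0 < b (extChartAt (𝓡∂ (d + 1)) x x) := h.fderivWithin_e₀_pos hi hxs hxi
  have hev : ∀ᶠ z in 𝓝 x, 0 < b (extChartAt (𝓡∂ (d + 1)) x z) :=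
    (contMDiffAt_comp_extChartAt hxs (hbs x hxs)).continuousAt.eventually (lt_mem_nhds hpos)
  obtain ⟨V, hVsub, hV, hxV⟩ := mem_nhds_iff.1 (Filter.inter_mem hev
    (Filter.inter_mem (hU.mem_nhds hx) (extChartAt_source_mem_nhds (I := 𝓡∂ (d + 1)) x)))
  refine ⟨V, fun z hz => (hVsub hz).2, hV, hxV, fun u => (b u)⁻¹, ?_, ?_, ?_⟩
  · intro z hz k η hη
    have hbz : b (extChartAt (𝓡∂ (d + 1)) x z) ≠ 0 := ne_of_gt (hVsub hz).1
    refine ContDiffWithinAt.smul ((hbs z (hVsub hz).2.2).inv hbz)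
      (contDiffWithinAt_form_of_apply fun v => ?_)
    exact hη.form_apply (Fin.cons (e₀ d) v)
  · intro z hz
    exact inv_ne_zero (ne_of_gt (hVsub hz).1)
  · intro z hz
    have hzs := (hVsub hz).2.2
    rw [DiffForm.inChart_dForm ((extChartAt (𝓡∂ (d + 1)) x).map_source hzs)
      ((h.contMDiff _).mdifferentiableAt (by simp)), inv_inv]
    rfl

/-- Existence of local decompositions. If `v` is a vector field with `dlam v = 1`, then
`w = dlam ∧ ι_v w + ι_v (dlam ∧ w)`, where `lam (ι_v w) = ι_v (lam w)` and `ι_v (dlam ∧ w)` extend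
smoothly across `Y`. -/
theorem exists_isLogDecomposition (h : IsBoundaryDefining d i lam) (hi : IsBoundaryPart d i)
    (hU : IsOpen U) {w : DiffForm (𝓡∂ (d + 1)) X (q + 1)} (hw : IsLogOn i lam U w) {x : X}
    (hx : x ∈ U) : ∃ V ⊆ U, IsOpen V ∧ x ∈ V ∧ ∃ σ τ, IsLogDecomposition i lam V w σ τ := by
  by_cases hxi : x ∈ range i
  swap
  · refine ⟨U \ range i, sdiff_subset, hU.sdiff h.isClosed_range, ⟨hx, hxi⟩, fun _ => 0, w,
      ?_, ?_, ?_⟩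
    · exact fun z _ => DiffForm.smoothAt_zero
    · exact fun z hz => h.smoothAt_of_isLogOn hU hw hz.1 hz.2
    · intro z _ _
      rw [DiffForm.wedge, wedge_zero_right, smul_zero_form, zero_add]
  obtain ⟨V, hVU, hV, hxV, c, hc, hc0, hcV⟩ := h.exists_transverse hi hU hx hxi
  obtain ⟨⟨α, hα, hα'⟩, β, hβ, hβ'⟩ := hw
  -- `σ = ι_v (lam w)` and `τ = ι_v (dlam ∧ w)`, with `v = c e₀` in the chart at `x`.
  refine ⟨V, fun z hz => (hVU hz).1, hV, hxV,
    DiffForm.ofChart x fun u => c u • (α.inChart x u).curryLeft (e₀ d),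
    DiffForm.ofChart x fun u => c u • (β.inChart x u).curryLeft (e₀ d), ?_, ?_, ?_⟩
  · intro z hz
    exact DiffForm.smoothAt_ofChart (hVU hz).2 (hc z hz (DiffForm.SmoothAt.contDiffWithinAt
      (hα z (hVU hz).1) (hVU hz).2))
  · intro z hz
    exact DiffForm.smoothAt_ofChart (hVU hz).2 (hc z hz (DiffForm.SmoothAt.contDiffWithinAt
      (hβ z (hVU hz).1) (hVU hz).2))
  · intro z hz hzi
    have hzs := (hVU hz).2
    have hl := (extChartAt (𝓡∂ (d + 1)) x).left_inv hzs
    have hlam0 := (h.pos z hzi).ne'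
    have e1 : α.inChart x (extChartAt (𝓡∂ (d + 1)) x z) =
        lam z • w.inChart x (extChartAt (𝓡∂ (d + 1)) x z) := by
      have : DiffForm.inChart (fun z => lam z • w z) x (extChartAt (𝓡∂ (d + 1)) x z) =
        lam ((extChartAt (𝓡∂ (d + 1)) x).symm (extChartAt (𝓡∂ (d + 1)) x z)) •
          w.inChart x (extChartAt (𝓡∂ (d + 1)) x z) := rfl
      rw [hl] at this
      rw [← this]
      exact DiffForm.inChart_congr hzs (hα' z (hVU hz).1 hzi)
    have e2 : β.inChart x (extChartAt (𝓡∂ (d + 1)) x z) =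
        wedge (Nat.add_comm 1 (q + 1)) ((dForm lam : DiffForm (𝓡∂ (d + 1)) X 1).inChart x
          (extChartAt (𝓡∂ (d + 1)) x z)) (w.inChart x (extChartAt (𝓡∂ (d + 1)) x z)) := by
      rw [← DiffForm.inChart_wedge]
      exact DiffForm.inChart_congr hzs (hβ' z (hVU hz).1 hzi)
    have e3 := contraction_wedge_one ((dForm lam : DiffForm (𝓡∂ (d + 1)) X 1).inChart x
      (extChartAt (𝓡∂ (d + 1)) x z)) (w.inChart x (extChartAt (𝓡∂ (d + 1)) x z)) (e₀ d)
    rw [← e2, hcV z hz, ofReal_smul_form] at e3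
    have e4 : w.inChart x (extChartAt (𝓡∂ (d + 1)) x z) = (lam z)⁻¹ •
        wedge (Nat.add_comm 1 q) ((dForm lam : DiffForm (𝓡∂ (d + 1)) X 1).inChart x
          (extChartAt (𝓡∂ (d + 1)) x z)) (c (extChartAt (𝓡∂ (d + 1)) x z) •
            (α.inChart x (extChartAt (𝓡∂ (d + 1)) x z)).curryLeft (e₀ d)) +
          c (extChartAt (𝓡∂ (d + 1)) x z) •
            (β.inChart x (extChartAt (𝓡∂ (d + 1)) x z)).curryLeft (e₀ d) := by
      have e5 : (lam z • w.inChart x (extChartAt (𝓡∂ (d + 1)) x z)).curryLeft (e₀ d) =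
        lam z • (w.inChart x (extChartAt (𝓡∂ (d + 1)) x z)).curryLeft (e₀ d) := rfl
      rw [e1, e5, wedge_real_smul_right, wedge_real_smul_right]
      have hc0' := hc0 z hz
      ext v
      have e6 := congrArg (fun a : EuclideanSpace ℝ (Fin (d + 1)) [⋀^Fin (q + 1)]→L[ℝ] ℂ => a v) e3
      simp only [ContinuousAlternatingMap.add_apply, ContinuousAlternatingMap.smul_apply,
        Complex.real_smul, Complex.ofReal_inv] at e6 ⊢
      have hlam0' : (lam z : ℂ) ≠ 0 := by exact_mod_cast hlam0
      have hc0'' : (c (extChartAt (𝓡∂ (d + 1)) x z) : ℂ) ≠ 0 := by exact_mod_cast hc0'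
      field_simp at e6 ⊢
      linear_combination e6
    rw [DiffForm.eq_inChart w hzs, e4]
    have e7 := DiffForm.eq_inChart (dForm lam : DiffForm (𝓡∂ (d + 1)) X 1) hzs
    rw [DiffForm.wedge, e7]
    refine Eq.trans ?_ (congrArg₂ (· + ·) (congrArg ((lam z)⁻¹ • ·)
      (wedge_compContinuousLinearMap _ _ _ _)) rfl)
    rfl

end IsBoundaryDefining

end LogForms

/-! ### The logarithmic complex and the residue -/

section LogComplex

variable {d : ℕ} {X : Type*} [TopologicalSpace X] [ChartedSpace (EuclideanHalfSpace (d + 1)) X]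
  [IsManifold (𝓡∂ (d + 1)) ∞ X]
  {Y : Type*} [TopologicalSpace Y] [ChartedSpace (EuclideanSpace ℝ (Fin d)) Y]
  [IsManifold (𝓡 d) ∞ Y]
  {i : Y → X} {lam lam' : X → ℝ} {p q : ℕ} {U V : Set X}

namespace IsBoundaryDefining

/-- A logarithmic `0`-form `w` extends smoothly across `Y`: it is the contraction of `dlam ∧ w`
with a vector field `v` such that `dlam v = 1`. -/
theorem extendsSmoothly_of_isLogOn_zero (h : IsBoundaryDefining d i lam) (hi : IsBoundaryPart d i)
    (hU : IsOpen U) {w : DiffForm (𝓡∂ (d + 1)) X 0} (hw : IsLogOn i lam U w) :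
    ExtendsSmoothly i U w := by
  refine h.extendsSmoothly_of_local (fun x hx => ?_) hU
  by_cases hxi : x ∈ range i
  swap
  · exact ⟨U \ range i, hU.sdiff h.isClosed_range, ⟨hx, hxi⟩, w,
      fun z hz => h.smoothAt_of_isLogOn hU hw hz.1 hz.2, fun _ _ _ => rfl⟩
  obtain ⟨V, hVU, hV, hxV, c, hc, hc0, hcV⟩ := h.exists_transverse hi hU hx hxi
  obtain ⟨-, β, hβ, hβ'⟩ := hw
  refine ⟨V, hV, hxV, DiffForm.ofChart x fun u => c u • (β.inChart x u).curryLeft (e₀ d), ?_, ?_⟩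
  · intro z hz
    exact DiffForm.smoothAt_ofChart (hVU hz).2 (hc z hz (DiffForm.SmoothAt.contDiffWithinAt
      (hβ z (hVU hz).1) (hVU hz).2))
  · intro z hz hzi
    have hzs := (hVU hz).2
    have e2 : β.inChart x (extChartAt (𝓡∂ (d + 1)) x z) =
        wedge (Nat.add_comm 1 0) ((dForm lam : DiffForm (𝓡∂ (d + 1)) X 1).inChart x
          (extChartAt (𝓡∂ (d + 1)) x z)) (w.inChart x (extChartAt (𝓡∂ (d + 1)) x z)) := by
      rw [← DiffForm.inChart_wedge]
      exact DiffForm.inChart_congr hzs (hβ' z (hVU hz).1 hzi)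
    have e3 := contraction_wedge_one_zero ((dForm lam : DiffForm (𝓡∂ (d + 1)) X 1).inChart x
      (extChartAt (𝓡∂ (d + 1)) x z)) (w.inChart x (extChartAt (𝓡∂ (d + 1)) x z)) (e₀ d)
    rw [← e2, hcV z hz, ofReal_smul_form] at e3
    rw [DiffForm.eq_inChart w hzs]
    have e4 : w.inChart x (extChartAt (𝓡∂ (d + 1)) x z) = c (extChartAt (𝓡∂ (d + 1)) x z) •
        (β.inChart x (extChartAt (𝓡∂ (d + 1)) x z)).curryLeft (e₀ d) := by
      have hc0' := hc0 z hz
      rw [← e3]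
      ext v
      simp only [ContinuousAlternatingMap.smul_apply, Complex.real_smul, Complex.ofReal_inv]
      exact (mul_inv_cancel_left₀ (by exact_mod_cast hc0') _).symm
    rw [e4]
    rfl

/-- `exists_eq_mul`, together with the induced relation between the differentials. -/
theorem exists_eq_mul_dForm (h : IsBoundaryDefining d i lam) (hi : IsBoundaryPart d i)
    (h' : IsBoundaryDefining d i lam') (x : X) :
    ∃ (f : X → ℝ) (V : Set X), IsOpen V ∧ x ∈ V ∧ ∀ z ∈ V,
      ContMDiffAt (𝓡∂ (d + 1)) 𝓘(ℝ, ℝ) ∞ f z ∧ 0 < f z ∧ lam' z = f z * lam z ∧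
      (dForm lam' : DiffForm (𝓡∂ (d + 1)) X 1) z = f z • dForm lam z + lam z • dForm f z := by
  obtain ⟨f, hf⟩ := h.exists_eq_mul hi h' x
  obtain ⟨V, hVs, hV, hxV⟩ := eventually_nhds_iff.1 hf
  refine ⟨f, V, hV, hxV, fun z hz => ⟨(hVs z hz).1, (hVs z hz).2.1, (hVs z hz).2.2, ?_⟩⟩
  rw [← dForm_mul ((hVs z hz).1.mdifferentiableAt (by simp))
    ((h.contMDiff z).mdifferentiableAt (by simp))]
  refine dForm_congr ?_
  filter_upwards [hV.mem_nhds hz] with t ht using (hVs t ht).2.2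

/-- Logarithmic forms do not depend on the boundary defining function: if `lam' = f lam`, then
`lam' w = f (lam w)` and `dlam' ∧ w = f (dlam ∧ w) + df ∧ (lam w)`. -/
theorem isLogOn_of_isLogOn (h : IsBoundaryDefining d i lam) (hi : IsBoundaryPart d i)
    (h' : IsBoundaryDefining d i lam') (hU : IsOpen U) {w : DiffForm (𝓡∂ (d + 1)) X p}
    (hw : IsLogOn i lam U w) : IsLogOn i lam' U w := by
  refine h'.isLogOn_of_local (fun x hx => ?_) hU
  obtain ⟨f, V, hV, hxV, hf⟩ := h.exists_eq_mul_dForm hi h' x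
  obtain ⟨⟨α, hα, hα'⟩, β, hβ, hβ'⟩ := hw
  refine ⟨V ∩ U, hV.inter hU, ⟨hxV, hx⟩, ⟨fun z => f z • α z, fun z hz => ?_, fun z hz hzi => ?_⟩,
    ⟨fun z => f z • β z + DiffForm.wedge (Nat.add_comm 1 p) (dForm f) α z,
      fun z hz => ?_, fun z hz hzi => ?_⟩⟩
  · exact DiffForm.SmoothAt.smul (hf z hz.1).1 (hα z hz.2)
  · simp only [hα' z hz.2 hzi, (hf z hz.1).2.2.1, mul_smul]
  · exact (DiffForm.SmoothAt.smul (hf z hz.1).1 (hβ z hz.2)).add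
      (DiffForm.SmoothAt.wedge _ (DiffForm.smoothAt_dForm (hf z hz.1).1) (hα z hz.2))
  · have e := hα' z hz.2 hzi
    simp only [DiffForm.wedge] at *
    rw [hβ' z hz.2 hzi, e, (hf z hz.1).2.2.2, wedge_add_left, wedge_real_smul_left,
      wedge_real_smul_left, wedge_real_smul_right]

/-- Logarithmic forms are stable under `d`, because `lam dw = d (lam w) - dlam ∧ w` and
`dlam ∧ dw = -d (dlam ∧ w)`. -/
theorem isLogOn_d (h : IsBoundaryDefining d i lam) (hU : IsOpen U)
    {w : DiffForm (𝓡∂ (d + 1)) X p} (hw : IsLogOn i lam U w) : IsLogOn i lam U w.d := by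
  have hws : ∀ z ∈ U, z ∉ range i → w.SmoothAt z := fun z hz hzi =>
    h.smoothAt_of_isLogOn hU hw hz hzi
  have hev : ∀ z ∈ U, z ∉ range i → ∀ᶠ t in 𝓝 z, t ∈ U ∧ t ∉ range i := fun z hz hzi =>
    (hU.eventually_mem hz).and (h.isClosed_range.isOpen_compl.eventually_mem hzi)
  obtain ⟨⟨α, hα, hα'⟩, β, hβ, hβ'⟩ := hw
  have hd : ∀ {k : ℕ} {γ : DiffForm (𝓡∂ (d + 1)) X k}, γ.SmoothOn U → ∀ z ∈ U, γ.d.SmoothAt z :=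
    fun hγ z hz => DiffForm.smoothAt_d
      (by filter_upwards [hU.mem_nhds hz] with t ht using hγ t ht)
  refine ⟨⟨fun z => α.d z + (-1 : ℂ) • β z, fun z hz => ?_, fun z hz hzi => ?_⟩,
    ⟨fun z => (-1 : ℂ) • β.d z, fun z hz => (hd hβ z hz).const_smul _, fun z hz hzi => ?_⟩⟩
  · exact (hd hα z hz).add (DiffForm.SmoothAt.const_smul _ (hβ z hz))
  · have e1 : α.d z = DiffForm.d (fun z => lam z • w z) z := by
      refine DiffForm.d_congr ?_
      filter_upwards [hev z hz hzi] with t ht using hα' t ht.1 ht.2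
    simp only [e1]
    rw [DiffForm.d_smul (h.contMDiff z) (hws z hz hzi), hβ' z hz hzi, neg_one_smul_form]
    abel
  · have e1 : β.d z = DiffForm.d (DiffForm.wedge (Nat.add_comm 1 p) (dForm lam) w) z := by
      refine DiffForm.d_congr ?_
      filter_upwards [hev z hz hzi] with t ht using hβ' t ht.1 ht.2
    simp only [e1]
    rw [DiffForm.d_wedge_dForm (h.contMDiff z) (Eventually.of_forall h.contMDiff)
      (by filter_upwards [hev z hz hzi] with t ht using hws t ht.1 ht.2), neg_one_smul_form,
      neg_neg]

/-- The differential of a boundary defining function kills the vectors tangent to `Y`. -/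
theorem dForm_mfderiv_eq_zero (h : IsBoundaryDefining d i lam) (hi : IsBoundaryPart d i) (y : Y)
    (v : EuclideanSpace ℝ (Fin d)) :
    ((dForm lam : DiffForm (𝓡∂ (d + 1)) X 1) (i y) :
      (Fin 1 → EuclideanSpace ℝ (Fin (d + 1))) → ℂ) (fun _ =>
        (mfderiv (𝓡 d) (𝓡∂ (d + 1)) i y :
          EuclideanSpace ℝ (Fin d) →L[ℝ] EuclideanSpace ℝ (Fin (d + 1))) v) = 0 := by
  have h1 : mfderiv (𝓡 d) 𝓘(ℝ, ℝ) (lam ∘ i) y = 0 := by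
    have : lam ∘ i = fun _ => (0 : ℝ) := funext fun y => h.eq_zero _ (mem_range_self y)
    rw [this]
    exact mfderiv_const
  rw [mfderiv_comp y ((h.contMDiff _).mdifferentiableAt (by simp))
    ((hi.contMDiff y).mdifferentiableAt (by simp))] at h1
  have h2 := congrArg (fun L : EuclideanSpace ℝ (Fin d) →L[ℝ] ℝ => L v) h1
  exact congrArg Complex.ofReal h2

theorem exists_dForm_ne_zero (h : IsBoundaryDefining d i lam) (y : Y) :
    ∃ ν : EuclideanSpace ℝ (Fin (d + 1)), ((dForm lam : DiffForm (𝓡∂ (d + 1)) X 1) (i y) :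
      (Fin 1 → EuclideanSpace ℝ (Fin (d + 1))) → ℂ) (fun _ => ν) ≠ 0 := by
  by_contra hc
  push Not at hc
  refine h.mfderiv_ne_zero (i y) (mem_range_self y) ?_
  refine ContinuousLinearMap.ext fun ν => ?_
  exact Complex.ofReal_injective (hc ν)

/-- The restriction of `σ` to `Y` is determined by `dlam ∧ σ` along `Y`, as one sees by evaluating
on a vector transverse to `Y` followed by vectors tangent to `Y`. -/
theorem pullback_eq_of_wedge_eq (h : IsBoundaryDefining d i lam) (hi : IsBoundaryPart d i)
    {σ₁ σ₂ : DiffForm (𝓡∂ (d + 1)) X q} {y : Y}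
    (hw : DiffForm.wedge (Nat.add_comm 1 q) (dForm lam) σ₁ (i y) =
      DiffForm.wedge (Nat.add_comm 1 q) (dForm lam) σ₂ (i y)) :
    (DiffForm.pullback i σ₁ : DiffForm (𝓡 d) Y q) y = DiffForm.pullback i σ₂ y := by
  obtain ⟨ν, hν⟩ := h.exists_dForm_ne_zero y
  ext v
  set v' : Fin q → EuclideanSpace ℝ (Fin (d + 1)) := fun j =>
    (mfderiv (𝓡 d) (𝓡∂ (d + 1)) i y :
      EuclideanSpace ℝ (Fin d) →L[ℝ] EuclideanSpace ℝ (Fin (d + 1))) (v j) with hv'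
  have key : ∀ σ : DiffForm (𝓡∂ (d + 1)) X q,
      (DiffForm.wedge (Nat.add_comm 1 q) (dForm lam) σ (i y) :
        (Fin (q + 1) → EuclideanSpace ℝ (Fin (d + 1))) → ℂ) (Fin.cons ν v') =
      ((dForm lam : DiffForm (𝓡∂ (d + 1)) X 1) (i y) :
      (Fin 1 → EuclideanSpace ℝ (Fin (d + 1))) → ℂ) (fun _ => ν) *
        (σ (i y) : (Fin q → EuclideanSpace ℝ (Fin (d + 1))) → ℂ) v' := fun σ =>
    wedge_one_cons_of_forall_eq_zero (V := EuclideanSpace ℝ (Fin (d + 1))) _ _ ν v'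
      fun j => h.dForm_mfderiv_eq_zero hi y (v j)
  have h1 := key σ₁
  rw [show (DiffForm.wedge (Nat.add_comm 1 q) (dForm lam) σ₁ (i y) :
        (Fin (q + 1) → EuclideanSpace ℝ (Fin (d + 1))) → ℂ) = (DiffForm.wedge (Nat.add_comm 1 q)
          (dForm lam) σ₂ (i y) : (Fin (q + 1) → EuclideanSpace ℝ (Fin (d + 1))) → ℂ) from
      congrArg (fun a : EuclideanSpace ℝ (Fin (d + 1)) [⋀^Fin (q + 1)]→L[ℝ] ℂ =>
        (a : (Fin (q + 1) → EuclideanSpace ℝ (Fin (d + 1))) → ℂ)) hw, key σ₂] at h1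
  exact (mul_left_cancel₀ hν h1).symm

/-- Uniqueness of the residue: it depends neither on the decomposition, nor on the boundary
defining function, nor on the values of the form along `Y`. -/
theorem pullback_eq_of_isLogDecomposition {lam₁ lam₂ : X → ℝ}
    (h₁ : IsBoundaryDefining d i lam₁) (h₂ : IsBoundaryDefining d i lam₂)
    (hi : IsBoundaryPart d i) {U₁ U₂ : Set X} (hU₁ : IsOpen U₁) (hU₂ : IsOpen U₂)
    {w₁ w₂ : DiffForm (𝓡∂ (d + 1)) X (q + 1)}
    {σ₁ σ₂ : DiffForm (𝓡∂ (d + 1)) X q} {τ₁ τ₂ : DiffForm (𝓡∂ (d + 1)) X (q + 1)} {y : Y}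
    (hy₁ : i y ∈ U₁) (hy₂ : i y ∈ U₂) (hd₁ : IsLogDecomposition i lam₁ U₁ w₁ σ₁ τ₁)
    (hd₂ : IsLogDecomposition i lam₂ U₂ w₂ σ₂ τ₂)
    (hw : ∀ᶠ z in 𝓝 (i y), z ∉ range i → w₁ z = w₂ z) :
    (DiffForm.pullback i σ₁ : DiffForm (𝓡 d) Y q) y = DiffForm.pullback i σ₂ y := by
  obtain ⟨f, V, hV, hyV, hf⟩ := h₁.exists_eq_mul_dForm hi h₂ (i y)
  refine h₁.pullback_eq_of_wedge_eq hi ?_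
  have hl₁ : lam₁ (i y) = 0 := h₁.eq_zero _ (mem_range_self y)
  have hl₂ : lam₂ (i y) = 0 := h₂.eq_zero _ (mem_range_self y)
  -- `lam₂ w` extends across `Y` in two ways, which agree along `Y`.
  have key := h₁.eq_of_eventually_eq (x := i y)
    (α := fun z => f z • (DiffForm.wedge (Nat.add_comm 1 q) (dForm lam₁) σ₁ z + lam₁ z • τ₁ z))
    (β := fun z => DiffForm.wedge (Nat.add_comm 1 q) (dForm lam₂) σ₂ z + lam₂ z • τ₂ z)
    (DiffForm.SmoothAt.smul (hf _ hyV).1 ((DiffForm.SmoothAt.wedge _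
      (DiffForm.smoothAt_dForm (h₁.contMDiff _)) (hd₁.1 _ hy₁)).add
        (DiffForm.SmoothAt.smul (h₁.contMDiff _) (hd₁.2.1 _ hy₁))))
    ((DiffForm.SmoothAt.wedge _
      (DiffForm.smoothAt_dForm (h₂.contMDiff _)) (hd₂.1 _ hy₂)).add
        (DiffForm.SmoothAt.smul (h₂.contMDiff _) (hd₂.2.1 _ hy₂))) (by
    filter_upwards [hw, hV.mem_nhds hyV, hU₁.mem_nhds hy₁,
        hU₂.mem_nhds hy₂] with z hz hzV hz₁ hz₂ hzi
    have hz := hz hzi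
    rw [hd₁.2.2 z hz₁ hzi, hd₂.2.2 z hz₂ hzi] at hz
    have p₁ := h₁.pos z hzi
    have p₂ := h₂.pos z hzi
    have e₁ : ∀ (l : ℝ), 0 < l → ∀ a b : TangentSpace (𝓡∂ (d + 1)) z [⋀^Fin (q + 1)]→L[ℝ] ℂ,
        a + l • b = l • (l⁻¹ • a + b) := by
      intro l hl a b
      ext v
      have := hl.ne'
      simp [this]
    rw [e₁ _ p₁, e₁ _ p₂, hz, (hf z hzV).2.2.1]
    exact smul_smul _ _ _)
  simp only [hl₁, hl₂] at key
  rw [show (0 : ℝ) • τ₁ (i y) = 0 by ext v; simp, show (0 : ℝ) • τ₂ (i y) = 0 by ext v; simp,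
    add_zero, add_zero] at key
  have e2 : DiffForm.wedge (Nat.add_comm 1 q) (dForm lam₂) σ₂ (i y) =
      f (i y) • DiffForm.wedge (Nat.add_comm 1 q) (dForm lam₁) σ₂ (i y) := by
    simp only [DiffForm.wedge]
    rw [(hf _ hyV).2.2.2, hl₁, show (0 : ℝ) • (dForm f : DiffForm (𝓡∂ (d + 1)) X 1) (i y) = 0 by
      ext v; simp, add_zero, wedge_real_smul_left]
  rw [e2] at key
  have hf0 := (hf _ hyV).2.1.ne'
  ext v
  have := congrArg (fun a : EuclideanSpace ℝ (Fin (d + 1)) [⋀^Fin (q + 1)]→L[ℝ] ℂ => a v) key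
  exact smul_right_injective ℂ hf0 this

end IsBoundaryDefining

theorem IsLogDecomposition.mono {w : DiffForm (𝓡∂ (d + 1)) X (q + 1)}
    {σ : DiffForm (𝓡∂ (d + 1)) X q} {τ : DiffForm (𝓡∂ (d + 1)) X (q + 1)}
    (h : IsLogDecomposition i lam U w σ τ) (hV : V ⊆ U) : IsLogDecomposition i lam V w σ τ :=
  ⟨fun x hx => h.1 x (hV hx), fun x hx => h.2.1 x (hV hx), fun x hx => h.2.2 x (hV hx)⟩

theorem IsLogDecomposition.congr {w w' : DiffForm (𝓡∂ (d + 1)) X (q + 1)}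
    {σ : DiffForm (𝓡∂ (d + 1)) X q} {τ : DiffForm (𝓡∂ (d + 1)) X (q + 1)}
    (h : IsLogDecomposition i lam U w σ τ) (hw : ∀ x ∈ U, x ∉ range i → w' x = w x) :
    IsLogDecomposition i lam U w' σ τ :=
  ⟨h.1, h.2.1, fun x hx hxi => (hw x hx hxi).trans (h.2.2 x hx hxi)⟩

theorem IsLogDecomposition.add_smul {w w' : DiffForm (𝓡∂ (d + 1)) X (q + 1)}
    {σ σ' : DiffForm (𝓡∂ (d + 1)) X q} {τ τ' : DiffForm (𝓡∂ (d + 1)) X (q + 1)}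
    (h : IsLogDecomposition i lam U w σ τ) (h' : IsLogDecomposition i lam U w' σ' τ') (a b : ℂ) :
    IsLogDecomposition i lam U (fun x => a • w x + b • w' x) (fun x => a • σ x + b • σ' x)
      (fun x => a • τ x + b • τ' x) := by
  refine ⟨fun x hx => ?_, fun x hx => ?_, fun x hx hxi => ?_⟩
  · exact (DiffForm.SmoothAt.const_smul a (h.1 x hx)).add
      (DiffForm.SmoothAt.const_smul b (h'.1 x hx))
  · exact (DiffForm.SmoothAt.const_smul a (h.2.1 x hx)).add
      (DiffForm.SmoothAt.const_smul b (h'.2.1 x hx))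
  · beta_reduce
    rw [h.2.2 x hx hxi, h'.2.2 x hx hxi]
    simp only [DiffForm.wedge, wedge_add_right, wedge_smul_right]
    ext v
    simp only [ContinuousAlternatingMap.add_apply, ContinuousAlternatingMap.smul_apply,
      Complex.real_smul, smul_eq_mul]
    ring

/-- If `w = (dlam / lam) ∧ σ + τ`, then `dw = (dlam / lam) ∧ (-dσ) + dτ`, since
`dlam / lam = d (log lam)` is closed. -/
theorem IsLogDecomposition.exteriorDerivative (h : IsBoundaryDefining d i lam) (hU : IsOpen U)
    {w : DiffForm (𝓡∂ (d + 1)) X (q + 1)}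
    {σ : DiffForm (𝓡∂ (d + 1)) X q} {τ : DiffForm (𝓡∂ (d + 1)) X (q + 1)}
    (hd : IsLogDecomposition i lam U w σ τ) :
    IsLogDecomposition i lam U w.d (fun x => (-1 : ℂ) • σ.d x) τ.d := by
  have hds : ∀ {k : ℕ} {γ : DiffForm (𝓡∂ (d + 1)) X k}, γ.SmoothOn U → ∀ z ∈ U, γ.d.SmoothAt z :=
    fun hγ z hz => DiffForm.smoothAt_d
      (by filter_upwards [hU.mem_nhds hz] with t ht using hγ t ht)
  refine ⟨fun x hx => (hds hd.1 x hx).const_smul _, hds hd.2.1, fun x hx hxi => ?_⟩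
  have hlog : ∀ z ∉ range i, ContMDiffAt (𝓡∂ (d + 1)) 𝓘(ℝ, ℝ) ∞ (fun z => Real.log (lam z)) z :=
    fun z hz => (Real.contDiffAt_log.2 (h.pos z hz).ne').contMDiffAt.comp z (h.contMDiff z)
  have hdlog : ∀ z ∉ range i, (dForm (fun z => Real.log (lam z)) : DiffForm (𝓡∂ (d + 1)) X 1) z =
      (lam z)⁻¹ • dForm lam z := fun z hz =>
    dForm_log ((h.contMDiff z).mdifferentiableAt (by simp)) (h.pos z hz).ne'
  have hev : ∀ᶠ t in 𝓝 x, t ∈ U ∧ t ∉ range i :=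
    (hU.eventually_mem hx).and (h.isClosed_range.isOpen_compl.eventually_mem hxi)
  have e1 : w.d x = DiffForm.d (fun z => DiffForm.wedge (Nat.add_comm 1 q)
      (dForm (fun z => Real.log (lam z))) σ z + τ z) x := by
    refine DiffForm.d_congr ?_
    filter_upwards [hev] with t ht
    rw [hd.2.2 t ht.1 ht.2]
    simp only [DiffForm.wedge]
    rw [hdlog t ht.2, wedge_real_smul_left]
  rw [e1, DiffForm.d_add (DiffForm.SmoothAt.wedge _ (DiffForm.smoothAt_dForm (hlog x hxi))
    (hd.1 x hx)) (hd.2.1 x hx), DiffForm.d_wedge_dForm (hlog x hxi)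
    (by filter_upwards [hev] with t ht using hlog t ht.2)
    (by filter_upwards [hev] with t ht using hd.1 t ht.1)]
  simp only [DiffForm.wedge]
  rw [hdlog x hxi, wedge_real_smul_left, wedge_smul_right, neg_one_smul_form]
  ext v
  simp

theorem residue_eq_pullback (hi : IsBoundaryPart d i) (h : IsBoundaryDefining d i lam)
    (hU : IsOpen U)
    {w : DiffForm (𝓡∂ (d + 1)) X (q + 1)} {σ : DiffForm (𝓡∂ (d + 1)) X q}
    {τ : DiffForm (𝓡∂ (d + 1)) X (q + 1)} (hd : IsLogDecomposition i lam U w σ τ) {y : Y}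
    (hy : i y ∈ U) : residue i w y = DiffForm.pullback i σ y := by
  have hex : ∃ (σ : DiffForm (𝓡∂ (d + 1)) X q) (lam : X → ℝ) (U : Set X)
        (τ : DiffForm (𝓡∂ (d + 1)) X (q + 1)),
        IsBoundaryDefining d i lam ∧ IsOpen U ∧ i y ∈ U ∧ IsLogDecomposition i lam U w σ τ :=
    ⟨σ, lam, U, τ, h, hU, hy, hd⟩
  have e1 : residue i w y = DiffForm.pullback i hex.choose y := dif_pos hex
  rw [e1]
  obtain ⟨lam₁, U₁, τ₁, h₁, hU₁, hy₁, hd₁⟩ := hex.choose_spec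
  exact h₁.pullback_eq_of_isLogDecomposition h hi hU₁ hU hy₁ hy hd₁ hd
      (Eventually.of_forall fun _ _ => rfl)

variable {w w' : DiffForm (𝓡∂ (d + 1)) X (q + 1)}

/-- Near every point of `Y`, the residue is the pull-back of a smooth form. -/
theorem eventually_residue_eq_pullback (hi : IsBoundaryPart d i) (h : IsBoundaryDefining d i lam)
    (hV : IsOpen V)
    {σ : DiffForm (𝓡∂ (d + 1)) X q} {τ : DiffForm (𝓡∂ (d + 1)) X (q + 1)}
    (hd : IsLogDecomposition i lam V w σ τ) {y : Y} (hy : i y ∈ V) :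
    ∀ᶠ z in 𝓝 y, residue i w z = DiffForm.pullback i σ z := by
  filter_upwards [hi.contMDiff.continuous.continuousAt.preimage_mem_nhds (hV.mem_nhds hy)] with z hz
  exact residue_eq_pullback hi h hV hd hz

theorem smoothAt_residue (hi : IsBoundaryPart d i) (h : IsBoundaryDefining d i lam)
    (hU : IsOpen U) (hw : IsLogOn i lam U w) {y : Y} (hy : i y ∈ U) : (residue i w).SmoothAt y := by
  obtain ⟨V, -, hV, hyV, σ, τ, hd⟩ := h.exists_isLogDecomposition hi hU hw hy
  exact (DiffForm.SmoothAt.pullback hi.contMDiff (hd.1 _ hyV)).congr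
    (eventually_residue_eq_pullback hi h hV hd hyV)

theorem residue_congr (hi : IsBoundaryPart d i) (h : IsBoundaryDefining d i lam)
    (hU : IsOpen U) (hw : IsLogOn i lam U w) (hV : IsOpen V)
    (hww' : ∀ x ∈ V, x ∉ range i → w' x = w x) {y : Y} (hyU : i y ∈ U) (hyV : i y ∈ V) :
    residue i w' y = residue i w y := by
  obtain ⟨V', -, hV', hyV', σ, τ, hd⟩ := h.exists_isLogDecomposition hi hU hw hyU
  rw [residue_eq_pullback hi h hV' hd hyV', residue_eq_pullback hi h (hV'.inter hV)
    ((hd.mono inter_subset_left).congr fun x hx => hww' x hx.2) ⟨hyV', hyV⟩]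

theorem residue_add_smul (hi : IsBoundaryPart d i) (h : IsBoundaryDefining d i lam)
    (hU : IsOpen U) (hw : IsLogOn i lam U w) (hw' : IsLogOn i lam U w') (a b : ℂ) {y : Y}
    (hy : i y ∈ U) : residue i (fun x => a • w x + b • w' x) y =
      a • residue i w y + b • residue i w' y := by
  obtain ⟨V, -, hV, hyV, σ, τ, hd⟩ := h.exists_isLogDecomposition hi hU hw hy
  obtain ⟨V', -, hV', hyV', σ', τ', hd'⟩ := h.exists_isLogDecomposition hi hU hw' hy
  rw [residue_eq_pullback hi h hV hd hyV, residue_eq_pullback hi h hV' hd' hyV',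
    residue_eq_pullback hi h (hV.inter hV') ((hd.mono inter_subset_left).add_smul
      (hd'.mono inter_subset_right) a b) ⟨hyV, hyV'⟩]
  rfl

theorem residue_d (hi : IsBoundaryPart d i) (h : IsBoundaryDefining d i lam)
    (hU : IsOpen U) (hw : IsLogOn i lam U w) {y : Y} (hy : i y ∈ U) :
    residue i w.d y = -(residue i w).d y := by
  obtain ⟨V, -, hV, hyV, σ, τ, hd⟩ := h.exists_isLogDecomposition hi hU hw hy
  rw [residue_eq_pullback hi h hV (hd.exteriorDerivative h hV) hyV,
    DiffForm.d_congr (eventually_residue_eq_pullback hi h hV hd hyV),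
    DiffForm.d_pullback hi.contMDiff (hd.1 _ hyV)]
  ext v
  simp [DiffForm.pullback]

/-- The differential of a logarithmic `0`-form is smooth across `Y`, so it has no residue. -/
theorem residue_d_zero (hi : IsBoundaryPart d i) (h : IsBoundaryDefining d i lam)
    (hU : IsOpen U) {w : DiffForm (𝓡∂ (d + 1)) X 0} (hw : IsLogOn i lam U w) {y : Y}
    (hy : i y ∈ U) : residue i w.d y = 0 := by
  obtain ⟨w', hw', hww'⟩ := h.extendsSmoothly_of_isLogOn_zero hi hU hw
  have hd : IsLogDecomposition i lam U w.d (fun _ => 0) w'.d := by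
    refine ⟨fun x _ => DiffForm.smoothAt_zero, fun x hx => DiffForm.smoothAt_d
      (by filter_upwards [hU.mem_nhds hx] with t ht using hw' t ht), fun x hx hxi => ?_⟩
    rw [DiffForm.wedge, wedge_zero_right, smul_zero_form]
    refine Eq.trans ?_ (zero_add (w'.d x)).symm
    refine DiffForm.d_congr ?_
    filter_upwards [hU.mem_nhds hx, h.isClosed_range.isOpen_compl.mem_nhds hxi] with t ht hti
    exact (hww' t ht hti).symm
  rw [residue_eq_pullback hi h hU hd hy]
  ext v
  simp [DiffForm.pullback]

end LogComplex

/-! ### Integration over the half-space -/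

section HalfSpaceIntegral

variable {d : ℕ}

/-- The identification of `ℝ × ℝ^d` with `ℝ^(d+1)`. -/
def consE (x : ℝ × EuclideanSpace ℝ (Fin d)) : EuclideanSpace ℝ (Fin (d + 1)) :=
  WithLp.toLp 2 (Fin.cons x.1 x.2.ofLp)

theorem consE_zero (t : ℝ) (v : EuclideanSpace ℝ (Fin d)) : consE (t, v) 0 = t := rfl

theorem consE_succ (t : ℝ) (v : EuclideanSpace ℝ (Fin d)) (j : Fin d) :
    consE (t, v) j.succ = v j := rfl

theorem tailL_consE (t : ℝ) (v : EuclideanSpace ℝ (Fin d)) : tailL d (consE (t, v)) = v := by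
  ext j
  rw [tailL_apply, consE_succ]

theorem consE_tailL {u : EuclideanSpace ℝ (Fin (d + 1))} : consE (u 0, tailL d u) = u :=
  eq_of_tailL_eq rfl (tailL_consE _ _)

theorem contDiff_consE {n : WithTop ℕ∞} : ContDiff ℝ n (consE (d := d)) := by
  rw [contDiff_euclidean]
  intro j
  refine Fin.cases ?_ (fun k => ?_) j
  · exact contDiff_fst
  · exact (contDiff_euclidean.1 contDiff_id k).comp contDiff_snd

theorem consE_add (t s : ℝ) (v : EuclideanSpace ℝ (Fin d)) :
    consE (t + s, v) = consE (t, v) + s • e₀ d := by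
  ext j
  refine Fin.cases ?_ (fun k => ?_) j
  · simp [consE_zero, e₀_zero]
  · simp [consE_succ, e₀_of_ne (Fin.succ_ne_zero k)]

theorem hasDerivAt_consE (t : ℝ) (v : EuclideanSpace ℝ (Fin d)) :
    HasDerivAt (fun s => consE (s, v)) (e₀ d) t := by
  have h : (fun s => consE (s, v)) = fun s : ℝ => consE (0, v) + s • e₀ d := by
    funext s
    rw [← consE_add, zero_add]
  rw [h]
  simpa using ((hasDerivAt_id t).smul_const (e₀ d)).const_add (consE (0, v))

/-- `consE` as a measurable equivalence. -/
def consEquiv (d : ℕ) : ℝ × EuclideanSpace ℝ (Fin d) ≃ᵐ EuclideanSpace ℝ (Fin (d + 1)) where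
  toFun := consE
  invFun u := (u 0, tailL d u)
  left_inv x := by
    obtain ⟨t, v⟩ := x
    simp [tailL_consE, consE_zero]
  right_inv u := consE_tailL
  measurable_toFun := contDiff_consE (n := 0).continuous.measurable
  measurable_invFun := by
    have h1 : Measurable fun u : EuclideanSpace ℝ (Fin (d + 1)) => u 0 :=
      (contDiff_coord (n := 0) 0).continuous.measurable
    exact h1.prodMk (tailL d).continuous.measurable

theorem measurePreserving_consEquiv (d : ℕ) :
    MeasurePreserving (consEquiv d) (volume.prod volume) volume := by
  have h1 := (volume_preserving_piFinSuccAbove (fun _ : Fin (d + 1) => ℝ) 0).symm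
  have h2 := (MeasurePreserving.id (volume : Measure ℝ)).prod (PiLp.volume_preserving_ofLp (Fin d))
  have h3 := (PiLp.volume_preserving_toLp (Fin (d + 1))).comp (h1.comp h2)
  convert! h3 using 1
  funext x
  refine PiLp.ext fun j => ?_
  refine Fin.cases ?_ (fun k => ?_) j
  · rfl
  · rfl

theorem measurableSet_halfSpace : MeasurableSet (range (𝓡∂ (d + 1))) := by
  have : range (𝓡∂ (d + 1)) = {u : EuclideanSpace ℝ (Fin (d + 1)) | 0 ≤ u 0} := by
    ext u
    exact mem_halfSpace
  rw [this]
  exact measurableSet_le measurable_const (contDiff_coord (n := 0) 0).continuous.measurable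

/-- The boundary of the half-space is a null set. -/
theorem volume_coord_zero_eq_zero :
    volume {u : EuclideanSpace ℝ (Fin (d + 1)) | u 0 = 0} = 0 := by
  have hm : MeasurableSet {u : EuclideanSpace ℝ (Fin (d + 1)) | u 0 = 0} :=
    measurableSet_eq_fun (contDiff_coord (n := 0) 0).continuous.measurable measurable_const
  rw [← (measurePreserving_consEquiv d).measure_preimage hm.nullMeasurableSet]
  have : (consEquiv d) ⁻¹' {u : EuclideanSpace ℝ (Fin (d + 1)) | u 0 = 0} =
      ({0} : Set ℝ) ×ˢ (univ : Set (EuclideanSpace ℝ (Fin d))) := by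
    ext ⟨t, v⟩
    simp only [mem_preimage, mem_prod, mem_univ, and_true, mem_singleton_iff]
    exact Iff.rfl
  rw [this, Measure.prod_prod]
  simp

variable {S : Set (EuclideanSpace ℝ (Fin (d + 1)))}

theorem integrable_of_continuousOn_halfSpace (hS : IsCompact S) (hSH : S ⊆ range (𝓡∂ (d + 1)))
    {k : EuclideanSpace ℝ (Fin (d + 1)) → ℂ} (hk : ContinuousOn k (range (𝓡∂ (d + 1))))
    (hk0 : ∀ u ∉ S, k u = 0) : Integrable k := by
  have h1 : IntegrableOn k S := (hk.mono hSH).integrableOn_compact hS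
  refine (integrableOn_iff_integrable_of_support_subset ?_).1 h1
  intro u hu
  by_contra h
  exact hu (hk0 u h)

theorem setIntegral_halfSpace_eq_integral (hSH : S ⊆ range (𝓡∂ (d + 1)))
    {k : EuclideanSpace ℝ (Fin (d + 1)) → ℂ}
    (hk0 : ∀ u ∉ S, k u = 0) : ∫ u in range (𝓡∂ (d + 1)), k u = ∫ u, k u :=
  setIntegral_eq_integral_of_forall_compl_eq_zero fun u hu => hk0 u fun h => hu (hSH h)

/-- The integral over the half-space of the derivative in the first coordinate. -/
theorem integral_halfSpace_deriv (hS : IsCompact S) (hSH : S ⊆ range (𝓡∂ (d + 1)))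
    {k k' : EuclideanSpace ℝ (Fin (d + 1)) → ℂ} (hk : ContinuousOn k (range (𝓡∂ (d + 1))))
    (hk' : ContinuousOn k' (range (𝓡∂ (d + 1)))) (hk0 : ∀ u ∉ S, k u = 0)
    (hk0' : ∀ u ∉ S, k' u = 0)
    (hd : ∀ (t : ℝ) (v : EuclideanSpace ℝ (Fin d)), 0 < t →
      HasDerivAt (fun s => k (consE (s, v))) (k' (consE (t, v))) t) :
    ∫ u in range (𝓡∂ (d + 1)), k' u = -∫ v : EuclideanSpace ℝ (Fin d), k (consE (0, v)) := by
  have hint := integrable_of_continuousOn_halfSpace hS hSH hk' hk0'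
  have hint' : Integrable (fun x => k' (consEquiv d x)) (volume.prod volume) :=
    (measurePreserving_consEquiv d).integrable_comp_emb (consEquiv d).measurableEmbedding |>.2 hint
  have e1 : ∫ u, k' u = ∫ v : EuclideanSpace ℝ (Fin d), ∫ t : ℝ, k' (consE (t, v)) := by
    rw [← (measurePreserving_consEquiv d).integral_comp (consEquiv d).measurableEmbedding]
    exact integral_prod_symm _ hint'
  rw [setIntegral_halfSpace_eq_integral hSH hk0', e1, ← integral_neg]
  refine integral_congr_ae (Eventually.of_forall fun v => ?_)
  simp only
  obtain ⟨R, hR⟩ := hS.isBounded.exists_norm_le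
  have hmem : ∀ t : ℝ, consE (t, v) ∈ S → t ≤ R := by
    intro t ht
    have h1 := PiLp.norm_apply_le (consE (t, v)) 0
    have h2 := hR _ ht
    rw [consE_zero, Real.norm_eq_abs] at h1
    exact (le_abs_self t).trans (h1.trans h2)
  have hc : Continuous fun t : ℝ => consE (t, v) := by
    exact (contDiff_consE (n := 0)).continuous.comp (by fun_prop)
  have hmaps : MapsTo (fun t : ℝ => consE (t, v)) (Ici 0) (range (𝓡∂ (d + 1))) := by
    intro t ht
    exact mem_halfSpace.2 ht
  have hcont := hk.comp hc.continuousOn hmaps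
  have hcont' := hk'.comp hc.continuousOn hmaps
  have e2 : ∫ t : ℝ, k' (consE (t, v)) = ∫ t in Ioi (0 : ℝ), k' (consE (t, v)) := by
    rw [← integral_Ici_eq_integral_Ioi]
    refine (setIntegral_eq_integral_of_forall_compl_eq_zero fun t ht => hk0' _ fun h => ht ?_).symm
    exact mem_halfSpace.1 (hSH h)
  have hi : IntegrableOn (fun t => k' (consE (t, v))) (Ioi 0) := by
    have h1 : IntegrableOn (fun t => k' (consE (t, v))) (Icc 0 R) :=
      (hcont'.mono Icc_subset_Ici_self).integrableOn_compact isCompact_Icc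
    refine h1.of_forall_sdiff_eq_zero measurableSet_Ioi fun t ht => hk0' _ fun h => ht.2 ?_
    exact ⟨le_of_lt ht.1, hmem t h⟩
  rw [e2, integral_Ioi_of_hasDerivAt_of_tendsto (f := fun t => k (consE (t, v))) (m := 0)
    (hcont 0 self_mem_Ici) (fun t ht => hd t v ht) hi, zero_sub]
  refine tendsto_const_nhds.congr' ?_
  filter_upwards [eventually_gt_atTop R] with t ht
  exact (hk0 _ fun h => absurd (hmem t h) (not_le.2 ht)).symm

end HalfSpaceIntegral

/-! ### Zeta integrals on the half-space -/

section FlatZeta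

variable {d : ℕ} {S : Set (EuclideanSpace ℝ (Fin (d + 1)))}
  {Λ β γ : EuclideanSpace ℝ (Fin (d + 1)) → ℝ}

/-- The derivative in the first coordinate, of a function on the half-space. -/
def partial₀ {F : Type*} [NormedAddCommGroup F] [NormedSpace ℝ F]
    (k : EuclideanSpace ℝ (Fin (d + 1)) → F) (u : EuclideanSpace ℝ (Fin (d + 1))) : F :=
  fderivWithin ℝ k (range (𝓡∂ (d + 1))) u (e₀ d)

/-- A smooth function on the half-space which vanishes off `S`. -/
def IsTest (S : Set (EuclideanSpace ℝ (Fin (d + 1)))) (h : EuclideanSpace ℝ (Fin (d + 1)) → ℂ) :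
    Prop :=
  ContDiffOn ℝ ∞ h (range (𝓡∂ (d + 1))) ∧ ∀ u ∉ S, h u = 0

theorem contDiffWithinAt_partial₀ {F : Type*} [NormedAddCommGroup F] [NormedSpace ℝ F]
    {k : EuclideanSpace ℝ (Fin (d + 1)) → F} {u : EuclideanSpace ℝ (Fin (d + 1))}
    (hu : u ∈ range (𝓡∂ (d + 1)))
    (h : ContDiffWithinAt ℝ ∞ k (range (𝓡∂ (d + 1))) u) :
    ContDiffWithinAt ℝ ∞ (partial₀ k) (range (𝓡∂ (d + 1))) u :=
  (h.fderivWithin_right (𝓡∂ (d + 1)).uniqueDiffOn (by simp) hu).clm_apply contDiffWithinAt_const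

theorem hasDerivAt_consE_of_pos {F : Type*} [NormedAddCommGroup F] [NormedSpace ℝ F]
    {k : EuclideanSpace ℝ (Fin (d + 1)) → F} {t : ℝ} (ht : 0 < t) {v : EuclideanSpace ℝ (Fin d)}
    (h : ContDiffWithinAt ℝ ∞ k (range (𝓡∂ (d + 1))) (consE (t, v))) :
    HasDerivAt (fun s => k (consE (s, v))) (partial₀ k (consE (t, v))) t := by
  have hn : range (𝓡∂ (d + 1)) ∈ 𝓝 (consE (t, v)) := by
    have ho : IsOpen {u : EuclideanSpace ℝ (Fin (d + 1)) | 0 < u 0} :=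
      isOpen_lt continuous_const (contDiff_coord (n := 0) 0).continuous
    exact mem_of_superset (ho.mem_nhds (show (0 : ℝ) < consE (t, v) 0 from ht)) fun u hu =>
      mem_halfSpace.2 (le_of_lt hu)
  have h1 : HasFDerivAt k (fderivWithin ℝ k (range (𝓡∂ (d + 1))) (consE (t, v))) (consE (t, v)) :=
    (h.differentiableWithinAt (by simp)).hasFDerivWithinAt.hasFDerivAt hn
  exact h1.comp_hasDerivAt t (hasDerivAt_consE t v)

namespace IsTest

variable {h : EuclideanSpace ℝ (Fin (d + 1)) → ℂ}

theorem eventually_eq_zero (hS : IsCompact S) (hh : IsTest S h)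
    {u : EuclideanSpace ℝ (Fin (d + 1))} (hu : u ∉ S) : h =ᶠ[𝓝 u] fun _ => 0 := by
  filter_upwards [hS.isClosed.isOpen_compl.mem_nhds hu] with z hz using hh.2 z hz

theorem smul (hS : IsCompact S) (hh : IsTest S h) {f : EuclideanSpace ℝ (Fin (d + 1)) → ℝ}
    (hf : ∀ u ∈ S, ContDiffWithinAt ℝ ∞ f (range (𝓡∂ (d + 1))) u) :
    IsTest S (fun u => f u • h u) := by
  refine ⟨fun u hu => ?_, fun u hu => by simp [hh.2 u hu]⟩
  by_cases huS : u ∈ S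
  · exact (hf u huS).smul (hh.1 u hu)
  · refine contDiffWithinAt_const (c := (0 : ℂ)) |>.congr_of_eventuallyEq ?_ (by simp [hh.2 u huS])
    refine nhdsWithin_le_nhds ?_
    filter_upwards [hh.eventually_eq_zero hS huS] with z hz
    simp [hz]

theorem deriv (hS : IsCompact S) (hh : IsTest S h) : IsTest S (partial₀ h) := by
  refine ⟨fun u hu => contDiffWithinAt_partial₀ hu (hh.1 u hu), fun u hu => ?_⟩
  have h1 := (hh.eventually_eq_zero hS hu).fderivWithin_eq_of_nhds (𝕜 := ℝ)
    (s := range (𝓡∂ (d + 1)))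
  rw [partial₀, h1]
  simp

end IsTest

/-- Data on a compact subset `S` of the half-space: a function `Λ` which is positive in the
interior, together with `β, γ` such that the vector field `β ∂₀` and the function `γ` satisfy
`(β ∂₀ + γ) Λ = 1`, and such that `β` vanishes at the boundary points where `Λ` does not. -/
structure IsFlatData (S : Set (EuclideanSpace ℝ (Fin (d + 1))))
    (Λ β γ : EuclideanSpace ℝ (Fin (d + 1)) → ℝ) : Prop where
  isCompact : IsCompact S
  subset : S ⊆ range (𝓡∂ (d + 1))
  smooth : ∀ u ∈ S, ContDiffWithinAt ℝ ∞ Λ (range (𝓡∂ (d + 1))) u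
  smooth_vector : ∀ u ∈ S, ContDiffWithinAt ℝ ∞ β (range (𝓡∂ (d + 1))) u
  smooth_function : ∀ u ∈ S, ContDiffWithinAt ℝ ∞ γ (range (𝓡∂ (d + 1))) u
  nonneg : ∀ u ∈ S, 0 ≤ Λ u
  pos : ∀ u ∈ S, 0 < u 0 → 0 < Λ u
  sum_eq_one : ∀ u ∈ S, β u * partial₀ Λ u + γ u * Λ u = 1
  boundary : ∀ u ∈ S, u 0 = 0 → Λ u * β u = 0

/-- The local zeta integral `∫ Λ^(s-1) h` over the half-space. The shift in the exponent makes up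
for the simple pole of the form that is integrated. -/
def flatZeta (Λ : EuclideanSpace ℝ (Fin (d + 1)) → ℝ) (h : EuclideanSpace ℝ (Fin (d + 1)) → ℂ)
    (s : ℂ) : ℂ :=
  ∫ u in range (𝓡∂ (d + 1)), (Λ u : ℂ) ^ (s - 1) * h u

theorem cpow_sub_one_mul_self {s : ℂ} (hs : s ≠ 0) (x : ℂ) : x ^ (s - 1) * x = x ^ s := by
  by_cases hx : x = 0
  · rw [hx, mul_zero, Complex.zero_cpow hs]
  · rw [Complex.cpow_sub _ _ hx, Complex.cpow_one, div_mul_cancel₀ _ hx]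

namespace IsFlatData

variable {h : EuclideanSpace ℝ (Fin (d + 1)) → ℂ}

theorem continuousOn_cpow_mul (hD : IsFlatData S Λ β γ) (hh : IsTest S h) {s : ℂ}
    (hs : 0 < s.re ∨ s = 0) :
    ContinuousOn (fun u => (Λ u : ℂ) ^ s * h u) (range (𝓡∂ (d + 1))) := by
  intro u hu
  by_cases huS : u ∈ S
  · refine ContinuousWithinAt.mul ?_ (hh.1 u hu).continuousWithinAt
    rcases hs with hs | rfl
    · exact (Complex.continuous_ofReal_cpow_const hs).continuousAt.comp_continuousWithinAt
        (hD.smooth u huS).continuousWithinAt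
    · simpa using continuousWithinAt_const
  · refine continuousWithinAt_const (b := (0 : ℂ)) |>.congr_of_eventuallyEq ?_
      (by simp [hh.2 u huS])
    refine nhdsWithin_le_nhds ?_
    filter_upwards [hh.eventually_eq_zero hD.isCompact huS] with z hz
    simp [hz]

theorem integrable_cpow_mul (hD : IsFlatData S Λ β γ) (hh : IsTest S h) {s : ℂ}
    (hs : 0 < s.re ∨ s = 0) : Integrable (fun u => (Λ u : ℂ) ^ s * h u) :=
  integrable_of_continuousOn_halfSpace hD.isCompact hD.subset (hD.continuousOn_cpow_mul hh hs)
    fun u hu => by simp [hh.2 u hu]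

theorem isTest_mul (hD : IsFlatData S Λ β γ) (hh : IsTest S h) :
    IsTest S (fun u => γ u • h u) := hh.smul hD.isCompact hD.smooth_function

theorem isTest_deriv (hD : IsFlatData S Λ β γ) (hh : IsTest S h) :
    IsTest S (partial₀ fun u => β u • h u) :=
  (hh.smul hD.isCompact hD.smooth_vector).deriv hD.isCompact

/-- Integration by parts along the vector field `β ∂₀`, based on
`Λ^(s-1) h = s⁻¹ β ∂₀(Λ^s) h + Λ^s γ h`. There is no boundary term because `Λ^s β` vanishes on the
boundary. The case `s = 1` is included for the computation of the residue. -/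
theorem flatZeta_eq (hD : IsFlatData S Λ β γ) (hh : IsTest S h) {s : ℂ}
    (hs : 1 < s.re ∨ s = 1) :
    flatZeta Λ h s = flatZeta Λ (fun u => γ u • h u) (s + 1) -
      s⁻¹ * flatZeta Λ (partial₀ fun u => β u • h u) (s + 1) := by
  have hs0 : 0 < s.re := by
    rcases hs with hs | rfl
    · linarith
    · simp
  have hs0' : s ≠ 0 := fun h => by simp [h] at hs0
  have hs1 : 0 < (s - 1).re ∨ s - 1 = 0 := by
    rcases hs with hs | rfl
    · exact Or.inl (by simpa using hs)
    · exact Or.inr (by simp)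
  have hβh := hh.smul hD.isCompact hD.smooth_vector
  have hγh := hD.isTest_mul hh
  have hBh := hD.isTest_deriv hh
  have hm : IsTest S fun u => partial₀ Λ u • (β u • h u) := hβh.smul hD.isCompact fun u hu =>
    contDiffWithinAt_partial₀ (hD.subset hu) (hD.smooth u hu)
  have key := integral_halfSpace_deriv hD.isCompact hD.subset
    (k := fun u => (Λ u : ℂ) ^ s * (β u • h u))
    (k' := fun u => s * ((Λ u : ℂ) ^ (s - 1) * (partial₀ Λ u • (β u • h u))) +
      (Λ u : ℂ) ^ s * (partial₀ fun u => β u • h u) u)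
    (hD.continuousOn_cpow_mul hβh (Or.inl hs0))
    ((continuousOn_const.mul (hD.continuousOn_cpow_mul hm hs1)).add
      (hD.continuousOn_cpow_mul hBh (Or.inl hs0)))
    (fun u hu => by simp [hh.2 u hu]) (fun u hu => by rw [hBh.2 u hu, hh.2 u hu]; simp) (by
      intro t v ht
      by_cases hu : consE (t, v) ∈ S
      · have h1 := hasDerivAt_consE_of_pos ht (hD.smooth _ hu)
        have h2 := hasDerivAt_consE_of_pos ht (hβh.1 _ (hD.subset hu))
        have h3 := (hasDerivAt_ofReal_cpow_const (hD.pos _ hu ht).ne' hs0').scomp t h1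
        refine (h3.mul h2).congr_deriv ?_
        simp only [Complex.real_smul, Function.comp]
        ring
      · have h0 : (s * ((Λ (consE (t, v)) : ℂ) ^ (s - 1) * (partial₀ Λ (consE (t, v)) •
            (β (consE (t, v)) • h (consE (t, v))))) +
          (Λ (consE (t, v)) : ℂ) ^ s * (partial₀ fun u => β u • h u) (consE (t, v))) = 0 := by
          rw [hBh.2 _ hu, hh.2 _ hu]
          simp
        simp only [h0]
        refine (hasDerivAt_const t (0 : ℂ)).congr_of_eventuallyEq ?_
        have hc : Tendsto (fun s : ℝ => consE (s, v)) (𝓝 t) (𝓝 (consE (t, v))) :=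
          ((contDiff_consE (n := 0)).continuous.comp (by fun_prop)).tendsto t
        filter_upwards [hc.eventually (hh.eventually_eq_zero hD.isCompact hu)] with r hr
        simp [hr])
  have hb : ∀ v : EuclideanSpace ℝ (Fin d),
      (Λ (consE (0, v)) : ℂ) ^ s * (β (consE (0, v)) • h (consE (0, v))) = 0 := by
    intro v
    by_cases hu : consE (0, v) ∈ S
    · rcases mul_eq_zero.1 (hD.boundary _ hu rfl) with h0 | h0
      · simp [h0, hs0']
      · simp [h0]
    · simp [hh.2 _ hu]
  simp only [hb, integral_zero, neg_zero] at key
  have i1 := (hD.integrable_cpow_mul hm hs1).integrableOn (s := range (𝓡∂ (d + 1)))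
  have i2 := (hD.integrable_cpow_mul hBh (Or.inl hs0)).integrableOn (s := range (𝓡∂ (d + 1)))
  have i3 := (hD.integrable_cpow_mul hγh (Or.inl hs0)).integrableOn (s := range (𝓡∂ (d + 1)))
  rw [integral_add (i1.const_mul s) i2, integral_const_mul] at key
  have hsplit : flatZeta Λ h s =
      (∫ u in range (𝓡∂ (d + 1)), (Λ u : ℂ) ^ (s - 1) * (partial₀ Λ u • (β u • h u))) +
      ∫ u in range (𝓡∂ (d + 1)), (Λ u : ℂ) ^ s * (γ u • h u) := by
    rw [← integral_add i1 i3]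
    refine setIntegral_congr_fun measurableSet_halfSpace fun u _ => ?_
    by_cases hu : u ∈ S
    · have h1 : ((β u : ℂ) * ((partial₀ Λ u : ℝ) : ℂ) + (γ u : ℂ) * (Λ u : ℂ)) = 1 := by
        exact_mod_cast hD.sum_eq_one u hu
      simp only [Complex.real_smul]
      rw [← cpow_sub_one_mul_self hs0']
      linear_combination (-(Λ u : ℂ) ^ (s - 1) * h u) * h1
    · simp [hh.2 _ hu]
  rw [hsplit]
  simp only [flatZeta, add_sub_cancel_right]
  field_simp
  linear_combination key

/-- Holomorphy in the half-plane `1 < Re s`, by differentiation under the integral sign. -/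
theorem differentiableAt_flatZeta (hD : IsFlatData S Λ β γ) (hh : IsTest S h) {s : ℂ}
    (hs : 1 < s.re) : DifferentiableAt ℂ (flatZeta Λ h) s := by
  have hSm := hD.isCompact.measurableSet
  have hΛc : ContinuousOn Λ S := fun u hu =>
    (hD.smooth u hu).continuousWithinAt.mono hD.subset
  have hhc : ContinuousOn h S := fun u hu =>
    (hh.1 u (hD.subset hu)).continuousWithinAt.mono hD.subset
  obtain ⟨L, hL⟩ := hD.isCompact.exists_bound_of_continuousOn hΛc
  obtain ⟨C, hC⟩ := hD.isCompact.exists_bound_of_continuousOn hhc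
  set ε := (s.re - 1) / 2 with hε
  have hεp : 0 < ε := by rw [hε]; linarith
  set L' := max L 1 with hL'
  have hL1 : 1 ≤ L' := le_max_right _ _
  set B := L' ^ (s.re + ε - 1) * |C| with hB
  have hre : ∀ z ∈ Metric.closedBall s ε, 1 < z.re ∧ z.re ≤ s.re + ε := by
    intro z hz
    have h1 := (Complex.abs_re_le_norm (z - s)).trans (mem_closedBall_iff_norm.1 hz)
    rw [Complex.sub_re] at h1
    have := abs_le.1 h1
    rw [hε] at this ⊢
    constructor <;> linarith
  have hbound : ∀ u ∈ S, ∀ z ∈ Metric.closedBall s ε, ‖(Λ u : ℂ) ^ (z - 1) * h u‖ ≤ B := by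
    intro u hu z hz
    have hz1 : 0 < (z - 1).re := by simpa using (hre z hz).1
    rw [norm_mul, Complex.norm_cpow_eq_rpow_re_of_nonneg (hD.nonneg u hu) hz1.ne']
    refine mul_le_mul ?_ ((hC u hu).trans (le_abs_self C)) (norm_nonneg _) (by positivity)
    have h1 : Λ u ≤ L' := (le_abs_self _).trans ((hL u hu).trans (le_max_left _ _))
    refine (Real.rpow_le_rpow (hD.nonneg u hu) h1 hz1.le).trans ?_
    refine Real.rpow_le_rpow_of_exponent_le hL1 ?_
    have := (hre z hz).2
    simp only [Complex.sub_re, Complex.one_re]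
    linarith
  have hderiv : ∀ u, ∀ z : ℂ, 1 < z.re → HasDerivAt (fun z => (Λ u : ℂ) ^ (z - 1) * h u)
      ((Λ u : ℂ) ^ (z - 1) * Complex.log (Λ u) * h u) z := by
    intro u z hz
    have h1 : HasDerivAt (fun z : ℂ => z - 1) 1 z := (hasDerivAt_id z).sub_const 1
    have h2 := (h1.const_cpow (c := (Λ u : ℂ)) (Or.inr (by
      intro h0
      have := congrArg Complex.re h0
      simp only [Complex.sub_re, Complex.one_re, Complex.zero_re] at this
      linarith))).mul_const (h u)
    simpa using h2
  have hF : flatZeta Λ h = fun z => ∫ u in S, (Λ u : ℂ) ^ (z - 1) * h u := by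
    funext z
    rw [flatZeta, setIntegral_halfSpace_eq_integral hD.subset fun u hu => by simp [hh.2 u hu]]
    exact (setIntegral_eq_integral_of_forall_compl_eq_zero fun u hu => by simp [hh.2 u hu]).symm
  rw [hF]
  have hint : ∀ z : ℂ, 1 < z.re → IntegrableOn (fun u => (Λ u : ℂ) ^ (z - 1) * h u) S :=
    fun z hz => (hD.integrable_cpow_mul hh (Or.inl (by simpa using hz))).integrableOn
  refine (hasDerivAt_integral_of_dominated_loc_of_deriv_le
    (F := fun z u => (Λ u : ℂ) ^ (z - 1) * h u)
    (F' := fun z u => (Λ u : ℂ) ^ (z - 1) * Complex.log (Λ u) * h u)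
    (bound := fun _ => B / (ε / 2)) (s := Metric.ball s (ε / 2))
    (Metric.ball_mem_nhds s (by positivity)) ?_ (hint s hs) ?_ ?_ ?_ ?_).2.differentiableAt
  · filter_upwards [Metric.ball_mem_nhds s hεp] with z hz
    exact (hint z (hre z (Metric.ball_subset_closedBall hz)).1).aestronglyMeasurable
  · have hm : AEMeasurable Λ (volume.restrict S) := hΛc.aemeasurable hSm
    have hm' : AEMeasurable (fun u => Complex.log (Λ u)) (volume.restrict S) :=
      Complex.measurable_log.comp_aemeasurable (Complex.measurable_ofReal.comp_aemeasurable hm)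
    have := (hint s hs).aestronglyMeasurable.mul hm'.aestronglyMeasurable
    refine this.congr (Eventually.of_forall fun u => ?_)
    simp only [Pi.mul_apply]
    ring
  · refine (ae_restrict_iff' hSm).2 (Eventually.of_forall fun u hu z hz => ?_)
    have hsub : Metric.closedBall z (ε / 2) ⊆ Metric.closedBall s ε := by
      refine Metric.closedBall_subset_closedBall' ?_
      have := Metric.mem_ball.1 hz
      linarith
    have hz1 := (hre z (hsub (Metric.mem_closedBall_self (by positivity)))).1
    -- Where `Λ` is small the logarithm is unbounded; the derivative in `s` is therefore bounded by
    -- Cauchy estimates on circles of radius `ε / 2`.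
    rw [← (hderiv u z hz1).deriv]
    refine Complex.norm_deriv_le_of_forall_mem_sphere_norm_le (by positivity) ?_ ?_
    · refine DifferentiableOn.diffContOnCl_ball (U := Metric.closedBall s ε) ?_ hsub
      exact fun t ht => (hderiv u t (hre t ht).1).differentiableAt.differentiableWithinAt
    · exact fun t ht => hbound u hu t (hsub (Metric.sphere_subset_closedBall ht))
  · have : IsFiniteMeasure (volume.restrict S) := ⟨by
      simpa using hD.isCompact.measure_lt_top⟩
    exact integrable_const _
  · refine Eventually.of_forall fun u z hz => hderiv u z ?_
    exact (hre z (Metric.ball_subset_closedBall (Metric.ball_subset_ball (by linarith) hz))).1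

end IsFlatData

end FlatZeta

/-! ### Meromorphic continuation of zeta integrals -/

section FlatContinuation

variable {d : ℕ} {S : Set (EuclideanSpace ℝ (Fin (d + 1)))}
  {Λ β γ : EuclideanSpace ℝ (Fin (d + 1)) → ℝ}

/-- The `N`-th extension of `flatZeta Λ h` to the left, by iterated integration by parts: it is
meromorphic for `1 - N < Re s`. -/
def zetaStep (Λ β γ : EuclideanSpace ℝ (Fin (d + 1)) → ℝ) :
    ℕ → (EuclideanSpace ℝ (Fin (d + 1)) → ℂ) → ℂ → ℂ
  | 0, h, s => flatZeta Λ h s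
  | N + 1, h, s => zetaStep Λ β γ N (fun u => γ u • h u) (s + 1) -
      s⁻¹ * zetaStep Λ β γ N (partial₀ fun u => β u • h u) (s + 1)

/-- The meromorphic continuation of `flatZeta Λ h`. The number `N` of integrations by parts is taken
large enough for `1 - N < Re s`, and the value does not depend on it by `zetaCont_eq`. -/
def zetaCont (Λ β γ : EuclideanSpace ℝ (Fin (d + 1)) → ℝ)
    (h : EuclideanSpace ℝ (Fin (d + 1)) → ℂ) (s : ℂ) : ℂ :=
  zetaStep Λ β γ ⌈2 - s.re⌉₊ h s

namespace IsFlatData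

variable {h : EuclideanSpace ℝ (Fin (d + 1)) → ℂ}

theorem zetaStep_eq_flatZeta (hD : IsFlatData S Λ β γ) (N : ℕ) : ∀ {h}, IsTest S h →
    ∀ {s : ℂ}, 1 < s.re → zetaStep Λ β γ N h s = flatZeta Λ h s := by
  induction N with
  | zero => exact fun _ _ _ => rfl
  | succ N ih =>
    intro h hh s hs
    have hs' : 1 < (s + 1).re := by simp; linarith
    rw [zetaStep, ih (hD.isTest_mul hh) hs', ih (hD.isTest_deriv hh) hs',
      ← hD.flatZeta_eq hh (Or.inl hs)]

theorem meromorphicAt_zetaStep (hD : IsFlatData S Λ β γ) (N : ℕ) : ∀ {h}, IsTest S h →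
    ∀ {s : ℂ}, 1 - N < s.re → MeromorphicAt (zetaStep Λ β γ N h) s := by
  induction N with
  | zero =>
    intro h hh s hs
    have ho : IsOpen {s : ℂ | 1 < s.re} := isOpen_lt continuous_const Complex.continuous_re
    have hd : DifferentiableOn ℂ (flatZeta Λ h) {s : ℂ | 1 < s.re} := fun z hz =>
      (hD.differentiableAt_flatZeta hh hz).differentiableWithinAt
    exact (hd.analyticAt (ho.mem_nhds (show 1 < s.re by simpa using hs))).meromorphicAt
  | succ N ih =>
    intro h hh s hs
    have hs' : 1 - N < (s + 1).re := by push_cast at hs; simp; linarith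
    have ha : AnalyticAt ℂ (fun s : ℂ => s + 1) s := by fun_prop
    have h1 : ∀ {g}, IsTest S g → MeromorphicAt (fun s => zetaStep Λ β γ N g (s + 1)) s := by
      intro g hg
      exact MeromorphicAt.comp_analyticAt (f := zetaStep Λ β γ N g) (ih hg hs') ha
    exact (h1 (hD.isTest_mul hh)).sub
      (analyticAt_id.meromorphicAt.inv.mul (h1 (hD.isTest_deriv hh)))

theorem zetaStep_succ (hD : IsFlatData S Λ β γ) (N : ℕ) : ∀ {h}, IsTest S h →
    ∀ {s : ℂ}, 1 - N < s.re → zetaStep Λ β γ (N + 1) h s = zetaStep Λ β γ N h s := by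
  induction N with
  | zero =>
    intro h hh s hs
    exact hD.zetaStep_eq_flatZeta 1 hh (by simpa using hs)
  | succ N ih =>
    intro h hh s hs
    have hs' : 1 - N < (s + 1).re := by push_cast at hs; simp; linarith
    rw [zetaStep, ih (hD.isTest_mul hh) hs', ih (hD.isTest_deriv hh) hs']
    rfl

theorem zetaStep_of_le (hD : IsFlatData S Λ β γ) (hh : IsTest S h) {N M : ℕ} (hNM : N ≤ M)
    {s : ℂ} (hs : 1 - N < s.re) : zetaStep Λ β γ M h s = zetaStep Λ β γ N h s := by
  induction M, hNM using Nat.le_induction with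
  | base => rfl
  | succ M hM ih =>
    rw [← ih, hD.zetaStep_succ M hh]
    have : (N : ℝ) ≤ M := by exact_mod_cast hM
    linarith

theorem zetaCont_eq (hD : IsFlatData S Λ β γ) (hh : IsTest S h) {N : ℕ}
    {s : ℂ} (hs : 1 - N < s.re) : zetaCont Λ β γ h s = zetaStep Λ β γ N h s := by
  have h1 : (1 : ℝ) - ⌈2 - s.re⌉₊ < s.re := by
    have := Nat.le_ceil (2 - s.re)
    linarith
  rcases le_total N ⌈2 - s.re⌉₊ with h2 | h2
  · exact hD.zetaStep_of_le hh h2 hs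
  · exact (hD.zetaStep_of_le hh h2 h1).symm

theorem zetaCont_eq_flatZeta (hD : IsFlatData S Λ β γ) (hh : IsTest S h) {s : ℂ}
    (hs : 1 < s.re) : zetaCont Λ β γ h s = flatZeta Λ h s :=
  hD.zetaCont_eq hh (N := 0) (by simpa using hs)

theorem eventually_zetaCont_eq (hD : IsFlatData S Λ β γ) (hh : IsTest S h) {N : ℕ}
    {s : ℂ} (hs : 1 - N < s.re) : zetaCont Λ β γ h =ᶠ[𝓝 s] zetaStep Λ β γ N h := by
  have ho : IsOpen {s : ℂ | 1 - (N : ℝ) < s.re} := isOpen_lt continuous_const Complex.continuous_re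
  filter_upwards [ho.mem_nhds hs] with z hz using hD.zetaCont_eq hh hz

theorem meromorphic_zetaCont (hD : IsFlatData S Λ β γ) (hh : IsTest S h) :
    Meromorphic (zetaCont Λ β γ h) := by
  intro s
  have h1 : (1 : ℝ) - ⌈2 - s.re⌉₊ < s.re := by
    have := Nat.le_ceil (2 - s.re)
    linarith
  exact (hD.meromorphicAt_zetaStep _ hh h1).congr
    ((hD.eventually_zetaCont_eq hh h1).filter_mono nhdsWithin_le_nhds).symm

/-- The residue at `0` of the continuation: after an integration by parts it is `-∫ ∂₀(β h)` over
the half-space, that is, the integral of `β h` over the boundary. -/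
theorem tendsto_mul_zetaCont (hD : IsFlatData S Λ β γ) (hh : IsTest S h) :
    Tendsto (fun s => s * zetaCont Λ β γ h s) (𝓝[≠] 0)
      (𝓝 (∫ v : EuclideanSpace ℝ (Fin d), β (consE (0, v)) • h (consE (0, v)))) := by
  have hγh := hD.isTest_mul hh
  have hBh := hD.isTest_deriv hh
  have hβh := hh.smul hD.isCompact hD.smooth_vector
  have hc : ∀ {g}, IsTest S g → ContinuousAt (zetaStep Λ β γ 1 g) 1 := by
    intro g hg
    have h2 : ∀ {k}, IsTest S k → ContinuousAt (fun s : ℂ => flatZeta Λ k (s + 1)) 1 := by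
      intro k hk
      have : ContinuousAt (flatZeta Λ k) ((1 : ℂ) + 1) :=
        (hD.differentiableAt_flatZeta hk (by simp)).continuousAt
      exact this.comp (f := fun s : ℂ => s + 1) (by fun_prop)
    exact (h2 (hD.isTest_mul hg)).sub
      ((continuousAt_inv₀ one_ne_zero).mul (h2 (hD.isTest_deriv hg)))
  have hval : zetaStep Λ β γ 1 (partial₀ fun u => β u • h u) 1 =
      -∫ v : EuclideanSpace ℝ (Fin d), β (consE (0, v)) • h (consE (0, v)) := by
    -- At `s = 1` the integral still converges, and integration by parts is valid there.
    have e1 : zetaStep Λ β γ 1 (partial₀ fun u => β u • h u) 1 =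
        flatZeta Λ (partial₀ fun u => β u • h u) 1 :=
      (hD.flatZeta_eq hBh (Or.inr rfl)).symm
    rw [e1, flatZeta]
    simp only [sub_self, Complex.cpow_zero, one_mul]
    exact integral_halfSpace_deriv hD.isCompact hD.subset (k := fun u => β u • h u)
      hβh.1.continuousOn hBh.1.continuousOn hβh.2 hBh.2 fun t v ht =>
        hasDerivAt_consE_of_pos ht (hβh.1 _ (mem_halfSpace.2 ht.le))
  have hshift : Tendsto (fun s : ℂ => s + 1) (𝓝[≠] 0) (𝓝 1) := by
    have : Continuous fun s : ℂ => s + 1 := by fun_prop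
    simpa using (this.tendsto 0).mono_left nhdsWithin_le_nhds
  have hid : Tendsto (fun s : ℂ => s) (𝓝[≠] 0) (𝓝 0) := tendsto_id.mono_left nhdsWithin_le_nhds
  have hlim : Tendsto (fun s : ℂ => s * zetaStep Λ β γ 1 (fun u => γ u • h u) (s + 1) -
      zetaStep Λ β γ 1 (partial₀ fun u => β u • h u) (s + 1)) (𝓝[≠] 0)
      (𝓝 (0 * zetaStep Λ β γ 1 (fun u => γ u • h u) 1 -
        zetaStep Λ β γ 1 (partial₀ fun u => β u • h u) 1)) :=
    (hid.mul ((hc hγh).tendsto.comp hshift)).sub ((hc hBh).tendsto.comp hshift)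
  rw [zero_mul, zero_sub, hval, neg_neg] at hlim
  refine hlim.congr' ?_
  have h2 : (1 : ℝ) - (2 : ℕ) < (0 : ℂ).re := by norm_num
  filter_upwards [(hD.eventually_zetaCont_eq hh h2).filter_mono nhdsWithin_le_nhds,
    self_mem_nhdsWithin] with s hs hs0
  have h0 : s ≠ 0 := hs0
  have h3 : zetaStep Λ β γ 2 h s = zetaStep Λ β γ 1 (fun u => γ u • h u) (s + 1) -
      s⁻¹ * zetaStep Λ β γ 1 (partial₀ fun u => β u • h u) (s + 1) := rfl
  rw [hs, h3, mul_sub, mul_inv_cancel_left₀ h0]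

end IsFlatData

/-- Existence of `β` and `γ`: take `β = χ / ∂₀Λ` and `γ = (1 - χ) / Λ`, for a cut-off function `χ`
concentrated near the zeros of `Λ`. -/
theorem exists_isFlatData (hS : IsCompact S) (hSH : S ⊆ range (𝓡∂ (d + 1)))
    (hΛ : ∀ u ∈ S, ContDiffWithinAt ℝ ∞ Λ (range (𝓡∂ (d + 1))) u)
    (hnonneg : ∀ u ∈ S, 0 ≤ Λ u) (hpos : ∀ u ∈ S, 0 < u 0 → 0 < Λ u)
    (hzero : ∀ u ∈ S, Λ u = 0 → 0 < partial₀ Λ u ∧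
      ∀ᶠ z in 𝓝[range (𝓡∂ (d + 1))] u, z 0 = 0 → Λ z = 0) :
    ∃ β γ, IsFlatData S Λ β γ ∧ ∀ u ∈ S, Λ u = 0 → β u = (partial₀ Λ u)⁻¹ := by
  -- The cut-off function is supported where `P` holds: there `∂₀Λ` is positive, and `Λ` vanishes on
  -- the boundary hyperplane.
  set P : EuclideanSpace ℝ (Fin (d + 1)) → Prop := fun z =>
    z ∈ S → 0 < partial₀ Λ z ∧ (z 0 = 0 → Λ z = 0) with hP
  have hev : ∀ u ∈ S, Λ u = 0 → ∀ᶠ z in 𝓝 u, P z := by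
    intro u hu h0
    obtain ⟨h1, h2⟩ := hzero u hu h0
    have h3 := (contDiffWithinAt_partial₀ (hSH hu) (hΛ u hu)).continuousWithinAt.eventually
      (lt_mem_nhds h1)
    filter_upwards [eventually_nhdsWithin_iff.1 (h3.and h2)] with z hz hzS
    exact hz (hSH hzS)
  have hΛc : ContinuousOn Λ S := fun u hu => (hΛ u hu).continuousWithinAt.mono hSH
  have hZ : IsCompact (S ∩ Λ ⁻¹' {0}) :=
    hS.of_isClosed_subset (hΛc.preimage_isClosed_of_isClosed hS.isClosed isClosed_singleton)
      inter_subset_left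
  have hO : S ∩ Λ ⁻¹' {0} ⊆ interior {z | P z} := by
    intro u hu
    exact mem_interior_iff_mem_nhds.2 (hev u hu.1 hu.2)
  obtain ⟨K, hK, hZK, hKO⟩ := exists_compact_between hZ isOpen_interior hO
  obtain ⟨χ, hχ1, hχ0, -⟩ := exists_contMDiffMap_one_nhds_of_subset_interior (n := (⊤ : ℕ∞))
    (𝓘(ℝ, EuclideanSpace ℝ (Fin (d + 1)))) hZ.isClosed hZK
  have hχs : ContDiff ℝ ∞ χ := χ.contMDiff.contDiff
  have hχ0' : ∀ u ∉ K, (χ : EuclideanSpace ℝ (Fin (d + 1)) → ℝ) =ᶠ[𝓝 u] fun _ => 0 := by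
    intro u hu
    filter_upwards [hK.isClosed.isOpen_compl.mem_nhds hu] with z hz using hχ0 z hz
  have hPK : ∀ u ∈ K, P u := fun u hu => (interior_subset (hKO hu) :)
  have hχ1' : ∀ u ∈ S, Λ u = 0 → (χ : EuclideanSpace ℝ (Fin (d + 1)) → ℝ) =ᶠ[𝓝 u] fun _ => 1 :=
    fun u hu h0 => Filter.Eventually.filter_mono
      (nhds_le_nhdsSet (show u ∈ S ∩ Λ ⁻¹' {0} from ⟨hu, h0⟩)) hχ1
  refine ⟨fun u => χ u / partial₀ Λ u, fun u => (1 - χ u) / Λ u,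
    ⟨hS, hSH, hΛ, fun u hu => ?_, fun u hu => ?_, hnonneg, hpos, fun u hu => ?_,
      fun u hu h0 => ?_⟩, fun u hu h0 => ?_⟩
  · by_cases huK : u ∈ K
    · exact hχs.contDiffAt.contDiffWithinAt.div (contDiffWithinAt_partial₀ (hSH hu) (hΛ u hu))
        (hPK u huK hu).1.ne'
    · refine (contDiffWithinAt_const (c := (0 : ℝ))).congr_of_eventuallyEq
        (nhdsWithin_le_nhds ?_) (by simp [hχ0 u huK])
      filter_upwards [hχ0' u huK] with z hz
      simp [hz]
  · by_cases h0 : Λ u = 0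
    · refine (contDiffWithinAt_const (c := (0 : ℝ))).congr_of_eventuallyEq
        (nhdsWithin_le_nhds ?_) (by simp [h0])
      filter_upwards [hχ1' u hu h0] with z hz
      simp [hz]
    · exact (contDiffWithinAt_const.sub hχs.contDiffAt.contDiffWithinAt).div (hΛ u hu) h0
  · have e1 : χ u / partial₀ Λ u * partial₀ Λ u = χ u := by
      by_cases huK : u ∈ K
      · exact div_mul_cancel₀ _ (hPK u huK hu).1.ne'
      · simp [hχ0 u huK]
    have e2 : (1 - χ u) / Λ u * Λ u = 1 - χ u := by
      by_cases h0 : Λ u = 0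
      · have h1 : χ u = 1 := (hχ1' u hu h0).self_of_nhds
        simp [h1]
      · exact div_mul_cancel₀ _ h0
    rw [e1, e2]
    ring
  · by_cases huK : u ∈ K
    · rw [(hPK u huK hu).2 h0, zero_mul]
    · simp [hχ0 u huK]
  · have h1 : χ u = 1 := (hχ1' u hu h0).self_of_nhds
    simp [h1]

/-- The zeta integral `∫ Λ^(s-1) h` over the half-space has a meromorphic continuation, with at
most a simple pole at `0`, whose residue is the integral of `h / ∂₀Λ` over the zeros of `Λ` on the
boundary hyperplane. -/
theorem exists_continuation_flatZeta (hS : IsCompact S) (hSH : S ⊆ range (𝓡∂ (d + 1)))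
    (hΛ : ∀ u ∈ S, ContDiffWithinAt ℝ ∞ Λ (range (𝓡∂ (d + 1))) u)
    (hnonneg : ∀ u ∈ S, 0 ≤ Λ u) (hpos : ∀ u ∈ S, 0 < u 0 → 0 < Λ u)
    (hzero : ∀ u ∈ S, Λ u = 0 → 0 < partial₀ Λ u ∧
      ∀ᶠ z in 𝓝[range (𝓡∂ (d + 1))] u, z 0 = 0 → Λ z = 0)
    {h : EuclideanSpace ℝ (Fin (d + 1)) → ℂ} (hh : IsTest S h)
    {m : EuclideanSpace ℝ (Fin d) → ℂ}
    (hm : ∀ v, consE (0, v) ∈ S → Λ (consE (0, v)) = 0 →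
      m v = (partial₀ Λ (consE (0, v)))⁻¹ • h (consE (0, v)))
    (hm0 : ∀ v, (consE (0, v) ∈ S → Λ (consE (0, v)) ≠ 0) → m v = 0) :
    (∃ Z : ℂ → ℂ, Meromorphic Z ∧ (∀ s : ℂ, 1 < s.re →
      Integrable (fun u => (Λ u : ℂ) ^ (s - 1) * h u) ∧ Z s = flatZeta Λ h s) ∧
      Tendsto (fun s => s * Z s) (𝓝[≠] 0) (𝓝 (∫ v, m v))) ∧ Continuous m := by
  obtain ⟨β, γ, hD, hβ⟩ := exists_isFlatData hS hSH hΛ hnonneg hpos hzero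
  have hmβ : m = fun v => β (consE (0, v)) • h (consE (0, v)) := by
    funext v
    by_cases hu : consE (0, v) ∈ S
    · by_cases h0 : Λ (consE (0, v)) = 0
      · rw [hm v hu h0, hβ _ hu h0]
      · rw [hm0 v fun _ => h0]
        have := (mul_eq_zero.1 (hD.boundary _ hu rfl)).resolve_left h0
        simp [this]
    · rw [hm0 v fun hc => absurd hc hu, hh.2 _ hu, smul_zero]
  refine ⟨⟨zetaCont Λ β γ h, hD.meromorphic_zetaCont hh, fun s hs => ⟨?_, ?_⟩, ?_⟩, ?_⟩
  · exact hD.integrable_cpow_mul hh (Or.inl (by simpa using hs))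
  · exact hD.zetaCont_eq_flatZeta hh hs
  · rw [hmβ]
    exact hD.tendsto_mul_zetaCont hh
  · rw [hmβ]
    have hc := (hh.smul hS hD.smooth_vector).1.continuousOn
    refine hc.comp_continuous (f := fun v => consE (0, v))
      ((contDiff_consE (n := 0)).continuous.comp (by fun_prop)) fun v => ?_
    exact mem_halfSpace.2 (le_of_eq rfl)

end FlatContinuation

/-! ### Frames and determinants -/

section Determinants

variable {n : ℕ}

/-- An alternating map of top degree transforms by the determinant. -/
theorem alternatingMap_map_single (f : EuclideanSpace ℝ (Fin n) [⋀^Fin n]→ₗ[ℝ] ℝ)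
    (L : EuclideanSpace ℝ (Fin n) →L[ℝ] EuclideanSpace ℝ (Fin n)) :
    f (fun j => L (EuclideanSpace.single j 1)) =
      L.det * f (fun j => EuclideanSpace.single j 1) := by
  set b := (EuclideanSpace.basisFun (Fin n) ℝ).toBasis with hb
  have hbe : ⇑b = fun j => EuclideanSpace.single j (1 : ℝ) := by
    funext j
    simp [hb]
  have h1 := f.eq_smul_basis_det b
  have h2 : ∀ v, f v = f b * b.det v := fun v => by
    conv_lhs => rw [h1]
    rfl
  have h3 : (fun j => L (EuclideanSpace.single j (1 : ℝ))) = ⇑(L : EuclideanSpace ℝ (Fin n) →ₗ[ℝ]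
      EuclideanSpace ℝ (Fin n)) ∘ ⇑b := by
    rw [hbe]
    rfl
  rw [h3, ← hbe, h2, Module.Basis.det_comp, Module.Basis.det_self, ContinuousLinearMap.det]
  ring

theorem continuous_alternatingMap (f : EuclideanSpace ℝ (Fin n) [⋀^Fin n]→ₗ[ℝ] ℝ) :
    Continuous f := by
  set b := (EuclideanSpace.basisFun (Fin n) ℝ).toBasis with hb
  have h2 : ∀ v, f v = f b * (Matrix.of fun i j => v j i).det := fun v => by
    conv_lhs => rw [f.eq_smul_basis_det b]
    rfl
  have h3 : (f : (Fin n → EuclideanSpace ℝ (Fin n)) → ℝ) = _ := funext h2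
  rw [h3]
  refine continuous_const.mul (Continuous.matrix_det ?_)
  refine continuous_matrix fun i j => ?_
  exact (EuclideanSpace.proj (𝕜 := ℝ) i).continuous.comp (continuous_apply j)

/-- The analogue of `alternatingMap_map_single` for complex-valued forms. -/
theorem form_map_single (f : EuclideanSpace ℝ (Fin n) [⋀^Fin n]→L[ℝ] ℂ)
    (L : EuclideanSpace ℝ (Fin n) →L[ℝ] EuclideanSpace ℝ (Fin n)) :
    f (fun j => L (EuclideanSpace.single j 1)) =
      L.det • f (fun j => EuclideanSpace.single j 1) := by
  have hr := alternatingMap_map_single (Complex.reLm.compAlternatingMap f.toAlternatingMap) L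
  have hi := alternatingMap_map_single (Complex.imLm.compAlternatingMap f.toAlternatingMap) L
  refine Complex.ext ?_ ?_
  · rw [Complex.smul_re]
    exact hr
  · rw [Complex.smul_im]
    exact hi

theorem frameSign_cons_map {V : Type*} [AddCommGroup V] [Module ℝ V]
    (o : Orientation ℝ V (Fin (n + 1))) (ν : V) (Φ : EuclideanSpace ℝ (Fin n) →ₗ[ℝ] V)
    (L : EuclideanSpace ℝ (Fin n) →L[ℝ] EuclideanSpace ℝ (Fin n)) :
    frameSign o (Fin.cons ν fun j => Φ (L (EuclideanSpace.single j 1)) : Fin (n + 1) → V) =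
      (SignType.sign L.det : SignType) *
        frameSign o (Fin.cons ν fun j => Φ (EuclideanSpace.single j 1) : Fin (n + 1) → V) := by
  have h := alternatingMap_map_single
    (((Module.Ray.someVector o : V [⋀^Fin (n + 1)]→ₗ[ℝ] ℝ).curryLeft ν).compLinearMap Φ) L
  have h' : Module.Ray.someVector o
      (Fin.cons ν fun j => Φ (L (EuclideanSpace.single j 1)) : Fin (n + 1) → V) =
      L.det * Module.Ray.someVector o
        (Fin.cons ν fun j => Φ (EuclideanSpace.single j 1) : Fin (n + 1) → V) := h
  rw [frameSign, h', sign_mul, SignType.coe_mul]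
  rfl

end Determinants

/-! ### Integrands in charts -/

section ChartIntegrand

variable {n : ℕ} {H : Type*} [TopologicalSpace H]
  {I : ModelWithCorners ℝ (EuclideanSpace ℝ (Fin n)) H}
  {M : Type*} [TopologicalSpace M] [ChartedSpace H M] [IsManifold I ∞ M]

/-- An alternating map representing the orientation of a tangent space. -/
def ManifoldOrientation.alternating (o : ManifoldOrientation I M) (x : M) :
    EuclideanSpace ℝ (Fin n) [⋀^Fin n]→ₗ[ℝ] ℝ :=
  Module.Ray.someVector (M := TangentSpace I x [⋀^Fin n]→ₗ[ℝ] ℝ) (o.at' x)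

/-- A volume form representing an orientation; it need not be continuous. Through it, the rules for
the change of charts for forms apply to signs of frames. -/
def ManifoldOrientation.form (o : ManifoldOrientation I M) : DiffForm I M n := fun x =>
  { toMultilinearMap :=
      (Complex.ofRealCLM.toLinearMap.compAlternatingMap (o.alternating x)).toMultilinearMap
    cont := Complex.continuous_ofReal.comp (continuous_alternatingMap (o.alternating x))
    map_eq_zero_of_eq' :=
      (Complex.ofRealCLM.toLinearMap.compAlternatingMap (o.alternating x)).map_eq_zero_of_eq' }

/-- The sign of the coordinate frame of a chart. -/
def chartSign (o : ManifoldOrientation I M) (x₀ : M) (u : EuclideanSpace ℝ (Fin n)) : ℝ :=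
  frameSign (o.at' ((extChartAt I x₀).symm u)) (coordFrame I x₀ u)

theorem chartSign_eq (o : ManifoldOrientation I M) (x₀ : M) (u : EuclideanSpace ℝ (Fin n)) :
    chartSign o x₀ u = (SignType.sign
      (o.form.inChart x₀ u fun j => EuclideanSpace.single j 1).re : SignType) := rfl

theorem det_coordChange_ne_zero {x₀ x₁ x : M} (h₀ : x ∈ (extChartAt I x₀).source)
    (h₁ : x ∈ (extChartAt I x₁).source) :
    (fderivWithin ℝ (extChartAt I x₁ ∘ (extChartAt I x₀).symm) (range I)
      (extChartAt I x₀ x)).det ≠ 0 := by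
  have : IsManifold I 1 M := DiffForm.isManifold_one
  have h : (tangentCoordChange I x₁ x₀ x).comp (tangentCoordChange I x₀ x₁ x) =
      ContinuousLinearMap.id ℝ (EuclideanSpace ℝ (Fin n)) := by
    ext1 v
    rw [ContinuousLinearMap.comp_apply, tangentCoordChange_comp ⟨⟨h₀, h₁⟩, h₀⟩,
      tangentCoordChange_self h₀]
    rfl
  have h2 := congrArg (fun L : EuclideanSpace ℝ (Fin n) →L[ℝ] EuclideanSpace ℝ (Fin n) =>
    LinearMap.det (L : EuclideanSpace ℝ (Fin n) →ₗ[ℝ] EuclideanSpace ℝ (Fin n))) h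
  simp only [ContinuousLinearMap.toLinearMap_comp, LinearMap.det_comp,
    ContinuousLinearMap.coe_id, LinearMap.det_id] at h2
  exact right_ne_zero_of_mul_eq_one h2

/-- The sign of the coordinate frame of a chart is locally constant on the whole chart, and not only
at its centre: change to the chart centred at the given point. -/
theorem eventually_chartSign_eq (o : ManifoldOrientation I M) {x₀ x₁ : M}
    (h₀ : x₁ ∈ (extChartAt I x₀).source) :
    ∀ᶠ u in 𝓝[range I] (extChartAt I x₀ x₁),
      chartSign o x₀ u = chartSign o x₀ (extChartAt I x₀ x₁) := by
  have h₁ : x₁ ∈ (extChartAt I x₁).source := mem_extChartAt_source x₁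
  set τ := extChartAt I x₁ ∘ (extChartAt I x₀).symm with hτ
  have hchange : ∀ u ∈ (extChartAt I x₀).target,
      (extChartAt I x₀).symm u ∈ (extChartAt I x₁).source →
      chartSign o x₀ u = (SignType.sign (fderivWithin ℝ τ (range I) u).det : SignType) *
        chartSign o x₁ (τ u) := by
    intro u hu hu'
    rw [chartSign_eq, chartSign_eq, DiffForm.inChart_coordChange o.form hu hu', ← SignType.coe_mul,
      ← sign_mul]
    have h2 := form_map_single (o.form.inChart x₁ (τ u)) (fderivWithin ℝ τ (range I) u)
    have h3 : ((o.form.inChart x₁ (τ u)).compContinuousLinearMap (fderivWithin ℝ τ (range I) u))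
        (fun j => EuclideanSpace.single j 1) = o.form.inChart x₁ (τ u)
          (fun j => fderivWithin ℝ τ (range I) u (EuclideanSpace.single j 1)) := rfl
    rw [h3, h2, Complex.smul_re, smul_eq_mul]
  have hτ1 : τ (extChartAt I x₀ x₁) = extChartAt I x₁ x₁ := by
    simp only [hτ, Function.comp, (extChartAt I x₀).left_inv h₀]
  have hτs := DiffForm.contDiffWithinAt_coordChange h₁ h₀
  have hdet : ContinuousWithinAt (fun u => (fderivWithin ℝ τ (range I) u).det) (range I)
      (extChartAt I x₀ x₁) :=
    ContinuousLinearMap.continuous_det.continuousAt.comp_continuousWithinAt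
      (hτs.fderivWithin_right (m := 0) I.uniqueDiffOn (by simp)
        (DiffForm.extChartAt_mem_range _ _)).continuousWithinAt
  have hne := det_coordChange_ne_zero h₀ h₁
  have hsgn : ∀ᶠ u in 𝓝[range I] (extChartAt I x₀ x₁),
      SignType.sign (fderivWithin ℝ τ (range I) u).det =
        SignType.sign (fderivWithin ℝ τ (range I) (extChartAt I x₀ x₁)).det := by
    rcases lt_or_gt_of_ne hne with h | h
    · filter_upwards [hdet.eventually (gt_mem_nhds h)] with u hu
      rw [sign_neg hu, sign_neg h]
    · filter_upwards [hdet.eventually (lt_mem_nhds h)] with u hu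
      rw [sign_pos hu, sign_pos h]
  have hev := DiffForm.eventually_mem_target h₀ (extChartAt_source_mem_nhds (I := I) x₁)
  have hloc : ∀ᶠ u in 𝓝[range I] (extChartAt I x₀ x₁),
      chartSign o x₁ (τ u) = chartSign o x₁ (extChartAt I x₁ x₁) := by
    have ht : Tendsto τ (𝓝[range I] (extChartAt I x₀ x₁)) (𝓝[range I] (extChartAt I x₁ x₁)) := by
      refine tendsto_nhdsWithin_iff.2 ⟨hτ1 ▸ hτs.continuousWithinAt,
        Eventually.of_forall fun u => ?_⟩
      exact DiffForm.extChartAt_mem_range _ _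
    exact ht.eventually (o.locally_constant x₁)
  filter_upwards [hsgn, hev, hloc] with u hu1 hu2 hu3
  rw [hchange u hu2.1 hu2.2, hchange _ ((extChartAt I x₀).map_source h₀)
    (by rw [(extChartAt I x₀).left_inv h₀]; exact h₁), hu1, hu3, hτ1]

variable [T2Space M] [SigmaCompactSpace M]

theorem tsupport_chartPartition_subset (x₀ : M) :
    tsupport (chartPartition I M x₀) ⊆ (extChartAt I x₀).source := by
  rw [extChartAt_source]
  exact (SmoothPartitionOfUnity.exists_isSubordinate_chartAt_source I M).choose_spec x₀

theorem chartIntegrand_eq (o : ManifoldOrientation I M) (w : DiffForm I M n) (x₀ : M)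
    (u : EuclideanSpace ℝ (Fin n)) :
    chartIntegrand o w x₀ u = (chartPartition I M x₀ ((extChartAt I x₀).symm u) *
      chartSign o x₀ u) • w.inChart x₀ u (fun j => EuclideanSpace.single j 1) := rfl

/-- The support, in the chart at `x₀`, of the integrand of a form supported in `K`. -/
def chartSupport (I : ModelWithCorners ℝ (EuclideanSpace ℝ (Fin n)) H)
    [IsManifold I ∞ M] (K : Set M) (x₀ : M) : Set (EuclideanSpace ℝ (Fin n)) :=
  extChartAt I x₀ '' (tsupport (chartPartition I M x₀) ∩ K)

variable {K : Set M} {w : DiffForm I M n}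

theorem chartSupport_subset_target (x₀ : M) :
    chartSupport I K x₀ ⊆ (extChartAt I x₀).target := by
  rintro _ ⟨x, hx, rfl⟩
  exact (extChartAt I x₀).map_source (tsupport_chartPartition_subset x₀ hx.1)

theorem isCompact_chartSupport (hK : IsCompact K) (x₀ : M) : IsCompact (chartSupport I K x₀) := by
  refine (hK.inter_left (isClosed_tsupport _)).image_of_continuousOn ?_
  exact (continuousOn_extChartAt x₀).mono fun x hx => tsupport_chartPartition_subset x₀ hx.1

theorem target_subset_range (x₀ : M) : (extChartAt I x₀).target ⊆ range I := by
  rw [extChartAt_target]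
  exact inter_subset_right

theorem measurableSet_target (x₀ : M) : MeasurableSet (extChartAt I x₀).target := by
  rw [extChartAt_target]
  exact ((chartAt H x₀).open_target.preimage I.continuous_symm).measurableSet.inter
    I.isClosed_range.measurableSet

/-- The integrand in a chart, extended by zero. -/
def chartIntegrandExt (o : ManifoldOrientation I M) (w : DiffForm I M n) (x₀ : M) :
    EuclideanSpace ℝ (Fin n) → ℂ :=
  (extChartAt I x₀).target.indicator (chartIntegrand o w x₀)

theorem chartIntegrandExt_of_mem (o : ManifoldOrientation I M) {x₀ : M}
    {u : EuclideanSpace ℝ (Fin n)} (hu : u ∈ (extChartAt I x₀).target) :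
    chartIntegrandExt o w x₀ u = chartIntegrand o w x₀ u := indicator_of_mem hu _

theorem chartIntegrandExt_eq_zero (o : ManifoldOrientation I M) (hw : ∀ x ∉ K, w x = 0) (x₀ : M)
    {u : EuclideanSpace ℝ (Fin n)} (hu : u ∉ chartSupport I K x₀) :
    chartIntegrandExt o w x₀ u = 0 := by
  by_cases huT : u ∈ (extChartAt I x₀).target
  swap
  · exact indicator_of_notMem huT _
  rw [chartIntegrandExt_of_mem o huT, chartIntegrand_eq]
  by_cases h1 : (extChartAt I x₀).symm u ∈ tsupport (chartPartition I M x₀)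
  · have h2 : (extChartAt I x₀).symm u ∉ K := fun h2 =>
      hu ⟨_, ⟨h1, h2⟩, (extChartAt I x₀).right_inv huT⟩
    have h3 : w.inChart x₀ u = 0 := by
      rw [DiffForm.inChart, hw _ h2]
      rfl
    rw [h3]
    simp
  · rw [image_eq_zero_of_notMem_tsupport h1]
    simp

theorem contDiffWithinAt_chartIntegrand (o : ManifoldOrientation I M) {x₀ x : M}
    (hx : x ∈ (extChartAt I x₀).source) (hw : w.SmoothAt x) :
    ContDiffWithinAt ℝ ∞ (chartIntegrand o w x₀) (range I) (extChartAt I x₀ x) := by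
  have h1 : ContDiffWithinAt ℝ ∞ (chartPartition I M x₀ ∘ (extChartAt I x₀).symm) (range I)
      (extChartAt I x₀ x) :=
    DiffForm.contDiffWithinAt_comp_symm hx ((chartPartition I M x₀).contMDiff x)
  have h2 : ContDiffWithinAt ℝ ∞ (chartSign o x₀) (range I) (extChartAt I x₀ x) :=
    contDiffWithinAt_const.congr_of_eventuallyEq (eventually_chartSign_eq o hx) rfl
  exact (h1.mul h2).smul ((hw.contDiffWithinAt hx).form_apply _)

theorem contDiffOn_chartIntegrandExt (o : ManifoldOrientation I M) (hK : IsCompact K)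
    (hw0 : ∀ x ∉ K, w x = 0) (hw : ∀ x, w.SmoothAt x) (x₀ : M) :
    ContDiffOn ℝ ∞ (chartIntegrandExt o w x₀) (range I) := by
  intro u hu
  by_cases huS : u ∈ chartSupport I K x₀
  · have huT := chartSupport_subset_target x₀ huS
    have h1 := contDiffWithinAt_chartIntegrand o ((extChartAt I x₀).map_target huT)
      (hw ((extChartAt I x₀).symm u))
    rw [(extChartAt I x₀).right_inv huT] at h1
    refine h1.congr_of_eventuallyEq ?_ (chartIntegrandExt_of_mem o huT)
    filter_upwards [extChartAt_target_mem_nhdsWithin_of_mem huT] with z hz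
    exact chartIntegrandExt_of_mem o hz
  · refine (contDiffWithinAt_const (c := (0 : ℂ))).congr_of_eventuallyEq (nhdsWithin_le_nhds ?_)
      (chartIntegrandExt_eq_zero o hw0 x₀ huS)
    filter_upwards [(isCompact_chartSupport hK x₀).isClosed.isOpen_compl.mem_nhds huS] with z hz
    exact chartIntegrandExt_eq_zero o hw0 x₀ hz

theorem finite_chartPartition (hK : IsCompact K) :
    {x₀ : M | ∃ x ∈ K, chartPartition I M x₀ x ≠ 0}.Finite := by
  refine ((chartPartition I M).locallyFinite.finite_nonempty_inter_compact hK).subset ?_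
  rintro x₀ ⟨x, hx, h⟩
  exact ⟨x, h, hx⟩

/-- The integral of a form supported in `K` is a sum over any finite set of charts that contains
those whose partition function does not vanish on `K`. -/
theorem formIntegral_eq_sum (o : ManifoldOrientation I M) (hw : ∀ x ∉ K, w x = 0) {A : Finset M}
    (hA : ∀ x₀, ∀ x ∈ K, chartPartition I M x₀ x ≠ 0 → x₀ ∈ A) :
    formIntegral o w = ∑ x₀ ∈ A, ∫ u in (extChartAt I x₀).target, chartIntegrand o w x₀ u := by
  refine finsum_eq_sum_of_support_subset _ fun x₀ hx₀ => ?_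
  by_contra hA'
  refine hx₀ ?_
  have : ∀ u, chartIntegrand o w x₀ u = 0 := by
    intro u
    rw [chartIntegrand_eq]
    by_cases hu : (extChartAt I x₀).symm u ∈ K
    · have : chartPartition I M x₀ ((extChartAt I x₀).symm u) = 0 := by
        by_contra h
        exact hA' (hA x₀ _ hu h)
      rw [this]
      simp
    · have h3 : w.inChart x₀ u = 0 := by
        rw [DiffForm.inChart, hw _ hu]
        rfl
      rw [h3]
      simp
  simp [this]

theorem sum_chartPartition {A : Finset M} {x : M}
    (hA : ∀ x₀, chartPartition I M x₀ x ≠ 0 → x₀ ∈ A) :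
    ∑ x₀ ∈ A, chartPartition I M x₀ x = 1 := by
  rw [← (chartPartition I M).sum_eq_one (mem_univ x)]
  exact (finsum_eq_sum_of_support_subset _ fun x₀ hx₀ => hA x₀ hx₀).symm

end ChartIntegrand

/-! ### The residue of the zeta function in charts of `X` -/

section ZetaResidue

variable {d : ℕ} {X : Type*} [TopologicalSpace X] [ChartedSpace (EuclideanHalfSpace (d + 1)) X]
  [IsManifold (𝓡∂ (d + 1)) ∞ X] [T2Space X] [SigmaCompactSpace X]
  {Y : Type*} [TopologicalSpace Y] [ChartedSpace (EuclideanSpace ℝ (Fin d)) Y]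
  [IsManifold (𝓡 d) ∞ Y]
  {i : Y → X} {lam : X → ℝ}

open Classical in
/-- The contribution of the chart at `x₀` to the residue at `0` of the zeta function of a form `W`,
as a density on the boundary hyperplane; here `θ` is the smooth extension of `lam W`. It vanishes at
the points outside the chart or not on `Y`. -/
def boundaryDensity (i : Y → X) (lam : X → ℝ) (o : ManifoldOrientation (𝓡∂ (d + 1)) X)
    (θ : DiffForm (𝓡∂ (d + 1)) X (d + 1)) (x₀ : X) (v : EuclideanSpace ℝ (Fin d)) : ℂ :=
  if consE (0, v) ∈ (extChartAt (𝓡∂ (d + 1)) x₀).target ∧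
    (extChartAt (𝓡∂ (d + 1)) x₀).symm (consE (0, v)) ∈ range i then
    (partial₀ (lam ∘ (extChartAt (𝓡∂ (d + 1)) x₀).symm) (consE (0, v)))⁻¹ •
      chartIntegrandExt o θ x₀ (consE (0, v))
  else 0

namespace IsBoundaryDefining

variable {K : Set X} {W θ : DiffForm (𝓡∂ (d + 1)) X (d + 1)}

theorem symm_notMem_range (h : IsBoundaryDefining d i lam) {x₀ : X}
    {u : EuclideanSpace ℝ (Fin (d + 1))} (hu : u ∈ (extChartAt (𝓡∂ (d + 1)) x₀).target)
    (hu0 : u 0 ≠ 0) : (extChartAt (𝓡∂ (d + 1)) x₀).symm u ∉ range i := by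
  intro hi
  have := h.coord_zero_eq_zero ((extChartAt (𝓡∂ (d + 1)) x₀).map_target hu) hi
  rw [(extChartAt (𝓡∂ (d + 1)) x₀).right_inv hu] at this
  exact hu0 this

/-- The zeta integral in a chart of `X` is the zeta integral of the coordinate expression of `lam`
on the half-space, to which `exists_continuation_flatZeta` applies. -/
theorem exists_chart_zeta (h : IsBoundaryDefining d i lam) (hi : IsBoundaryPart d i)
    (o : ManifoldOrientation (𝓡∂ (d + 1)) X) (hK : IsCompact K) (hθs : ∀ x, θ.SmoothAt x)
    (hθ0 : ∀ x ∉ K, θ x = 0) (hθ : ∀ x ∉ range i, θ x = lam x • W x) (x₀ : X) :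
    (∃ Z : ℂ → ℂ, Meromorphic Z ∧ (∀ s : ℂ, 1 < s.re →
      IntegrableOn (chartIntegrand o (fun x => ((lam x : ℂ) ^ s) • W x) x₀)
        (extChartAt (𝓡∂ (d + 1)) x₀).target ∧
      Z s = ∫ u in (extChartAt (𝓡∂ (d + 1)) x₀).target,
        chartIntegrand o (fun x => ((lam x : ℂ) ^ s) • W x) x₀ u) ∧
      Tendsto (fun s => s * Z s) (𝓝[≠] 0) (𝓝 (∫ v, boundaryDensity i lam o θ x₀ v))) ∧
      Continuous (boundaryDensity i lam o θ x₀) := by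
  set S := chartSupport (𝓡∂ (d + 1)) K x₀ with hS
  set Λ := lam ∘ (extChartAt (𝓡∂ (d + 1)) x₀).symm with hΛ
  have hST : S ⊆ (extChartAt (𝓡∂ (d + 1)) x₀).target := chartSupport_subset_target x₀
  have hSc : IsCompact S := isCompact_chartSupport hK x₀
  have hSH : S ⊆ range (𝓡∂ (d + 1)) := hST.trans (target_subset_range x₀)
  have hr : ∀ {u}, u ∈ (extChartAt (𝓡∂ (d + 1)) x₀).target →
      extChartAt (𝓡∂ (d + 1)) x₀ ((extChartAt (𝓡∂ (d + 1)) x₀).symm u) = u := fun hu =>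
    (extChartAt (𝓡∂ (d + 1)) x₀).right_inv hu
  have hh : IsTest S (chartIntegrandExt o θ x₀) :=
    ⟨contDiffOn_chartIntegrandExt o hK hθ0 hθs x₀, fun u hu =>
        chartIntegrandExt_eq_zero o hθ0 x₀ hu⟩
  obtain ⟨⟨Z, hZm, hZ, hZ0⟩, hmc⟩ := exists_continuation_flatZeta (Λ := Λ) hSc hSH
    (fun u hu => by
      have := h.contDiffWithinAt ((extChartAt (𝓡∂ (d + 1)) x₀).map_target (hST hu))
      rwa [hr (hST hu)] at this)
    (fun u _ => h.nonneg _)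
    (fun u hu hu0 => h.pos _ (h.symm_notMem_range (hST hu) hu0.ne'))
    (fun u hu hu0 => by
      have hx := (extChartAt (𝓡∂ (d + 1)) x₀).map_target (hST hu)
      have hxi : (extChartAt (𝓡∂ (d + 1)) x₀).symm u ∈ range i := h.eq_zero_iff.1 hu0
      have h1 := h.fderivWithin_e₀_pos hi hx hxi
      have h2 := h.eventually_mem_range hi hx hxi
      rw [hr (hST hu)] at h1 h2
      refine ⟨h1, nhdsWithin_le_nhds ?_⟩
      filter_upwards [h2] with z hz hz0 using h.eq_zero_iff.2 (hz hz0))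
    hh (m := boundaryDensity i lam o θ x₀)
    (fun v hv hv0 => if_pos ⟨hST hv, h.eq_zero_iff.1 hv0⟩)
    (fun v hv => by
      by_cases hc : consE (0, v) ∈ (extChartAt (𝓡∂ (d + 1)) x₀).target ∧
        (extChartAt (𝓡∂ (d + 1)) x₀).symm (consE (0, v)) ∈ range i
      · have h1 : consE (0, v) ∉ S := fun hvS => hv hvS (h.eq_zero_iff.2 hc.2)
        rw [boundaryDensity, if_pos hc, hh.2 _ h1, smul_zero]
      · exact if_neg hc)
  refine ⟨⟨Z, hZm, fun s hs => ?_, hZ0⟩, hmc⟩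
  obtain ⟨hint, hZs⟩ := hZ s hs
  have hs0 : s ≠ 0 := fun h0 => by
    rw [h0] at hs
    simp at hs
    linarith
  -- The two integrands differ at most along `Y`, which is a null set in the chart.
  have hae : chartIntegrand o (fun x => ((lam x : ℂ) ^ s) • W x) x₀
      =ᵐ[volume.restrict (extChartAt (𝓡∂ (d + 1)) x₀).target]
      fun u => (Λ u : ℂ) ^ (s - 1) * chartIntegrandExt o θ x₀ u := by
    have hnull : ∀ᵐ u : EuclideanSpace ℝ (Fin (d + 1)), u 0 ≠ 0 := by
      rw [ae_iff]
      simpa using volume_coord_zero_eq_zero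
    refine (ae_restrict_iff' (measurableSet_target x₀)).2 ?_
    filter_upwards [hnull] with u hu0 hu
    have hxi := h.symm_notMem_range hu hu0
    have e1 : (θ ((extChartAt (𝓡∂ (d + 1)) x₀).symm u)) (coordFrame (𝓡∂ (d + 1)) x₀ u) =
        lam ((extChartAt (𝓡∂ (d + 1)) x₀).symm u) •
          (W ((extChartAt (𝓡∂ (d + 1)) x₀).symm u)) (coordFrame (𝓡∂ (d + 1)) x₀ u) := by
      rw [hθ _ hxi]
      rfl
    have e2 : Λ u = lam ((extChartAt (𝓡∂ (d + 1)) x₀).symm u) := rfl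
    rw [chartIntegrandExt_of_mem o hu, chartIntegrand, chartIntegrand, e1, e2,
      ← cpow_sub_one_mul_self hs0]
    simp only [Complex.real_smul, ContinuousAlternatingMap.smul_apply, smul_eq_mul]
    ring
  refine ⟨hint.integrableOn.congr_fun_ae hae.symm, ?_⟩
  rw [integral_congr_ae hae, hZs, flatZeta, setIntegral_halfSpace_eq_integral hSH
    fun u hu => by simp [hh.2 u hu]]
  exact (setIntegral_eq_integral_of_forall_compl_eq_zero fun u hu => by
    simp [hh.2 u fun hc => hu (hST hc)]).symm

/-- The residue of the zeta function of a top-degree form with a simple pole along `Y`, as a sum of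
boundary integrals in the charts of `X`. -/
theorem hasI₀_sum (h : IsBoundaryDefining d i lam) (hi : IsBoundaryPart d i)
    (o : ManifoldOrientation (𝓡∂ (d + 1)) X) (hK : IsCompact K) (hθs : ∀ x, θ.SmoothAt x)
    (hθ0 : ∀ x ∉ K, θ x = 0) (hθ : ∀ x ∉ range i, θ x = lam x • W x) {A : Finset X}
    (hA : ∀ x₀, ∀ x ∈ K, chartPartition (𝓡∂ (d + 1)) X x₀ x ≠ 0 → x₀ ∈ A) :
    HasI₀ o lam W (∑ x₀ ∈ A, ∫ v, boundaryDensity i lam o θ x₀ v) := by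
  choose hex _ using h.exists_chart_zeta hi o hK hθs hθ0 hθ
  choose Z hZm hZ hZ0 using hex
  refine ⟨fun s => ∑ x₀ ∈ A, Z x₀ s, ⟨?_, 1, fun s hs => ?_⟩, ?_⟩
  · intro s
    exact MeromorphicAt.fun_sum fun x₀ _ => hZm x₀ s
  · have hW0 : ∀ x ∉ K, ((lam x : ℂ) ^ s) • W x = 0 := by
      intro x hx
      by_cases hxi : x ∈ range i
      · have hs0 : s ≠ 0 := fun h0 => by
          rw [h0] at hs
          simp at hs
          linarith
        rw [h.eq_zero x hxi, Complex.ofReal_zero, Complex.zero_cpow hs0]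
        ext v
        simp
      · have h1 := hθ x hxi
        rw [hθ0 x hx] at h1
        ext v
        have h2 := congrArg (fun a : EuclideanSpace ℝ (Fin (d + 1)) [⋀^Fin (d + 1)]→L[ℝ] ℂ =>
            a v) h1
        have h3 : (0 : ℂ) = (lam x : ℂ) * W x v := h2
        have h4 : W x v = 0 := (mul_eq_zero.1 h3.symm).resolve_left
          (Complex.ofReal_ne_zero.2 (h.pos x hxi).ne')
        rw [ContinuousAlternatingMap.smul_apply, h4, smul_zero]
        rfl
    refine ⟨⟨(finite_chartPartition (I := 𝓡∂ (d + 1)) hK).subset ?_, fun x₀ => (hZ x₀ s hs).1⟩, ?_⟩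
    · rintro x₀ ⟨x, hx, hx'⟩
      refine ⟨x, ?_, hx⟩
      by_contra hxK
      exact hx' (hW0 x hxK)
    · rw [formIntegral_eq_sum o hW0 hA]
      exact Finset.sum_congr rfl fun x₀ _ => (hZ x₀ s hs).2
  · simp only [Finset.mul_sum]
    exact tendsto_finsetSum _ fun x₀ _ => hZ0 x₀

end IsBoundaryDefining

end ZetaResidue

/-! ### Signs of frames -/

section SignAt

variable {n : ℕ} {H : Type*} [TopologicalSpace H]
  {I : ModelWithCorners ℝ (EuclideanSpace ℝ (Fin n)) H}
  {M : Type*} [TopologicalSpace M] [ChartedSpace H M] [IsManifold I ∞ M]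

/-- The sign of a frame at `x`, with the tangent space identified with the model space, so that the
base point can be replaced by an equal one. -/
def signAt (o : ManifoldOrientation I M) (x : M) (v : Fin n → EuclideanSpace ℝ (Fin n)) : ℝ :=
  frameSign (V := TangentSpace I x) (o.at' x) v

theorem signAt_congr (o : ManifoldOrientation I M) {x x' : M} (h : x = x')
    (v : Fin n → EuclideanSpace ℝ (Fin n)) : signAt o x v = signAt o x' v := by
  rw [h]

theorem chartSign_eq_signAt (o : ManifoldOrientation I M) {x₀ x : M}
    (hx : x ∈ (extChartAt I x₀).source) :
    chartSign o x₀ (extChartAt I x₀ x) = signAt o x fun j =>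
      (mfderivWithin 𝓘(ℝ, EuclideanSpace ℝ (Fin n)) I (extChartAt I x₀).symm (range I)
        (extChartAt I x₀ x) : EuclideanSpace ℝ (Fin n) →L[ℝ] EuclideanSpace ℝ (Fin n))
        (EuclideanSpace.single j 1) :=
  signAt_congr o ((extChartAt I x₀).left_inv hx) _

end SignAt

/-! ### Residues in charts of `X` and in charts of `Y` -/

section BoundaryChart

variable {d : ℕ} {X : Type*} [TopologicalSpace X] [ChartedSpace (EuclideanHalfSpace (d + 1)) X]
  [IsManifold (𝓡∂ (d + 1)) ∞ X]
  {Y : Type*} [TopologicalSpace Y] [ChartedSpace (EuclideanSpace ℝ (Fin d)) Y]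
  [IsManifold (𝓡 d) ∞ Y]
  {i : Y → X} {lam : X → ℝ}

/-- The inclusion of the boundary hyperplane. -/
def consZeroL (d : ℕ) : EuclideanSpace ℝ (Fin d) →L[ℝ] EuclideanSpace ℝ (Fin (d + 1)) where
  toFun v := consE (0, v)
  map_add' v w := by
    refine PiLp.ext fun j => Fin.cases ?_ (fun k => ?_) j
    · simp [consE_zero]
    · simp [consE_succ]
  map_smul' c v := by
    refine PiLp.ext fun j => Fin.cases ?_ (fun k => ?_) j
    · simp [consE_zero]
    · simp [consE_succ]
  cont := (contDiff_consE (n := 0)).continuous.comp (by fun_prop)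

theorem consZeroL_apply (v : EuclideanSpace ℝ (Fin d)) : consZeroL d v = consE (0, v) := rfl

theorem consZeroL_tailL {u : EuclideanSpace ℝ (Fin (d + 1))} (hu : u 0 = 0) :
    consZeroL d (tailL d u) = u :=
  eq_of_tailL_eq hu.symm (tailL_consE _ _)

/-- The standard basis consists of the inward normal and of the standard basis of the boundary. -/
theorem single_eq_cons : (fun j : Fin (d + 1) => EuclideanSpace.single j (1 : ℝ)) =
    Fin.cons (e₀ d) fun j => consZeroL d (EuclideanSpace.single j (1 : ℝ)) := by
  funext j
  refine Fin.cases ?_ (fun k => ?_) j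
  · refine PiLp.ext fun l => Fin.cases ?_ (fun m => ?_) l
    · simp [e₀_zero]
    · simp [e₀_of_ne (Fin.succ_ne_zero m)]
  · refine PiLp.ext fun l => Fin.cases ?_ (fun m => ?_) l
    · simp [consZeroL_apply, consE_zero, (Fin.succ_ne_zero k).symm]
    · simp [consZeroL_apply, consE_succ]

/-- The derivative of the inclusion of `Y` in boundary charts. -/
def boundaryDeriv (i : Y → X) (y₀ : Y) (x₀ : X) (v : EuclideanSpace ℝ (Fin d)) :
    EuclideanSpace ℝ (Fin d) →L[ℝ] EuclideanSpace ℝ (Fin d) :=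
  (tailL d).comp (fderiv ℝ (inclInCharts i y₀ x₀) v)

namespace IsBoundaryDefining

variable {y₀ y : Y} {x₀ : X}

theorem consZeroL_boundaryDeriv (h : IsBoundaryDefining d i lam) (hi : IsBoundaryPart d i)
    (hy : y ∈ (extChartAt (𝓡 d) y₀).source) (hx : i y ∈ (extChartAt (𝓡∂ (d + 1)) x₀).source)
    (v : EuclideanSpace ℝ (Fin d)) :
    consZeroL d (boundaryDeriv i y₀ x₀ (extChartAt (𝓡 d) y₀ y) v) =
      fderiv ℝ (inclInCharts i y₀ x₀) (extChartAt (𝓡 d) y₀ y) v :=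
  consZeroL_tailL (h.fderiv_inclInCharts_zero hi hy hx v)

/-- The first coordinate vector of a chart points inwards along `Y`. -/
theorem inward (h : IsBoundaryDefining d i lam) (hi : IsBoundaryPart d i)
    (hx : i y ∈ (extChartAt (𝓡∂ (d + 1)) x₀).source) :
    0 < (EuclideanSpace.proj (0 : Fin (d + 1)) : EuclideanSpace ℝ (Fin (d + 1)) →L[ℝ] ℝ)
      ((mfderiv (𝓡∂ (d + 1)) 𝓘(ℝ, EuclideanSpace ℝ (Fin (d + 1)))
        (extChartAt (𝓡∂ (d + 1)) (i y)) (i y) :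
        EuclideanSpace ℝ (Fin (d + 1)) →L[ℝ] EuclideanSpace ℝ (Fin (d + 1)))
        ((mfderivWithin 𝓘(ℝ, EuclideanSpace ℝ (Fin (d + 1))) (𝓡∂ (d + 1))
          (extChartAt (𝓡∂ (d + 1)) x₀).symm (range (𝓡∂ (d + 1)))
          (extChartAt (𝓡∂ (d + 1)) x₀ (i y)) :
          EuclideanSpace ℝ (Fin (d + 1)) →L[ℝ] EuclideanSpace ℝ (Fin (d + 1))) (e₀ d))) := by
  have : IsManifold (𝓡∂ (d + 1)) 1 X := DiffForm.isManifold_one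
  set ν := (mfderivWithin 𝓘(ℝ, EuclideanSpace ℝ (Fin (d + 1))) (𝓡∂ (d + 1))
          (extChartAt (𝓡∂ (d + 1)) x₀).symm (range (𝓡∂ (d + 1)))
          (extChartAt (𝓡∂ (d + 1)) x₀ (i y)) :
          EuclideanSpace ℝ (Fin (d + 1)) →L[ℝ] EuclideanSpace ℝ (Fin (d + 1))) (e₀ d) with hν
  have hmd : MDifferentiableAt (𝓡∂ (d + 1)) 𝓘(ℝ, ℝ) lam (i y) :=
    (h.contMDiff _).mdifferentiableAt (by simp)
  have hyr : i y ∈ range i := mem_range_self y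
  have hs := mem_extChartAt_source (I := 𝓡∂ (d + 1)) (i y)
  have h1 := mfderiv_eq_fderivWithin_comp hmd hx ν
  have h2 := mfderiv_eq_fderivWithin_comp hmd hs ν
  have h3 : (mfderiv (𝓡∂ (d + 1)) 𝓘(ℝ, EuclideanSpace ℝ (Fin (d + 1)))
      (extChartAt (𝓡∂ (d + 1)) x₀) (i y) :
      EuclideanSpace ℝ (Fin (d + 1)) →L[ℝ] EuclideanSpace ℝ (Fin (d + 1))) ν = e₀ d :=
    congrArg (fun L : EuclideanSpace ℝ (Fin (d + 1)) →L[ℝ] EuclideanSpace ℝ (Fin (d + 1)) =>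
      L (e₀ d)) (mfderiv_extChartAt_comp_mfderivWithin_extChartAt_symm' hx)
  have h1' := h1.trans (congrArg _ h3)
  have h2' := h2.trans (h.fderivWithin_apply hi hs hyr _)
  have h4 := h.fderivWithin_e₀_pos hi hx hyr
  have h5 := h.fderivWithin_e₀_pos hi hs hyr
  have h6 := h4.trans_eq (h1'.symm.trans h2')
  exact (pos_iff_pos_of_mul_pos h6).2 h5

/-- The differential of the inclusion, on coordinate vectors. -/
theorem mfderiv_frame (h : IsBoundaryDefining d i lam) (hi : IsBoundaryPart d i)
    (hy : y ∈ (extChartAt (𝓡 d) y₀).source) (hx : i y ∈ (extChartAt (𝓡∂ (d + 1)) x₀).source)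
    (v : EuclideanSpace ℝ (Fin d)) :
    (mfderiv (𝓡 d) (𝓡∂ (d + 1)) i y :
      EuclideanSpace ℝ (Fin d) →L[ℝ] EuclideanSpace ℝ (Fin (d + 1)))
      ((mfderivWithin 𝓘(ℝ, EuclideanSpace ℝ (Fin d)) (𝓡 d) (extChartAt (𝓡 d) y₀).symm
        (range (𝓡 d)) (extChartAt (𝓡 d) y₀ y) :
        EuclideanSpace ℝ (Fin d) →L[ℝ] EuclideanSpace ℝ (Fin d)) v) =
      (mfderivWithin 𝓘(ℝ, EuclideanSpace ℝ (Fin (d + 1))) (𝓡∂ (d + 1))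
          (extChartAt (𝓡∂ (d + 1)) x₀).symm (range (𝓡∂ (d + 1)))
          (extChartAt (𝓡∂ (d + 1)) x₀ (i y)) :
          EuclideanSpace ℝ (Fin (d + 1)) →L[ℝ] EuclideanSpace ℝ (Fin (d + 1)))
        (consZeroL d (boundaryDeriv i y₀ x₀ (extChartAt (𝓡 d) y₀ y) v)) := by
  have : IsManifold (𝓡∂ (d + 1)) 1 X := DiffForm.isManifold_one
  rw [h.consZeroL_boundaryDeriv hi hy hx, hi.fderiv_inclInCharts hy hx]
  exact (congrArg (fun L : EuclideanSpace ℝ (Fin (d + 1)) →L[ℝ] EuclideanSpace ℝ (Fin (d + 1)) =>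
      L _) (mfderivWithin_extChartAt_symm_comp_mfderiv_extChartAt' hx)).symm

/-- The signs of the coordinate frames of `Y` and of `X` differ by that of the jacobian. -/
theorem chartSign_boundary (h : IsBoundaryDefining d i lam) (hi : IsBoundaryPart d i)
    {oX : ManifoldOrientation (𝓡∂ (d + 1)) X} {oY : ManifoldOrientation (𝓡 d) Y}
    (ho : IsBoundaryOrientation i oX oY)
    (hy : y ∈ (extChartAt (𝓡 d) y₀).source) (hx : i y ∈ (extChartAt (𝓡∂ (d + 1)) x₀).source) :
    chartSign oY y₀ (extChartAt (𝓡 d) y₀ y) =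
      (SignType.sign (boundaryDeriv i y₀ x₀ (extChartAt (𝓡 d) y₀ y)).det : SignType) *
        chartSign oX x₀ (extChartAt (𝓡∂ (d + 1)) x₀ (i y)) := by
  set Φ := (mfderivWithin 𝓘(ℝ, EuclideanSpace ℝ (Fin (d + 1))) (𝓡∂ (d + 1))
          (extChartAt (𝓡∂ (d + 1)) x₀).symm (range (𝓡∂ (d + 1)))
          (extChartAt (𝓡∂ (d + 1)) x₀ (i y)) :
          EuclideanSpace ℝ (Fin (d + 1)) →L[ℝ] EuclideanSpace ℝ (Fin (d + 1))) with hΦ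
  rw [chartSign_eq_signAt oY hy, chartSign_eq_signAt oX hx]
  have h1 := ho y (Φ (e₀ d)) (fun j =>
    (mfderivWithin 𝓘(ℝ, EuclideanSpace ℝ (Fin d)) (𝓡 d) (extChartAt (𝓡 d) y₀).symm
        (range (𝓡 d)) (extChartAt (𝓡 d) y₀ y) :
        EuclideanSpace ℝ (Fin d) →L[ℝ] EuclideanSpace ℝ (Fin d)) (EuclideanSpace.single j 1))
    (h.inward hi hx)
  refine Eq.trans h1 ?_
  have h2 : (fun j => Φ (EuclideanSpace.single j 1)) =
      (Fin.cons (Φ (e₀ d)) fun j => Φ (consZeroL d (EuclideanSpace.single j 1)) :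
        Fin (d + 1) → EuclideanSpace ℝ (Fin (d + 1))) := by
    have := congrArg (fun v : Fin (d + 1) → EuclideanSpace ℝ (Fin (d + 1)) => fun j => Φ (v j))
      (single_eq_cons (d := d))
    refine Eq.trans this ?_
    funext j
    refine Fin.cases rfl (fun k => rfl) j
  have h3 := frameSign_cons_map (V := TangentSpace (𝓡∂ (d + 1)) (i y)) (oX.at' (i y)) (Φ (e₀ d))
    ((Φ.comp (consZeroL d)).toLinearMap :
      EuclideanSpace ℝ (Fin d) →ₗ[ℝ] EuclideanSpace ℝ (Fin (d + 1)))
    (boundaryDeriv i y₀ x₀ (extChartAt (𝓡 d) y₀ y))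
  have h4 : signAt oX (i y) (fun j => Φ (EuclideanSpace.single j 1)) =
      signAt oX (i y) (Fin.cons (Φ (e₀ d)) fun j => Φ (consZeroL d (EuclideanSpace.single j 1)) :
        Fin (d + 1) → EuclideanSpace ℝ (Fin (d + 1))) := congrArg _ h2
  refine Eq.trans ?_ (h3.trans (congrArg _ h4.symm))
  have h5 : (fun j : Fin d => (mfderiv (𝓡 d) (𝓡∂ (d + 1)) i y :
      EuclideanSpace ℝ (Fin d) →L[ℝ] EuclideanSpace ℝ (Fin (d + 1)))
      ((mfderivWithin 𝓘(ℝ, EuclideanSpace ℝ (Fin d)) (𝓡 d) (extChartAt (𝓡 d) y₀).symm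
        (range (𝓡 d)) (extChartAt (𝓡 d) y₀ y) :
        EuclideanSpace ℝ (Fin d) →L[ℝ] EuclideanSpace ℝ (Fin d)) (EuclideanSpace.single j 1))) =
      fun j => Φ (consZeroL d (boundaryDeriv i y₀ x₀ (extChartAt (𝓡 d) y₀ y)
        (EuclideanSpace.single j 1))) :=
    funext fun j => h.mfderiv_frame hi hy hx _
  exact congrArg (fun w => signAt oX (i y) (Fin.cons (Φ (e₀ d)) w :
    Fin (d + 1) → EuclideanSpace ℝ (Fin (d + 1)))) h5

variable {θ : DiffForm (𝓡∂ (d + 1)) X (d + 1)} {η : DiffForm (𝓡 d) Y d}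

/-- The form `dlam ∧ κ`, evaluated on a coordinate frame along `Y`. -/
theorem inChart_wedge_dForm_single (h : IsBoundaryDefining d i lam) (hi : IsBoundaryPart d i)
    {κ : DiffForm (𝓡∂ (d + 1)) X d}
    (hθ : θ (i y) = DiffForm.wedge (Nat.add_comm 1 d) (dForm lam) κ (i y))
    (hx : i y ∈ (extChartAt (𝓡∂ (d + 1)) x₀).source) :
    θ.inChart x₀ (extChartAt (𝓡∂ (d + 1)) x₀ (i y)) (fun j => EuclideanSpace.single j 1) =
      partial₀ (lam ∘ (extChartAt (𝓡∂ (d + 1)) x₀).symm) (extChartAt (𝓡∂ (d + 1)) x₀ (i y)) •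
        κ.inChart x₀ (extChartAt (𝓡∂ (d + 1)) x₀ (i y))
          (fun j => consZeroL d (EuclideanSpace.single j 1)) := by
  have hT := (extChartAt (𝓡∂ (d + 1)) x₀).map_source hx
  have hdl := DiffForm.inChart_dForm hT ((h.contMDiff _).mdifferentiableAt (by simp) :
    MDifferentiableAt (𝓡∂ (d + 1)) 𝓘(ℝ, ℝ) lam _)
  rw [DiffForm.inChart_congr hx hθ, DiffForm.inChart_wedge, hdl, single_eq_cons,
    wedge_one_cons_of_forall_eq_zero, Complex.real_smul]
  · rfl
  · intro j
    have h1 := h.fderivWithin_eq_zero hi hx (mem_range_self y)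
      (a := consZeroL d (EuclideanSpace.single j 1)) rfl
    exact congrArg Complex.ofReal h1

/-- The restriction of `κ` to `Y`, evaluated on the coordinate frame of `Y`. -/
theorem inChart_boundary_single (hi : IsBoundaryPart d i) (h : IsBoundaryDefining d i lam)
    {κ : DiffForm (𝓡∂ (d + 1)) X d} (hη : η y = DiffForm.pullback i κ y)
    (hy : y ∈ (extChartAt (𝓡 d) y₀).source) (hx : i y ∈ (extChartAt (𝓡∂ (d + 1)) x₀).source) :
    η.inChart y₀ (extChartAt (𝓡 d) y₀ y) (fun j => EuclideanSpace.single j 1) =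
      (boundaryDeriv i y₀ x₀ (extChartAt (𝓡 d) y₀ y)).det •
        κ.inChart x₀ (extChartAt (𝓡∂ (d + 1)) x₀ (i y))
          (fun j => consZeroL d (EuclideanSpace.single j 1)) := by
  have h1 := (DiffForm.inChart_pullback_eventuallyEq (w := κ)
    (Eventually.of_forall fun z => (hi.contMDiff z).mdifferentiableAt (by simp))
    hi.contMDiff.continuous.continuousAt hy hx).self_of_nhdsWithin
      (DiffForm.extChartAt_mem_range _ _)
  rw [DiffForm.inChart_congr hy hη, h1]
  have h2 : (extChartAt (𝓡∂ (d + 1)) x₀ ∘ i ∘ (extChartAt (𝓡 d) y₀).symm)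
      (extChartAt (𝓡 d) y₀ y) = extChartAt (𝓡∂ (d + 1)) x₀ (i y) := by
    simp only [Function.comp, (extChartAt (𝓡 d) y₀).left_inv hy]
  beta_reduce
  rw [h2]
  refine Eq.trans ?_ (form_map_single ((κ.inChart x₀ (extChartAt (𝓡∂ (d + 1)) x₀ (i y))
    ).compContinuousLinearMap (consZeroL d)) (boundaryDeriv i y₀ x₀ (extChartAt (𝓡 d) y₀ y)))
  have h3 : range (𝓡 d) = univ := (𝓡 d).range_eq_univ
  refine congrArg (κ.inChart x₀ (extChartAt (𝓡∂ (d + 1)) x₀ (i y))) (funext fun j => ?_)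
  rw [h3]
  refine Eq.trans ?_ (h.consZeroL_boundaryDeriv hi hy hx (EuclideanSpace.single j 1)).symm
  simp only [fderivWithin_univ]
  rfl

variable [T2Space X] [SigmaCompactSpace X] [T2Space Y] [SigmaCompactSpace Y]

/-- The boundary density is, up to a jacobian, the integrand on `Y` of `η`, when `θ = dlam ∧ κ` and
`η = κ|_Y` at the given point. -/
theorem boundaryDensity_eq (h : IsBoundaryDefining d i lam) (hi : IsBoundaryPart d i)
    {oX : ManifoldOrientation (𝓡∂ (d + 1)) X} {oY : ManifoldOrientation (𝓡 d) Y}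
    (ho : IsBoundaryOrientation i oX oY) {κ : DiffForm (𝓡∂ (d + 1)) X d}
    (hθ : θ (i y) = DiffForm.wedge (Nat.add_comm 1 d) (dForm lam) κ (i y))
    (hη : η y = DiffForm.pullback i κ y)
    (hy : y ∈ (extChartAt (𝓡 d) y₀).source) (hx : i y ∈ (extChartAt (𝓡∂ (d + 1)) x₀).source) :
    |(boundaryDeriv i y₀ x₀ (extChartAt (𝓡 d) y₀ y)).det| •
      boundaryDensity i lam oX θ x₀ (tailL d (extChartAt (𝓡∂ (d + 1)) x₀ (i y))) =
    (chartPartition (𝓡∂ (d + 1)) X x₀ (i y) * chartSign oY y₀ (extChartAt (𝓡 d) y₀ y)) •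
      η.inChart y₀ (extChartAt (𝓡 d) y₀ y) (fun j => EuclideanSpace.single j 1) := by
  have hT := (extChartAt (𝓡∂ (d + 1)) x₀).map_source hx
  have hl := (extChartAt (𝓡∂ (d + 1)) x₀).left_inv hx
  have hu : consE (0, tailL d (extChartAt (𝓡∂ (d + 1)) x₀ (i y))) =
      extChartAt (𝓡∂ (d + 1)) x₀ (i y) :=
    consZeroL_tailL (h.coord_zero_eq_zero hx (mem_range_self y))
  have hpos : 0 < partial₀ (lam ∘ (extChartAt (𝓡∂ (d + 1)) x₀).symm)
      (extChartAt (𝓡∂ (d + 1)) x₀ (i y)) := h.fderivWithin_e₀_pos hi hx (mem_range_self y)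
  rw [boundaryDensity, hu, if_pos ⟨hT, hl.symm ▸ mem_range_self y⟩, chartIntegrandExt_of_mem oX hT,
    chartIntegrand_eq, h.inChart_wedge_dForm_single hi hθ hx, inChart_boundary_single hi h hη hy hx,
    h.chartSign_boundary hi ho hy hx, hl]
  generalize κ.inChart x₀ (extChartAt (𝓡∂ (d + 1)) x₀ (i y))
          (fun j => consZeroL d (EuclideanSpace.single j 1)) = a
  generalize (boundaryDeriv i y₀ x₀ (extChartAt (𝓡 d) y₀ y)).det = D
  simp only [smul_smul]
  congr 1
  rw [← sign_mul_self D]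
  field_simp

end IsBoundaryDefining

end BoundaryChart

/-! ### Integration over `Y` -/

section BoundaryIntegral

section Boundaryless

variable {n : ℕ} {M : Type*} [TopologicalSpace M] [ChartedSpace (EuclideanSpace ℝ (Fin n)) M]
  [IsManifold (𝓡 n) ∞ M] [T2Space M] [SigmaCompactSpace M]

theorem integrableOn_chartIntegrand (o : ManifoldOrientation (𝓡 n) M) {K : Set M}
    {w : DiffForm (𝓡 n) M n} (hK : IsCompact K)
    (hw0 : ∀ x ∉ K, w x = 0) (hw : ∀ x, w.SmoothAt x) (x₀ : M) :
    IntegrableOn (chartIntegrand o w x₀) (extChartAt (𝓡 n) x₀).target := by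
  have h1 : ContinuousOn (chartIntegrandExt o w x₀) univ := by
    have := (contDiffOn_chartIntegrandExt o hK hw0 hw x₀).continuousOn
    rwa [(𝓡 n).range_eq_univ] at this
  have h2 : IntegrableOn (chartIntegrandExt o w x₀) (extChartAt (𝓡 n) x₀).target := by
    refine Integrable.integrableOn ?_
    refine (continuousOn_univ.1 h1).integrable_of_hasCompactSupport ?_
    exact HasCompactSupport.intro (isCompact_chartSupport (I := 𝓡 n) hK x₀) fun u hu =>
      chartIntegrandExt_eq_zero o hw0 x₀ hu
  exact h2.congr_fun (fun u hu => chartIntegrandExt_of_mem o hu) (measurableSet_target x₀)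

theorem formIntegrable_of_smooth (o : ManifoldOrientation (𝓡 n) M) {K : Set M}
    {w : DiffForm (𝓡 n) M n} (hK : IsCompact K)
    (hw0 : ∀ x ∉ K, w x = 0) (hw : ∀ x, w.SmoothAt x) : FormIntegrable o w := by
  refine ⟨(finite_chartPartition (I := 𝓡 n) hK).subset ?_, integrableOn_chartIntegrand o hK hw0 hw⟩
  rintro x₀ ⟨x, hx, hx'⟩
  exact ⟨x, by_contra fun hxK => hx' (hw0 x hxK), hx⟩

end Boundaryless

variable {d : ℕ} {X : Type*} [TopologicalSpace X] [ChartedSpace (EuclideanHalfSpace (d + 1)) X]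
  [IsManifold (𝓡∂ (d + 1)) ∞ X] [T2Space X] [SigmaCompactSpace X]
  {Y : Type*} [TopologicalSpace Y] [ChartedSpace (EuclideanSpace ℝ (Fin d)) Y]
  [IsManifold (𝓡 d) ∞ Y] [T2Space Y] [SigmaCompactSpace Y]
  {i : Y → X} {lam : X → ℝ}

/-- The partition function of the chart of `Y` at `y₀`, transported to the boundary hyperplane in
the chart of `X` at `x₀`; it is zero at the points that are not on `Y`. -/
def boundaryPartition (i : Y → X) (y₀ : Y) (x₀ : X) (v : EuclideanSpace ℝ (Fin d)) : ℝ :=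
  Function.extend i (chartPartition (𝓡 d) Y y₀) 0
    ((extChartAt (𝓡∂ (d + 1)) x₀).symm (consE (0, v)))

/-- The part of the chart at `y₀` that is mapped into the chart at `x₀`. -/
def chartOverlap (i : Y → X) (y₀ : Y) (x₀ : X) : Set (EuclideanSpace ℝ (Fin d)) :=
  (extChartAt (𝓡 d) y₀).target ∩
    (extChartAt (𝓡 d) y₀).symm ⁻¹' (i ⁻¹' (extChartAt (𝓡∂ (d + 1)) x₀).source)

namespace IsBoundaryDefining

variable {θ : DiffForm (𝓡∂ (d + 1)) X (d + 1)} {η : DiffForm (𝓡 d) Y d} {K : Set X}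

theorem measurableSet_chartOverlap (hi : IsBoundaryPart d i) (y₀ : Y) (x₀ : X) :
    MeasurableSet (chartOverlap (d := d) i y₀ x₀) :=
  ((continuousOn_extChartAt_symm (I := 𝓡 d) y₀).isOpen_inter_preimage
    (isOpen_extChartAt_target (I := 𝓡 d) y₀)
    ((isOpen_extChartAt_source (I := 𝓡∂ (d + 1)) x₀).preimage
      hi.contMDiff.continuous)).measurableSet

theorem hasFDerivAt_chartOverlap (hi : IsBoundaryPart d i) {y₀ : Y} {x₀ : X}
    {v : EuclideanSpace ℝ (Fin d)} (hv : v ∈ chartOverlap i y₀ x₀) :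
    HasFDerivAt (tailL d ∘ inclInCharts i y₀ x₀) (boundaryDeriv i y₀ x₀ v) v := by
  have h1 := hi.contDiffAt_inclInCharts ((extChartAt (𝓡 d) y₀).map_target hv.1) hv.2
  rw [(extChartAt (𝓡 d) y₀).right_inv hv.1] at h1
  exact (tailL d).hasFDerivAt.comp v (h1.differentiableAt (by simp)).hasFDerivAt

theorem injOn_chartOverlap (h : IsBoundaryDefining d i lam) (hi : IsBoundaryPart d i)
    (y₀ : Y) (x₀ : X) : InjOn (tailL d ∘ inclInCharts i y₀ x₀) (chartOverlap i y₀ x₀) := by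
  intro v hv v' hv' hvv'
  have h1 := h.coord_zero_eq_zero hv.2 (mem_range_self _)
  have h2 := h.coord_zero_eq_zero hv'.2 (mem_range_self _)
  have h3 : extChartAt (𝓡∂ (d + 1)) x₀ (i ((extChartAt (𝓡 d) y₀).symm v)) =
      extChartAt (𝓡∂ (d + 1)) x₀ (i ((extChartAt (𝓡 d) y₀).symm v')) :=
    eq_of_tailL_eq (h1.trans h2.symm) hvv'
  exact (extChartAt (𝓡 d) y₀).symm.injOn hv.1 hv'.1
    (hi.isEmbedding.injective ((extChartAt (𝓡∂ (d + 1)) x₀).injOn hv.2 hv'.2 h3))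

theorem boundaryPartition_of_mem (h : IsBoundaryDefining d i lam) (hi : IsBoundaryPart d i)
    {y y₀ : Y} {x₀ : X} (hx : i y ∈ (extChartAt (𝓡∂ (d + 1)) x₀).source) :
    boundaryPartition i y₀ x₀ (tailL d (extChartAt (𝓡∂ (d + 1)) x₀ (i y))) =
      chartPartition (𝓡 d) Y y₀ y := by
  have h1 : consE (0, tailL d (extChartAt (𝓡∂ (d + 1)) x₀ (i y))) =
      extChartAt (𝓡∂ (d + 1)) x₀ (i y) :=
    consZeroL_tailL (h.coord_zero_eq_zero hx (mem_range_self y))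
  rw [boundaryPartition, h1, (extChartAt (𝓡∂ (d + 1)) x₀).left_inv hx,
    hi.isEmbedding.injective.extend_apply]

/-- Where the boundary density does not vanish, the boundary hyperplane consists of points of `Y`.
-/
theorem exists_of_boundaryDensity_ne_zero {oX : ManifoldOrientation (𝓡∂ (d + 1)) X}
    (hθ0 : ∀ x ∉ K, θ x = 0) {x₀ : X} {v : EuclideanSpace ℝ (Fin d)}
    (hv : boundaryDensity i lam oX θ x₀ v ≠ 0) :
    ∃ y, i y ∈ K ∧ i y ∈ (extChartAt (𝓡∂ (d + 1)) x₀).source ∧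
      v = tailL d (extChartAt (𝓡∂ (d + 1)) x₀ (i y)) := by
  have hc : consE (0, v) ∈ (extChartAt (𝓡∂ (d + 1)) x₀).target ∧
      (extChartAt (𝓡∂ (d + 1)) x₀).symm (consE (0, v)) ∈ range i := by
    by_contra hc
    exact hv (if_neg hc)
  obtain ⟨y, hy⟩ := hc.2
  refine ⟨y, ?_, ?_, ?_⟩
  · by_contra hyK
    refine hv ?_
    rw [boundaryDensity, if_pos hc, chartIntegrandExt_eq_zero oX hθ0, smul_zero]
    rintro ⟨x, hx, hxu⟩
    refine hyK ?_
    have hx1 := tsupport_chartPartition_subset x₀ hx.1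
    rw [hy, ← hxu, (extChartAt (𝓡∂ (d + 1)) x₀).left_inv hx1]
    exact hx.2
  · rw [hy]
    exact (extChartAt (𝓡∂ (d + 1)) x₀).map_target hc.1
  · rw [hy, (extChartAt (𝓡∂ (d + 1)) x₀).right_inv hc.1, tailL_consE]

/-- The integrands on both sides of the change of variables. -/
theorem smul_boundaryDensity_eq (h : IsBoundaryDefining d i lam) (hi : IsBoundaryPart d i)
    {oX : ManifoldOrientation (𝓡∂ (d + 1)) X} {oY : ManifoldOrientation (𝓡 d) Y}
    (ho : IsBoundaryOrientation i oX oY)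
    (hθη : ∀ y, ∃ κ : DiffForm (𝓡∂ (d + 1)) X d,
      θ (i y) = DiffForm.wedge (Nat.add_comm 1 d) (dForm lam) κ (i y) ∧
      η y = DiffForm.pullback i κ y) {y₀ : Y} {x₀ : X}
    {v : EuclideanSpace ℝ (Fin d)} (hv : v ∈ chartOverlap i y₀ x₀) :
    |(boundaryDeriv i y₀ x₀ v).det| •
      (boundaryPartition i y₀ x₀ ((tailL d ∘ inclInCharts i y₀ x₀) v) •
        boundaryDensity i lam oX θ x₀ ((tailL d ∘ inclInCharts i y₀ x₀) v)) =
      chartPartition (𝓡∂ (d + 1)) X x₀ (i ((extChartAt (𝓡 d) y₀).symm v)) •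
        chartIntegrand oY η y₀ v := by
  set y := (extChartAt (𝓡 d) y₀).symm v with hy
  have hys : y ∈ (extChartAt (𝓡 d) y₀).source := (extChartAt (𝓡 d) y₀).map_target hv.1
  have hvy : extChartAt (𝓡 d) y₀ y = v := (extChartAt (𝓡 d) y₀).right_inv hv.1
  obtain ⟨κ, hκ1, hκ2⟩ := hθη y
  have h1 := h.boundaryDensity_eq hi ho hκ1 hκ2 hys hv.2
  rw [hvy] at h1
  have h2 : (tailL d ∘ inclInCharts i y₀ x₀) v = tailL d (extChartAt (𝓡∂ (d + 1)) x₀ (i y)) := rfl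
  rw [h2, boundaryPartition_of_mem h hi hv.2, smul_comm, h1, chartIntegrand_eq, ← hy]
  simp only [smul_smul]
  congr 1
  ring

theorem smul_boundaryDensity_eq_zero {oX : ManifoldOrientation (𝓡∂ (d + 1)) X}
    (h : IsBoundaryDefining d i lam) (hi : IsBoundaryPart d i)
    (hθ0 : ∀ x ∉ K, θ x = 0) {y₀ : Y} {x₀ : X} {v : EuclideanSpace ℝ (Fin d)}
    (hv : v ∉ (tailL d ∘ inclInCharts i y₀ x₀) '' chartOverlap i y₀ x₀) :
    boundaryPartition i y₀ x₀ v • boundaryDensity i lam oX θ x₀ v = 0 := by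
  by_contra hne
  obtain ⟨y, -, hx, rfl⟩ := exists_of_boundaryDensity_ne_zero hθ0 (right_ne_zero_of_smul hne)
  have h1 := left_ne_zero_of_smul hne
  rw [boundaryPartition_of_mem h hi hx] at h1
  have hys : y ∈ (extChartAt (𝓡 d) y₀).source :=
    tsupport_chartPartition_subset y₀ (subset_tsupport _ h1)
  have hl := (extChartAt (𝓡 d) y₀).left_inv hys
  refine hv ⟨extChartAt (𝓡 d) y₀ y, ⟨(extChartAt (𝓡 d) y₀).map_source hys, ?_⟩, ?_⟩
  · rw [mem_preimage, hl]
    exact hx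
  · simp only [Function.comp, inclInCharts, hl]

/-- Change of variables between the boundary hyperplane in a chart of `X` and a chart of `Y`. -/
theorem integral_boundaryDensity (h : IsBoundaryDefining d i lam) (hi : IsBoundaryPart d i)
    {oX : ManifoldOrientation (𝓡∂ (d + 1)) X} {oY : ManifoldOrientation (𝓡 d) Y}
    (ho : IsBoundaryOrientation i oX oY) (hθ0 : ∀ x ∉ K, θ x = 0)
    (hθη : ∀ y, ∃ κ : DiffForm (𝓡∂ (d + 1)) X d,
      θ (i y) = DiffForm.wedge (Nat.add_comm 1 d) (dForm lam) κ (i y) ∧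
      η y = DiffForm.pullback i κ y) (y₀ : Y) (x₀ : X)
    (hint : IntegrableOn (chartIntegrand oY η y₀) (extChartAt (𝓡 d) y₀).target) :
    IntegrableOn (fun v => chartPartition (𝓡∂ (d + 1)) X x₀ (i ((extChartAt (𝓡 d) y₀).symm v)) •
        chartIntegrand oY η y₀ v) (extChartAt (𝓡 d) y₀).target ∧
    Integrable (fun v => boundaryPartition i y₀ x₀ v • boundaryDensity i lam oX θ x₀ v) ∧
    ∫ v, boundaryPartition i y₀ x₀ v • boundaryDensity i lam oX θ x₀ v =
      ∫ v in (extChartAt (𝓡 d) y₀).target,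
        chartPartition (𝓡∂ (d + 1)) X x₀ (i ((extChartAt (𝓡 d) y₀).symm v)) •
          chartIntegrand oY η y₀ v := by
  have hm := measurableSet_chartOverlap hi y₀ x₀
  have hT : MeasurableSet (extChartAt (𝓡 d) y₀).target := measurableSet_target y₀
  have hder : ∀ v ∈ chartOverlap i y₀ x₀, HasFDerivWithinAt (tailL d ∘ inclInCharts i y₀ x₀)
      (boundaryDeriv i y₀ x₀ v) (chartOverlap i y₀ x₀) v := fun v hv =>
    (hasFDerivAt_chartOverlap hi hv).hasFDerivWithinAt
  have hinj := h.injOn_chartOverlap hi y₀ x₀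
  have hI : IntegrableOn (fun v => chartPartition (𝓡∂ (d + 1)) X x₀
      (i ((extChartAt (𝓡 d) y₀).symm v)) • chartIntegrand oY η y₀ v)
      (extChartAt (𝓡 d) y₀).target := by
    refine Integrable.bdd_smul (μ := volume.restrict (extChartAt (𝓡 d) y₀).target)
      (φ := fun v => chartPartition (𝓡∂ (d + 1)) X x₀ (i ((extChartAt (𝓡 d) y₀).symm v)))
      hint 1 ?_ (Eventually.of_forall fun v => ?_)
    · refine ContinuousOn.aestronglyMeasurable ?_ hT
      exact (((chartPartition (𝓡∂ (d + 1)) X x₀).contMDiff.continuous.comp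
        hi.contMDiff.continuous).comp_continuousOn (continuousOn_extChartAt_symm y₀))
    · rw [Real.norm_eq_abs, abs_of_nonneg ((chartPartition (𝓡∂ (d + 1)) X).nonneg x₀ _)]
      exact (chartPartition (𝓡∂ (d + 1)) X).le_one x₀ _
  have hzero : ∀ v ∉ (tailL d ∘ inclInCharts i y₀ x₀) '' chartOverlap i y₀ x₀,
      boundaryPartition i y₀ x₀ v • boundaryDensity i lam oX θ x₀ v = 0 := fun v hv =>
    smul_boundaryDensity_eq_zero h hi hθ0 hv
  have hcongr : EqOn (fun v => |(boundaryDeriv i y₀ x₀ v).det| •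
      (boundaryPartition i y₀ x₀ ((tailL d ∘ inclInCharts i y₀ x₀) v) •
        boundaryDensity i lam oX θ x₀ ((tailL d ∘ inclInCharts i y₀ x₀) v)))
      (fun v => chartPartition (𝓡∂ (d + 1)) X x₀ (i ((extChartAt (𝓡 d) y₀).symm v)) •
        chartIntegrand oY η y₀ v) (chartOverlap i y₀ x₀) := fun v hv =>
    h.smul_boundaryDensity_eq hi ho hθη hv
  refine ⟨hI, ?_, ?_⟩
  · refine (integrableOn_iff_integrable_of_support_subset
      (s := (tailL d ∘ inclInCharts i y₀ x₀) '' chartOverlap i y₀ x₀) fun v hv => ?_).1 ?_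
    · by_contra hc
      exact hv (hzero v hc)
    · rw [integrableOn_image_iff_integrableOn_abs_det_fderiv_smul volume hm hder hinj]
      exact (hI.mono_set inter_subset_left).congr_fun hcongr.symm hm
  · rw [← setIntegral_eq_integral_of_forall_compl_eq_zero hzero,
      integral_image_eq_integral_abs_det_fderiv_smul volume hm hder hinj,
      setIntegral_congr_fun hm hcongr]
    refine (setIntegral_eq_of_subset_of_forall_sdiff_eq_zero hT inter_subset_left
      fun v hv => ?_).symm
    have h1 : i ((extChartAt (𝓡 d) y₀).symm v) ∉ tsupport (chartPartition (𝓡∂ (d + 1)) X x₀) :=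
      fun hc => hv.2 ⟨hv.1, tsupport_chartPartition_subset x₀ hc⟩
    rw [image_eq_zero_of_notMem_tsupport h1, zero_smul]

/-- The boundary integrals in the charts of `X` add up to the integral over `Y`: cut both sides by
the partitions of unity of `X` and of `Y`, and change variables in each piece. -/
theorem sum_integral_boundaryDensity (h : IsBoundaryDefining d i lam) (hi : IsBoundaryPart d i)
    {oX : ManifoldOrientation (𝓡∂ (d + 1)) X} {oY : ManifoldOrientation (𝓡 d) Y}
    (ho : IsBoundaryOrientation i oX oY) (hK : IsCompact K) (hθ0 : ∀ x ∉ K, θ x = 0)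
    (hηs : ∀ y, η.SmoothAt y) (hη0 : ∀ y, i y ∉ K → η y = 0)
    (hθη : ∀ y, ∃ κ : DiffForm (𝓡∂ (d + 1)) X d,
      θ (i y) = DiffForm.wedge (Nat.add_comm 1 d) (dForm lam) κ (i y) ∧
      η y = DiffForm.pullback i κ y) {A : Finset X}
    (hA : ∀ x₀, ∀ x ∈ K, chartPartition (𝓡∂ (d + 1)) X x₀ x ≠ 0 → x₀ ∈ A) :
    FormIntegrable oY η ∧
      ∑ x₀ ∈ A, ∫ v, boundaryDensity i lam oX θ x₀ v = formIntegral oY η := by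
  have hcl : IsClosedEmbedding i := ⟨hi.isEmbedding, h.isClosed_range⟩
  have hKY : IsCompact (i ⁻¹' K) := hcl.isCompact_preimage hK
  have hη0' : ∀ y ∉ i ⁻¹' K, η y = 0 := hη0
  have hint := integrableOn_chartIntegrand oY hKY hη0' hηs
  set B := (finite_chartPartition (I := 𝓡 d) hKY).toFinset with hB
  have hBm : ∀ y₀, ∀ y ∈ i ⁻¹' K, chartPartition (𝓡 d) Y y₀ y ≠ 0 → y₀ ∈ B := fun y₀ y hy hne =>
    (Set.Finite.mem_toFinset _).2 ⟨y, hy, hne⟩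
  refine ⟨formIntegrable_of_smooth oY hKY hη0' hηs, ?_⟩
  have key := fun y₀ x₀ => h.integral_boundaryDensity hi ho hθ0 hθη y₀ x₀ (hint y₀)
  have e1 : ∀ x₀, ∫ v, boundaryDensity i lam oX θ x₀ v = ∑ y₀ ∈ B,
      ∫ v in (extChartAt (𝓡 d) y₀).target,
        chartPartition (𝓡∂ (d + 1)) X x₀ (i ((extChartAt (𝓡 d) y₀).symm v)) •
          chartIntegrand oY η y₀ v := by
    intro x₀
    rw [← Finset.sum_congr rfl fun y₀ _ => (key y₀ x₀).2.2,
      ← integral_finsetSum _ fun y₀ _ => (key y₀ x₀).2.1]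
    refine integral_congr_ae (Eventually.of_forall fun v => ?_)
    simp only [← Finset.sum_smul]
    by_cases hv : boundaryDensity i lam oX θ x₀ v = 0
    · rw [hv, smul_zero]
    · obtain ⟨y, hyK, hx, rfl⟩ := exists_of_boundaryDensity_ne_zero hθ0 hv
      rw [Finset.sum_congr rfl fun y₀ _ => boundaryPartition_of_mem (y₀ := y₀) h hi hx,
        sum_chartPartition fun y₀ hne => hBm y₀ y hyK hne, one_smul]
  rw [Finset.sum_congr rfl fun x₀ _ => e1 x₀, Finset.sum_comm,
    formIntegral_eq_sum oY hη0' hBm]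
  refine Finset.sum_congr rfl fun y₀ _ => ?_
  rw [← integral_finsetSum _ fun x₀ _ => (key y₀ x₀).1]
  refine setIntegral_congr_fun (measurableSet_target y₀) fun v _ => ?_
  simp only [← Finset.sum_smul]
  by_cases hv : i ((extChartAt (𝓡 d) y₀).symm v) ∈ K
  · rw [sum_chartPartition fun x₀ hne => hA x₀ _ hv hne, one_smul]
  · have h3 : η.inChart y₀ v = 0 := by
      rw [DiffForm.inChart, hη0 _ hv]
      rfl
    rw [chartIntegrand_eq, h3]
    simp

end IsBoundaryDefining

end BoundaryIntegral

/-! ### The residue formula -/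

section ResidueFormula

variable {d : ℕ} {X : Type*} [TopologicalSpace X] [ChartedSpace (EuclideanHalfSpace (d + 1)) X]
  [IsManifold (𝓡∂ (d + 1)) ∞ X] [T2Space X] [SigmaCompactSpace X]
  {Y : Type*} [TopologicalSpace Y] [ChartedSpace (EuclideanSpace ℝ (Fin d)) Y]
  [IsManifold (𝓡 d) ∞ Y] [T2Space Y] [SigmaCompactSpace Y]
  {i : Y → X} {lam : X → ℝ}

namespace IsBoundaryDefining

/-- Along `Y`, the smooth extension of `lam w` is `dlam ∧ σ`. -/
theorem extension_eq_wedge (h : IsBoundaryDefining d i lam) {q : ℕ} {V : Set X} (hV : IsOpen V)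
    {w : DiffForm (𝓡∂ (d + 1)) X (q + 1)} {σ : DiffForm (𝓡∂ (d + 1)) X q}
    {τ α : DiffForm (𝓡∂ (d + 1)) X (q + 1)} (hd : IsLogDecomposition i lam V w σ τ) {y : Y}
    (hy : i y ∈ V) (hα : α.SmoothAt (i y)) (hαw : ∀ x ∉ range i, α x = lam x • w x) :
    α (i y) = DiffForm.wedge (Nat.add_comm 1 q) (dForm lam) σ (i y) := by
  have key := h.eq_of_eventually_eq hα
    (β := fun z => DiffForm.wedge (Nat.add_comm 1 q) (dForm lam) σ z + lam z • τ z)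
    ((DiffForm.SmoothAt.wedge _ (DiffForm.smoothAt_dForm (h.contMDiff _)) (hd.1 _ hy)).add
      (DiffForm.SmoothAt.smul (h.contMDiff _) (hd.2.1 _ hy))) (by
    filter_upwards [hV.mem_nhds hy] with z hz hzi
    have hp := (h.pos z hzi).ne'
    rw [hαw z hzi, hd.2.2 z hz hzi]
    ext v
    have hp' : (lam z : ℂ) ≠ 0 := Complex.ofReal_ne_zero.2 hp
    simp only [ContinuousAlternatingMap.add_apply, ContinuousAlternatingMap.smul_apply,
      Complex.real_smul, Complex.ofReal_inv]
    field_simp)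
  rw [key]
  simp only [h.eq_zero _ (mem_range_self y)]
  ext v
  simp

/-- The residue formula. The form `lam (w ∧ φ)` extends smoothly, and along `Y` its extension is
`dlam ∧ (σ ∧ φ)`, where `σ` is given by a local decomposition of `w`. -/
theorem hasI₀_wedge (h : IsBoundaryDefining d i lam) (hi : IsBoundaryPart d i)
    {oX : ManifoldOrientation (𝓡∂ (d + 1)) X} {oY : ManifoldOrientation (𝓡 d) Y}
    (ho : IsBoundaryOrientation i oX oY) {q r : ℕ} (hqr : q + 1 + r = d + 1) (hqr' : q + r = d)
    {w : DiffForm (𝓡∂ (d + 1)) X (q + 1)} {φ : DiffForm (𝓡∂ (d + 1)) X r}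
    (hw : IsLogOn i lam univ w) (hφ : φ.SmoothOn univ) (hφc : IsCompact (closure {x | φ x ≠ 0})) :
    FormIntegrable oY (DiffForm.wedge hqr' (residue i w) (DiffForm.pullback i φ)) ∧
      HasI₀ oX lam (DiffForm.wedge hqr w φ)
        (formIntegral oY (DiffForm.wedge hqr' (residue i w) (DiffForm.pullback i φ))) := by
  obtain ⟨α, hα, hα'⟩ := hw.1
  have hφ0 : ∀ x ∉ closure {x | φ x ≠ 0}, φ x = 0 := fun x hx => by
    by_contra hne
    exact hx (subset_closure hne)
  have hθ0 : ∀ x ∉ closure {x | φ x ≠ 0}, DiffForm.wedge hqr α φ x = 0 := fun x hx => by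
    rw [DiffForm.wedge, hφ0 x hx, wedge_zero_right]
  have hA : ∀ x₀, ∀ x ∈ closure {x | φ x ≠ 0}, chartPartition (𝓡∂ (d + 1)) X x₀ x ≠ 0 →
      x₀ ∈ (finite_chartPartition (I := 𝓡∂ (d + 1)) hφc).toFinset := fun x₀ x hx hne =>
    (Set.Finite.mem_toFinset _).2 ⟨x, hx, hne⟩
  have h1 := h.hasI₀_sum (W := DiffForm.wedge hqr w φ) (θ := DiffForm.wedge hqr α φ) hi oX hφc
    (fun x => DiffForm.SmoothAt.wedge _ (hα x (mem_univ x)) (hφ x (mem_univ x))) hθ0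
    (fun x hx => by
      have h2 := hα' x (mem_univ x) hx
      simp only [DiffForm.wedge] at h2 ⊢
      rw [h2, wedge_real_smul_left]) hA
  have h2 := h.sum_integral_boundaryDensity hi ho hφc hθ0
    (η := DiffForm.wedge hqr' (residue i w) (DiffForm.pullback i φ))
    (fun y => DiffForm.SmoothAt.wedge _ (smoothAt_residue hi h isOpen_univ hw (mem_univ _))
      (DiffForm.SmoothAt.pullback hi.contMDiff (hφ _ (mem_univ _))))
    (fun y hy => by
      have h3 : (DiffForm.pullback i φ : DiffForm (𝓡 d) Y r) y = 0 := by
        rw [DiffForm.pullback, hφ0 _ hy]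
        rfl
      rw [DiffForm.wedge, h3, wedge_zero_right])
    (fun y => by
      obtain ⟨V, -, hV, hyV, σ, τ, hd⟩ :=
        h.exists_isLogDecomposition hi isOpen_univ hw (mem_univ (i y))
      refine ⟨DiffForm.wedge hqr' σ φ, ?_, ?_⟩
      · have h3 := h.extension_eq_wedge hV hd hyV (hα _ (mem_univ _))
          fun x hx => hα' x (mem_univ x) hx
        simp only [DiffForm.wedge] at h3 ⊢
        rw [h3, wedge_assoc_one hqr hqr']
      · rw [DiffForm.wedge, residue_eq_pullback hi h hV hd hyV]
        exact (wedge_compContinuousLinearMap _ _ _ _).symm) hA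
  rw [← h2.2]
  exact ⟨h2.1, h1⟩

/-- The residue vanishes in degree `0`, since a logarithmic `0`-form extends smoothly across `Y`. -/
theorem hasI₀_wedge_zero (h : IsBoundaryDefining d i lam) (hi : IsBoundaryPart d i)
    (oX : ManifoldOrientation (𝓡∂ (d + 1)) X)
    {w : DiffForm (𝓡∂ (d + 1)) X 0} {φ : DiffForm (𝓡∂ (d + 1)) X (d + 1)}
    (hw : IsLogOn i lam univ w) (hφ : φ.SmoothOn univ) (hφc : IsCompact (closure {x | φ x ≠ 0})) :
    HasI₀ oX lam (DiffForm.wedge (Nat.zero_add (d + 1)) w φ) 0 := by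
  obtain ⟨w', hw', hww'⟩ := h.extendsSmoothly_of_isLogOn_zero hi isOpen_univ hw
  have hφ0 : ∀ x ∉ closure {x | φ x ≠ 0}, φ x = 0 := fun x hx => by
    by_contra hne
    exact hx (subset_closure hne)
  have h1 := h.hasI₀_sum (W := DiffForm.wedge (Nat.zero_add (d + 1)) w φ)
    (θ := fun x => lam x • DiffForm.wedge (Nat.zero_add (d + 1)) w' φ x) hi oX hφc
    (fun x => DiffForm.SmoothAt.smul (h.contMDiff x)
      (DiffForm.SmoothAt.wedge _ (hw' x (mem_univ x)) (hφ x (mem_univ x))))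
    (fun x hx => by
      rw [DiffForm.wedge, hφ0 x hx, wedge_zero_right, smul_zero_form])
    (fun x hx => by
      have h2 := hww' x (mem_univ x) hx
      simp only [DiffForm.wedge]
      rw [h2])
    (A := (finite_chartPartition (I := 𝓡∂ (d + 1)) hφc).toFinset)
    fun x₀ x hx hne => (Set.Finite.mem_toFinset _).2 ⟨x, hx, hne⟩
  -- The form vanishes along `Y`, hence so do the boundary densities.
  have h2 : ∀ x₀ v, boundaryDensity i lam oX
      (fun x => lam x • DiffForm.wedge (Nat.zero_add (d + 1)) w' φ x) x₀ v = 0 := by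
    intro x₀ v
    by_cases hc : consE (0, v) ∈ (extChartAt (𝓡∂ (d + 1)) x₀).target ∧
        (extChartAt (𝓡∂ (d + 1)) x₀).symm (consE (0, v)) ∈ range i
    · have h3 : DiffForm.inChart (fun x => lam x • DiffForm.wedge (Nat.zero_add (d + 1)) w' φ x) x₀
          (consE (0, v)) = 0 := by
        rw [DiffForm.inChart, h.eq_zero _ hc.2]
        ext v
        exact zero_smul ℝ (_ : ℂ)
      rw [boundaryDensity, if_pos hc, chartIntegrandExt_of_mem oX hc.1, chartIntegrand_eq, h3]
      simp
    · exact if_neg hc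
  simpa only [h2, integral_zero, Finset.sum_const_zero] using h1

end IsBoundaryDefining

end ResidueFormula
end

theorem mainTheorem11 {d : ℕ}
    {X : Type*} [TopologicalSpace X] [ChartedSpace (EuclideanHalfSpace (d + 1)) X]
    [IsManifold (𝓡∂ (d + 1)) ∞ X] [T2Space X] [SigmaCompactSpace X]
    {Y : Type*} [TopologicalSpace Y] [ChartedSpace (EuclideanSpace ℝ (Fin d)) Y]
    [IsManifold (𝓡 d) ∞ Y] [T2Space Y] [SigmaCompactSpace Y]
    (i : Y → X) (hi : IsBoundaryPart d i)
    (oX : ManifoldOrientation (𝓡∂ (d + 1)) X) (oY : ManifoldOrientation (𝓡 d) Y)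
    (ho : IsBoundaryOrientation i oX oY)
    (lam : X → ℝ) (hlam : IsBoundaryDefining d i lam) :
    -- Logarithmic forms do not depend on `lam` ...
    (∀ lam' : X → ℝ, IsBoundaryDefining d i lam' →
      ∀ (p : ℕ) (U : Set X), IsOpen U → ∀ w : DiffForm (𝓡∂ (d + 1)) X p,
        (IsLogOn i lam U w ↔ IsLogOn i lam' U w)) ∧
    -- ... and form a complex of sheaves of complex vector spaces:
    -- the property is local, linear, and stable under the exterior derivative.
    (∀ (p : ℕ) (U : Set X), IsOpen U → ∀ w : DiffForm (𝓡∂ (d + 1)) X p,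
      (IsLogOn i lam U w ↔ ∀ x ∈ U, ∃ V ⊆ U, IsOpen V ∧ x ∈ V ∧ IsLogOn i lam V w) ∧
      (∀ w' : DiffForm (𝓡∂ (d + 1)) X p, ∀ a b : ℂ, IsLogOn i lam U w → IsLogOn i lam U w' →
        IsLogOn i lam U (fun x => a • w x + b • w' x)) ∧
      (IsLogOn i lam U w → IsLogOn i lam U w.d)) ∧
    -- Local decompositions exist, and the residue is given by any decomposition.
    (∀ (q : ℕ) (U : Set X), IsOpen U → ∀ w : DiffForm (𝓡∂ (d + 1)) X (q + 1),
      (IsLogOn i lam U w → ∀ x ∈ U, ∃ V ⊆ U, IsOpen V ∧ x ∈ V ∧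
        ∃ σ τ, IsLogDecomposition i lam V w σ τ) ∧
      (∀ lam' : X → ℝ, IsBoundaryDefining d i lam' → ∀ σ τ, IsLogDecomposition i lam' U w σ τ →
        ∀ y ∈ i ⁻¹' U, residue i w y = DiffForm.pullback i σ y)) ∧
    -- (i) The residue is a morphism of complexes of sheaves to the push-forward of the de Rham
    -- complex of `Y` shifted by `-1`: it takes smooth values, commutes with restrictions, is
    -- linear, and intertwines `d` with `-d`.
    (∀ (q : ℕ) (U : Set X), IsOpen U → ∀ w : DiffForm (𝓡∂ (d + 1)) X (q + 1),
      IsLogOn i lam U w →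
        (residue i w).SmoothOn (i ⁻¹' U) ∧
        (∀ V ⊆ U, IsOpen V → ∀ w' : DiffForm (𝓡∂ (d + 1)) X (q + 1),
          (∀ x ∈ V, x ∉ range i → w' x = w x) → ∀ y ∈ i ⁻¹' V, residue i w' y = residue i w y) ∧
        (∀ w' : DiffForm (𝓡∂ (d + 1)) X (q + 1), ∀ a b : ℂ, IsLogOn i lam U w' →
          ∀ y ∈ i ⁻¹' U, residue i (fun x => a • w x + b • w' x) y =
            a • residue i w y + b • residue i w' y) ∧
        (∀ y ∈ i ⁻¹' U, residue i w.d y = -(residue i w).d y)) ∧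
    (∀ U : Set X, IsOpen U → ∀ w : DiffForm (𝓡∂ (d + 1)) X 0, IsLogOn i lam U w →
      ∀ y ∈ i ⁻¹' U, residue i w.d y = 0) ∧
    -- (ii) `I₀(w ∧ φ) = ∫_Y R(w) ∧ φ`, whatever the function used to define `I₀`.
    (∀ (q r : ℕ) (h : q + 1 + r = d + 1) (w : DiffForm (𝓡∂ (d + 1)) X (q + 1))
      (φ : DiffForm (𝓡∂ (d + 1)) X r), IsLogOn i lam univ w → φ.SmoothOn univ →
      IsCompact (closure {x | φ x ≠ 0}) →
        FormIntegrable oY (DiffForm.wedge (by omega) (residue i w) (DiffForm.pullback i φ)) ∧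
        ∀ lam' : X → ℝ, IsBoundaryDefining d i lam' →
          HasI₀ oX lam' (DiffForm.wedge h w φ)
            (formIntegral oY
              (DiffForm.wedge (by omega) (residue i w) (DiffForm.pullback i φ)))) ∧
    (∀ (w : DiffForm (𝓡∂ (d + 1)) X 0) (φ : DiffForm (𝓡∂ (d + 1)) X (d + 1)),
      IsLogOn i lam univ w → φ.SmoothOn univ → IsCompact (closure {x | φ x ≠ 0}) →
        ∀ lam' : X → ℝ, IsBoundaryDefining d i lam' →
          HasI₀ oX lam' (DiffForm.wedge (Nat.zero_add (d + 1)) w φ) 0) := by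
  refine ⟨fun lam' hlam' p U hU w => ⟨hlam.isLogOn_of_isLogOn hi hlam' hU,
    hlam'.isLogOn_of_isLogOn hi hlam hU⟩,
    fun p U hU w => ⟨⟨fun hw x hx => ⟨U, Subset.rfl, hU, hx, hw⟩,
      fun hw => hlam.isLogOn_of_local (fun x hx => ?_) hU⟩,
      fun w' a b hw hw' => IsBoundaryDefining.isLogOn_add_smul a b hw hw', hlam.isLogOn_d hU⟩,
    fun q U hU w => ⟨fun hw x hx => hlam.exists_isLogDecomposition hi hU hw hx,
      fun lam' hlam' σ τ hd y hy => residue_eq_pullback hi hlam' hU hd hy⟩,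
    fun q U hU w hw => ⟨fun y hy => smoothAt_residue hi hlam hU hw hy,
      fun V hVU hV w' hww' y hy => residue_congr hi hlam hU hw hV hww' (hVU hy) hy,
      fun w' a b hw' y hy => residue_add_smul hi hlam hU hw hw' a b hy,
      fun y hy => residue_d hi hlam hU hw hy⟩,
    fun U hU w hw y hy => residue_d_zero hi hlam hU hw hy,
    fun q r h w φ hw hφ hφc => ⟨(hlam.hasI₀_wedge hi ho h (by omega) hw hφ hφc).1,
      fun lam' hlam' => (hlam'.hasI₀_wedge hi ho h (by omega)
        (hlam.isLogOn_of_isLogOn hi hlam' isOpen_univ hw) hφ hφc).2⟩,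
    fun w φ hw hφ hφc lam' hlam' => hlam'.hasI₀_wedge_zero hi oX
      (hlam.isLogOn_of_isLogOn hi hlam' isOpen_univ hw) hφ hφc⟩
  obtain ⟨V, -, hV, hxV, hw'⟩ := hw x hx
  exact ⟨V, hV, hxV, hw'⟩
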